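/- Identify the point $(x,y)$ of the plane with $x+iy$; write $\mathbf x^{im}=(x,-y)$ for the reflection of $\mathbf x=(x,y)$ in the line $y=0$, and $\hat y=(0,1)$. Let $J_p$ be the Bessel functions and $H_p=H_p^{(1)}$ the Hankel functions of the first kind, of integer order $p$. Let $k>0$ be the wave number and $\alpha\in\mathbb C$ with $\operatorname{Re}\alpha\ge 0$, $\operatorname{Im}\alpha\ge 0$ (for instance $\alpha>0$). Put $g(\mathbf x,\mathbf x_0)=\frac i4H_0(k|\mathbf x-\mathbf x_0|)$ and $\mu(s)=2i\alpha e^{i\alpha s}$, and let $$u_{\mathbf x_0}(\mathbf x)=g(\mathbf x,\mathbf x_0)+g(\mathbf x,\mathbf x_0^{im})+\int_0^\infty g(\mathbf x,\mathbf x_0^{im}-s\hat y)\,\mu(s)\,ds$$ be the domain Green's function of the Helmholtz equation in the half-space $y>0$ with the impedance condition $\partial u/\partial\mathbf n-i\alpha u=0$ on $y=0$ ($\mathbf n$ the outward normal), given by its free-space part, point image and complex line image. Here and below $\int_0^\infty=\lim_{T\to\infty}\int_0^T$. Let $R>0$. A configuration consists of finitely many sources $\mathbf x_1,\dots,\mathbf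 x_N$ with real strengths $q_1,\dots,q_N$, a centre $\mathbf x_c$ and a target $\mathbf x$. It is well separated (with radius $R$) if $|\mathbf x_j-\mathbf x_c|\le R$ for all $j$ and $|\mathbf x-\mathbf x_c|\ge 3R$. Its free-space multipole coefficients are $\alpha_p=\sum_j q_je^{-ip\theta_j}J_p(k\rho_j)$, where $(\rho_j,\theta_j)$ are the polar coordinates of $\mathbf x_j-\mathbf x_c$. We say that the free-space $P$-term expansion has accuracy $\varepsilon$ if, for every well-separated configuration in the plane with radius $R$ (and any $N$), $$\Big|\sum_jq_jg(\mathbf x,\mathbf x_j)-\frac i4\sum_{p=-P}^P\alpha_pH_p(k|\mathbf x-\mathbf x_c|)e^{ip\theta_c}\Big|\le\varepsilon\sum_j|q_j| ,$$ where $\theta_c$ is the polar angle of $\mathbf x-\mathbf x_c$. There is a constant $C$, which depends only on $kR$, such that the following holds. 1. For every $P\ge 0$, the free-space $P$-term expansion has accuracy $C\,3^{-P}$. 2. Take any $\alpha$ as above and any well-separated configuration with radius $R$ for which the disc of radius $R$ about $\mathbf x_c=(x_c,y_c)$ lies in the closed upper half-plane ($y_c\ge R$) and the target has $y\ge 0$.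 Let $\theta_{im}$ and $\hat\theta_{im}=\hat\theta_{im}(s)$ be the polar angles of $\mathbf x-\mathbf x_c^{im}$ and of $\mathbf x-(\mathbf x_c^{im}-s\hat y)$. Then: (a) for every $s\ge 0$ the image sources $\mathbf x_j^{im}-s\hat y$ with centre $\mathbf x_c^{im}-s\hat y$ and the target $\mathbf x$ are again well separated with radius $R$; (b) all line image integrals converge, both those in $u_{\mathbf x_j}(\mathbf x)$ and, for all $p\in\mathbb Z$, those in the expansion in (c); (c) for every $P$ and $\varepsilon$ for which the free-space $P$-term expansion has accuracy $\varepsilon$: for every $s\ge0$ (the point images for $s=0$, the line images at depth $s$ otherwise) $$\Big|\sum_jq_jg(\mathbf x,\mathbf x_j^{im}-s\hat y)-\frac i4\sum_{p=-P}^P\bar\alpha_pH_p(k|\mathbf x-(\mathbf x_c^{im}-s\hat y)|)e^{ip\hat\theta_{im}(s)}\Big|\le\varepsilon\sum_j|q_j| ,$$ and for the full field of the domain Green's function, with the same number of terms and the same accuracy up to the constant $C$, $$\Big|\sum_jq_ju_{\mathbf x_j}(\mathbf x)-\frac i4\sum_{p=-P}^P\alpha_pH_p(k|\mathbf x-\mathbf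 x_c|)e^{ip\theta_c}-\frac i4\sum_{p=-P}^P\bar\alpha_p\Big(H_p(k|\mathbf x-\mathbf x_c^{im}|)e^{ip\theta_{im}}+\int_0^\infty H_p(k|\mathbf x-(\mathbf x_c^{im}-s\hat y)|)e^{ip\hat\theta_{im}}\mu(s)\,ds\Big)\Big|\le C\,\varepsilon\sum_j|q_j| .$$ -/

import Mathlib

open scoped ComplexConjugate

namespace HalfSpaceHelmholtz

/-! Points of the plane are complex numbers: `(x, y)` is `x + i y`, the Euclidean norm is `‖·‖`,
the polar angle is `Complex.arg`, reflection in the line `y = 0` is complex conjugation, and the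
vertical unit vector is `Complex.I`. -/

/-- The Bessel function of the first kind `J_n(x)` of integer order, by Bessel's integral
`J_n(x) = (1/π) ∫_0^π cos (x sin t - n t) dt`. -/
noncomputable def besselJ (n : ℤ) (x : ℝ) : ℝ :=
  (1 / Real.pi) * ∫ t in (0 : ℝ)..Real.pi, Real.cos (x * Real.sin t - n * t)

/-- The Bessel function of the second kind `Y_n(x)` of integer order for `x > 0`, by Schläfli's
integral `Y_n(x) = (1/π) ∫_0^π sin (x sin t - n t) dt
  - (1/π) ∫_0^∞ (e^{n t} + (-1)^n e^{-n t}) e^{-x sinh t} dt`. -/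
noncomputable def besselY (n : ℤ) (x : ℝ) : ℝ :=
  (1 / Real.pi) * (∫ t in (0 : ℝ)..Real.pi, Real.sin (x * Real.sin t - n * t))
    - (1 / Real.pi) * ∫ t in Set.Ioi (0 : ℝ),
        (Real.exp (n * t) + (-1 : ℝ) ^ n * Real.exp (-(n * t))) * Real.exp (-(x * Real.sinh t))

/-- The Hankel function of the first kind `H_n(x) = J_n(x) + i Y_n(x)`, for `x > 0`. -/
noncomputable def hankel (n : ℤ) (x : ℝ) : ℂ :=
  (besselJ n x : ℂ) + Complex.I * (besselY n x : ℂ)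

/-- The free-space Green's function `g(x, x₀) = (i/4) H_0(k ‖x - x₀‖)`. -/
noncomputable def freeGreen (k : ℝ) (x x₀ : ℂ) : ℂ :=
  Complex.I / 4 * hankel 0 (k * ‖x - x₀‖)

/-- The outgoing cylindrical wave `H_p(k ρ) e^{i p θ}`, where `(ρ, θ)` are the polar coordinates
of `z`. -/
noncomputable def outgoingWave (k : ℝ) (p : ℤ) (z : ℂ) : ℂ :=
  hankel p (k * ‖z‖) * Complex.exp (Complex.I * p * Complex.arg z)

/-- The point at depth `s` on the line image of `x₀`, namely `x₀^im - s ŷ`. For `s = 0` it is the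
point image `x₀^im`. -/
noncomputable def lineImage (x₀ : ℂ) (s : ℝ) : ℂ := conj x₀ - s * Complex.I

/-- The complex line image density `μ(s) = 2 i α e^{i α s}`. -/
noncomputable def lineDensity (α : ℂ) (s : ℝ) : ℂ :=
  2 * Complex.I * α * Complex.exp (Complex.I * α * s)

/-- Convergence of the improper integral `∫_0^∞ f(s) ds = lim_{T → ∞} ∫_0^T f(s) ds`
(possibly only conditional). -/
def ImproperlyIntegrable (f : ℝ → ℂ) : Prop :=
  (∀ T : ℝ, 0 ≤ T → IntervalIntegrable f MeasureTheory.volume 0 T) ∧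
    ∃ L : ℂ, Filter.Tendsto (fun T : ℝ => ∫ s in (0 : ℝ)..T, f s) Filter.atTop (nhds L)

/-- The value of the improper integral `∫_0^∞ f(s) ds = lim_{T → ∞} ∫_0^T f(s) ds`. -/
noncomputable def improperIntegral (f : ℝ → ℂ) : ℂ :=
  Filter.limUnder Filter.atTop (fun T : ℝ => ∫ s in (0 : ℝ)..T, f s)

/-- The integrand `g(x, x₀^im - s ŷ) μ(s)` of the line image of a source at `x₀`. -/
noncomputable def lineGreen (k : ℝ) (α : ℂ) (x x₀ : ℂ) (s : ℝ) : ℂ :=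
  freeGreen k x (lineImage x₀ s) * lineDensity α s

/-- The integrand `H_p(k |x - (x_c^im - s ŷ)|) e^{i p θ̂} μ(s)`, where `θ̂` is the polar angle of
`x - (x_c^im - s ŷ)`. -/
noncomputable def lineWave (k : ℝ) (α : ℂ) (p : ℤ) (x xc : ℂ) (s : ℝ) : ℂ :=
  outgoingWave k p (x - lineImage xc s) * lineDensity α s

/-- The Green's function of the half-space with the impedance condition: free-space part, point
image and complex line image. -/
noncomputable def domainGreen (k : ℝ) (α : ℂ) (x x₀ : ℂ) : ℂ :=
  freeGreen k x x₀ + (freeGreen k x (conj x₀) + improperIntegral (lineGreen k α x x₀))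

/-- The free-space multipole coefficient `α_p = ∑ j, q_j e^{-i p θ_j} J_p(k ρ_j)`, where
`(ρ_j, θ_j)` are the polar coordinates of `x_j - x_c`. -/
noncomputable def multipoleCoeff (k : ℝ) {N : ℕ} (q : Fin N → ℝ) (xs : Fin N → ℂ) (xc : ℂ)
    (p : ℤ) : ℂ :=
  ∑ j, (q j : ℂ) * Complex.exp (-(Complex.I * p * Complex.arg (xs j - xc))) *
    (besselJ p (k * ‖xs j - xc‖) : ℂ)

/-- The expansion `(i/4) ∑_{p=-P}^{P} a_p H_p(k |x - c|) e^{i p θ}` about the centre `c`, where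
`θ` is the polar angle of `x - c`. -/
noncomputable def multipoleExpansion (k : ℝ) (P : ℕ) (a : ℤ → ℂ) (x c : ℂ) : ℂ :=
  Complex.I / 4 * ∑ p ∈ Finset.Icc (-(P : ℤ)) (P : ℤ), a p * outgoingWave k p (x - c)

/-- The expansion of the field of the domain Green's function built from the coefficients `a_p`
and their conjugates. -/
noncomputable def domainExpansion (k : ℝ) (α : ℂ) (P : ℕ) (a : ℤ → ℂ) (x xc : ℂ) : ℂ :=
  Complex.I / 4 * ∑ p ∈ Finset.Icc (-(P : ℤ)) (P : ℤ), a p * outgoingWave k p (x - xc) +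
  Complex.I / 4 * ∑ p ∈ Finset.Icc (-(P : ℤ)) (P : ℤ), conj (a p) *
    (outgoingWave k p (x - conj xc) + improperIntegral (lineWave k α p x xc))

/-- The sources `xs` lie in the disc of radius `R` about `xc`, and the target `x` is at distance
at least `3 R` from `xc`. -/
def WellSeparated (R : ℝ) {N : ℕ} (xs : Fin N → ℂ) (xc x : ℂ) : Prop :=
  (∀ j, ‖xs j - xc‖ ≤ R) ∧ 3 * R ≤ ‖x - xc‖

/-- The free-space expansion with cut-off `P` has accuracy `ε` (relative to the total strength of
the sources) for all well-separated configurations of radius `R`, with any number of sources. -/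
def FreeSpaceAccuracy (k R : ℝ) (P : ℕ) (ε : ℝ) : Prop :=
  ∀ (N : ℕ) (q : Fin N → ℝ) (xs : Fin N → ℂ) (xc x : ℂ), WellSeparated R xs xc x →
    ‖(∑ j, (q j : ℂ) * freeGreen k x (xs j)) -
      multipoleExpansion k P (multipoleCoeff k q xs xc) x xc‖ ≤ ε * ∑ j, |q j|

end HalfSpaceHelmholtz

namespace HalfSpaceHelmholtz

open MeasureTheory Filter Topology Set

/-! ### Fourier coefficients of absolutely convergent series -/

/-! The reflected coefficients are exact: conjugation maps the multipole coefficients of the sources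
to those of their images (`conj_sourceCoeff`), and reflection only moves a source configuration away
from a target in the upper half-plane. So the estimate at each fixed depth is free-space accuracy
applied to the image configuration. The full field does not follow by integrating it, since |μ| need
not be integrable and may be arbitrarily large. The proof compares three quantities of order
3^(-(P+1))/(P+1), with constants depending on kR only.

Upper bound for free space. Graf's addition theorem (`hasSum_graf`) gives the exact two-sided
series. It is obtained by integrating the Bessel generating function along the contour of the Hankel
function and rotating the contour. With J_p of size at most (kR/2)^p/p! and H_p of size at most
(2/(3kR))^p (p-1)!, the term of order p is O(3^(-p)/p), and so the tail is geometric.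

Upper bound for line images. The integrals of H_p e^{ipθ} μ up to T satisfy the same growth bound in
p as H_p itself, uniformly in α and T (`norm_integral_lineIntegrand_le`). Writing H_p by its contour
integral leaves integrals of e^{c r(s)} e^{ipθ(s)} iα e^{iαs} in s. For imaginary c, the phase c r +
α s has no stationary point because Re α ≥ 0 and r' ≥ 0, and one integration by parts leaves only
bounded variations. For negative c, iα e^{iαs} is integrated exactly. The variation of e^{ipθ} costs
a factor |p|; the decay of e^{cr} repays it by lowering the exponential moment by one order.

Lower bound for ε. With a single source at distance R and the target running over the circle of
radius 3R, the truncation error is a Fourier series in the angle, and each omitted coefficient is at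
most ε (`FreeSpaceAccuracy.le_of_lt`). Leading-order lower bounds for J_p and H_p then give ε ≥ c
3^(-(P+1))/(P+1) (`exists_le_accuracy`), so the line image error is at most a constant times ε.

Convergence of the line integrals uses the same integration by parts with dominated convergence; the
boundary term at T vanishes in the limit only after integration over the contour, by the
Riemann–Lebesgue lemma (`tendsto_boundary`). -/

theorem integral_exp_int_mul_I (n : ℤ) :
    ∫ θ in (0 : ℝ)..2 * Real.pi, Complex.exp (Complex.I * n * θ) =
      if n = 0 then 2 * (Real.pi : ℂ) else 0 := by
  split_ifs with h
  · simp [h]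
  · have hn : Complex.I * (n : ℂ) ≠ 0 := by simp [h]
    rw [integral_exp_mul_complex hn]
    have : Complex.I * n * ((2 * Real.pi : ℝ) : ℂ) = n * (2 * Real.pi * Complex.I) := by
      push_cast; ring
    rw [this, Complex.exp_int_mul_two_pi_mul_I]
    simp

theorem norm_exp_I_mul_int_mul (m : ℤ) (θ : ℝ) : ‖Complex.exp (Complex.I * m * θ)‖ = 1 := by
  rw [Complex.norm_exp]; simp

theorem norm_exp_neg_I_mul_int_mul (m : ℤ) (θ : ℝ) :
    ‖Complex.exp (-(Complex.I * m * θ))‖ = 1 := by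
  rw [Complex.norm_exp]; simp

/-- Absolute summability permits termwise integration, and orthogonality leaves one term. It serves
to identify Bessel's integral with a power series coefficient and to isolate one mode of the
truncation error. -/
theorem integral_mul_exp_of_hasSum {c : ℤ → ℂ} {f : ℝ → ℂ} (hc : Summable fun m => ‖c m‖)
    (hf : ∀ θ : ℝ, HasSum (fun m => c m * Complex.exp (Complex.I * m * θ)) (f θ)) (p : ℤ) :
    ∫ θ in (0 : ℝ)..2 * Real.pi, f θ * Complex.exp (-(Complex.I * p * θ)) =
      2 * Real.pi * c p := by
  have h1 : HasSum (fun m : ℤ => ∫ θ in (0 : ℝ)..2 * Real.pi,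
      c m * Complex.exp (Complex.I * (m - p : ℤ) * θ))
      (∫ θ in (0 : ℝ)..2 * Real.pi, f θ * Complex.exp (-(Complex.I * p * θ))) := by
    refine intervalIntegral.hasSum_integral_of_dominated_convergence (fun m _ => ‖c m‖)
      (fun m => Continuous.aestronglyMeasurable (by fun_prop)) (fun m => ?_)
      (Eventually.of_forall fun _ _ => hc) intervalIntegrable_const
      (Eventually.of_forall fun θ _ => ?_)
    · refine Eventually.of_forall fun θ _ => ?_
      rw [norm_mul, norm_exp_I_mul_int_mul, mul_one]
    · have h := (hf θ).mul_right (Complex.exp (-(Complex.I * p * θ)))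
      have h' : (fun m : ℤ => c m * Complex.exp (Complex.I * m * θ) *
          Complex.exp (-(Complex.I * p * θ))) =
          fun m : ℤ => c m * Complex.exp (Complex.I * (m - p : ℤ) * θ) := by
        funext m
        rw [mul_assoc, ← Complex.exp_add]
        congr 2
        push_cast; ring
      rwa [h'] at h
  have h2 : HasSum (fun m : ℤ => ∫ θ in (0 : ℝ)..2 * Real.pi,
      c m * Complex.exp (Complex.I * (m - p : ℤ) * θ)) (2 * Real.pi * c p) := by
    convert hasSum_single (f := fun m : ℤ => ∫ θ in (0 : ℝ)..2 * Real.pi,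
      c m * Complex.exp (Complex.I * (m - p : ℤ) * θ)) p ?_ using 1
    · simp [mul_comm]
    · intro m hm
      rw [intervalIntegral.integral_const_mul, integral_exp_int_mul_I,
        if_neg (sub_ne_zero.2 hm), mul_zero]
  exact h1.unique h2

theorem norm_coeff_le_of_hasSum {c : ℤ → ℂ} {f : ℝ → ℂ} {ε : ℝ} (hc : Summable fun m => ‖c m‖)
    (hf : ∀ θ : ℝ, HasSum (fun m => c m * Complex.exp (Complex.I * m * θ)) (f θ))
    (hε : ∀ θ, ‖f θ‖ ≤ ε) (p : ℤ) : ‖c p‖ ≤ ε := by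
  have h := intervalIntegral.norm_integral_le_of_norm_le_const (a := 0) (b := 2 * Real.pi)
    (f := fun θ : ℝ => f θ * Complex.exp (-(Complex.I * p * θ))) (C := ε) (fun θ _ => by
      rw [norm_mul, norm_exp_neg_I_mul_int_mul, mul_one]; exact hε θ)
  rw [integral_mul_exp_of_hasSum hc hf] at h
  have hpi := Real.pi_pos
  rw [norm_mul, sub_zero, abs_of_pos (by positivity : (0 : ℝ) < 2 * Real.pi)] at h
  have : ‖(2 * Real.pi : ℂ)‖ = 2 * Real.pi := by
    simp [abs_of_pos hpi]
  rw [this] at h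
  nlinarith

/-! ### The generating function of the Bessel functions -/

/-- The terms of the product of the exponential series of `x / 2` and `-x / 2`. -/
noncomputable def besselTerm (x : ℝ) (q : ℕ × ℕ) : ℝ :=
  (x / 2) ^ q.1 / q.1.factorial * ((-(x / 2)) ^ q.2 / q.2.factorial)

/-- The coefficient of `T ^ m` in `exp ((x / 2) (T - 1 / T))`. -/
noncomputable def besselSeries (m : ℤ) (x : ℝ) : ℝ :=
  ∑' q : {q : ℕ × ℕ // (q.1 : ℤ) - q.2 = m}, besselTerm x q

theorem hasSum_besselTerm_mul (x : ℝ) {T : ℂ} (hT : T ≠ 0) :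
    HasSum (fun q : ℕ × ℕ => (besselTerm x q : ℂ) * T ^ ((q.1 : ℤ) - q.2))
      (Complex.exp ((x / 2 : ℝ) * (T - T⁻¹))) ∧
    Summable (fun q : ℕ × ℕ => ‖(besselTerm x q : ℂ) * T ^ ((q.1 : ℤ) - q.2)‖) := by
  have h1 : ∀ z : ℂ, HasSum (fun n : ℕ => z ^ n / n.factorial) (Complex.exp z) := fun z => by
    rw [Complex.exp_eq_exp_ℂ]; exact NormedSpace.expSeries_div_hasSum_exp z
  have h2 : ∀ z : ℂ, Summable (fun n : ℕ => ‖z ^ n / n.factorial‖) := fun z =>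
    NormedSpace.norm_expSeries_div_summable z
  have key : (fun q : ℕ × ℕ => (besselTerm x q : ℂ) * T ^ ((q.1 : ℤ) - q.2)) = fun q : ℕ × ℕ =>
      (((x / 2 : ℝ) * T) ^ q.1 / q.1.factorial) * ((-((x / 2 : ℝ) * T⁻¹)) ^ q.2 / q.2.factorial) := by
    funext q
    rw [besselTerm, zpow_sub₀ hT, zpow_natCast, zpow_natCast]
    push_cast
    rw [mul_pow, ← neg_mul, mul_pow, inv_pow]
    ring
  have hs := summable_mul_of_summable_norm (h2 ((x / 2 : ℝ) * T)) (h2 (-((x / 2 : ℝ) * T⁻¹)))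
  refine ⟨?_, ?_⟩
  · rw [key]
    have := (h1 ((x / 2 : ℝ) * T)).mul (h1 (-((x / 2 : ℝ) * T⁻¹))) hs
    rwa [← Complex.exp_add, show ((x / 2 : ℝ) : ℂ) * T + -((x / 2 : ℝ) * T⁻¹) =
      (x / 2 : ℝ) * (T - T⁻¹) by ring] at this
  · rw [summable_norm_iff, key]; exact hs

theorem summable_abs_besselTerm (x : ℝ) : Summable (fun q => |besselTerm x q|) := by
  simpa using (hasSum_besselTerm_mul x one_ne_zero).2

/-- The absolutely convergent product of the two exponential series is regrouped along the fibres on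
which the exponent of T is constant. -/
theorem hasSum_besselSeries_mul (x : ℝ) {T : ℂ} (hT : T ≠ 0) :
    HasSum (fun m : ℤ => (besselSeries m x : ℂ) * T ^ m)
      (Complex.exp ((x / 2 : ℝ) * (T - T⁻¹))) := by
  have h := (Equiv.sigmaFiberEquiv (fun q : ℕ × ℕ => (q.1 : ℤ) - q.2)).hasSum_iff.2
    (hasSum_besselTerm_mul x hT).1
  refine h.sigma fun m => ?_
  have h3 : HasSum (fun q : {q : ℕ × ℕ // (q.1 : ℤ) - q.2 = m} => besselTerm x q)
      (besselSeries m x) := ((summable_abs_besselTerm x).of_abs.subtype _).hasSum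
  have h4 := (Complex.hasSum_ofReal.2 h3).mul_right (T ^ m)
  have h5 : (fun q : {q : ℕ × ℕ // (q.1 : ℤ) - q.2 = m} => (besselTerm x q : ℂ) * T ^ m) =
      fun q : {q : ℕ × ℕ // (q.1 : ℤ) - q.2 = m} =>
        (besselTerm x q : ℂ) * T ^ ((q.1.1 : ℤ) - q.1.2) := by
    funext q; rw [q.2]
  rw [h5] at h4
  exact h4

theorem summable_norm_besselSeries (x : ℝ) : Summable (fun m : ℤ => |besselSeries m x|) := by
  have h := ((Equiv.sigmaFiberEquiv (fun q : ℕ × ℕ => (q.1 : ℤ) - q.2)).summable_iff.2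
    (summable_abs_besselTerm x)).sigma
  refine Summable.of_nonneg_of_le (fun _ => abs_nonneg _) (fun m => ?_) h
  have h2 : Summable fun q : {q : ℕ × ℕ // (q.1 : ℤ) - q.2 = m} => ‖besselTerm x q‖ :=
    (summable_abs_besselTerm x).subtype {q : ℕ × ℕ | (q.1 : ℤ) - q.2 = m}
  have h3 := norm_tsum_le_tsum_norm h2
  rw [Real.norm_eq_abs] at h3
  exact h3

/-- At T = e^{iθ} the generating function is e^{ix sin θ}, so both sides are its m-th Fourier
coefficient. Periodicity moves the period to [-π, π], and folding at 0 produces the cosine of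
Bessel's integral. -/
theorem besselJ_eq_besselSeries (m : ℤ) (x : ℝ) : besselJ m x = besselSeries m x := by
  have h1 := integral_mul_exp_of_hasSum (c := fun m => (besselSeries m x : ℂ))
    (f := fun θ : ℝ => Complex.exp (Complex.I * (x * Real.sin θ : ℝ)))
    (by simpa using summable_norm_besselSeries x) (fun θ => by
      convert hasSum_besselSeries_mul x (Complex.exp_ne_zero (Complex.I * θ)) using 2
      · rw [← Complex.exp_int_mul]; congr 2; ring
      · rw [← Complex.exp_neg, Complex.ofReal_mul, Complex.ofReal_sin, Complex.sin]
        push_cast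
        rw [show -(θ : ℂ) * Complex.I = -(Complex.I * θ) by ring,
          show (θ : ℂ) * Complex.I = Complex.I * θ by ring]
        linear_combination (x / 2 : ℂ) * (Complex.exp (-(Complex.I * θ)) -
          Complex.exp (Complex.I * θ)) * Complex.I_sq) m
  set F : ℝ → ℂ := fun θ => Complex.exp (Complex.I * (x * Real.sin θ : ℝ)) *
    Complex.exp (-(Complex.I * m * θ)) with hF
  have hc : Continuous F := by fun_prop
  have hper : Function.Periodic F (2 * Real.pi) := by
    intro θ
    simp only [hF, Real.sin_add_two_pi]
    congr 1
    rw [Complex.exp_eq_exp_iff_exists_int]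
    refine ⟨-m, ?_⟩
    push_cast; ring
  have h2 : ∫ θ in (0 : ℝ)..2 * Real.pi, F θ = ∫ θ in (-Real.pi)..Real.pi, F θ := by
    have := hper.intervalIntegral_add_eq 0 (-Real.pi)
    simpa [show -Real.pi + 2 * Real.pi = Real.pi by ring] using this
  have h3 : ∫ θ in (-Real.pi)..Real.pi, F θ =
      ∫ θ in (0 : ℝ)..Real.pi, ((2 * Real.cos (x * Real.sin θ - m * θ) : ℝ) : ℂ) := by
    rw [← intervalIntegral.integral_add_adjacent_intervals (b := 0)
      (hc.intervalIntegrable _ _) (hc.intervalIntegrable _ _)]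
    have : ∫ θ in (-Real.pi)..0, F θ = ∫ θ in (0 : ℝ)..Real.pi, F (-θ) := by
      rw [intervalIntegral.integral_comp_neg]; simp
    rw [this, ← intervalIntegral.integral_add ((show Continuous fun θ => F (-θ) from
        hc.comp continuous_neg).intervalIntegrable _ _)
      (hc.intervalIntegrable _ _)]
    refine intervalIntegral.integral_congr fun θ _ => ?_
    simp only [hF, Real.sin_neg]
    rw [← Complex.exp_add, ← Complex.exp_add, Complex.ofReal_mul 2, Complex.ofReal_cos, Complex.cos]
    push_cast
    rw [mul_div_cancel₀ _ (two_ne_zero), add_comm]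
    congr 2 <;> ring
  rw [h2, h3, intervalIntegral.integral_ofReal, intervalIntegral.integral_const_mul] at h1
  have h4 : 2 * ∫ θ in (0 : ℝ)..Real.pi, Real.cos (x * Real.sin θ - m * θ) =
      2 * Real.pi * besselSeries m x := by exact_mod_cast h1
  have hpi := Real.pi_pos
  rw [besselJ]
  field_simp
  linarith

theorem hasSum_besselJ_mul_zpow (x : ℝ) {T : ℂ} (hT : T ≠ 0) :
    HasSum (fun m : ℤ => (besselJ m x : ℂ) * T ^ m)
      (Complex.exp ((x / 2 : ℝ) * (T - T⁻¹))) := by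
  simp_rw [besselJ_eq_besselSeries]
  exact hasSum_besselSeries_mul x hT

theorem summable_abs_besselJ (x : ℝ) : Summable (fun m : ℤ => |besselJ m x|) := by
  simp_rw [besselJ_eq_besselSeries]
  exact summable_norm_besselSeries x

theorem abs_besselJ_neg (m : ℤ) (x : ℝ) : |besselJ (-m) x| = |besselJ m x| := by
  have : besselJ (-m) x = (-1) ^ m * besselJ m x := by
    have h := intervalIntegral.integral_comp_sub_left (a := 0) (b := Real.pi)
      (fun t : ℝ => Real.cos (x * Real.sin t - (-m : ℤ) * t)) Real.pi
    simp only [sub_zero, sub_self] at h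
    have e : ∀ t : ℝ, Real.cos (x * Real.sin (Real.pi - t) - (-m : ℤ) * (Real.pi - t)) =
        (-1) ^ m * Real.cos (x * Real.sin t - m * t) := fun t => by
      rw [← Real.cos_add_int_mul_pi, Real.sin_pi_sub]
      congr 1
      push_cast; ring
    simp only [e, intervalIntegral.integral_const_mul] at h
    rw [besselJ, ← h, besselJ]
    ring
  rw [this, abs_mul, abs_zpow, abs_neg, abs_one, one_zpow, one_mul]

theorem abs_besselJ_natAbs (m : ℤ) (x : ℝ) : |besselJ m x| = |besselJ m.natAbs x| := by
  rcases Int.natAbs_eq m with h | h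
  · rw [← h]
  · conv_lhs => rw [h]
    exact abs_besselJ_neg _ _

theorem hasSum_besselJ_nat (n : ℕ) (x : ℝ) :
    HasSum (fun l : ℕ => besselTerm x (l + n, l)) (besselJ n x) := by
  rw [besselJ_eq_besselSeries]
  have h3 : HasSum (fun q : {q : ℕ × ℕ // (q.1 : ℤ) - q.2 = n} => besselTerm x q)
      (besselSeries n x) := ((summable_abs_besselTerm x).of_abs.subtype _).hasSum
  let e : ℕ ≃ {q : ℕ × ℕ // (q.1 : ℤ) - q.2 = n} :=
    { toFun := fun l => ⟨(l + n, l), by push_cast; ring⟩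
      invFun := fun q => q.1.2
      left_inv := fun _ => rfl
      right_inv := fun q => by
        obtain ⟨⟨a, b⟩, h⟩ := q
        simp only [Subtype.mk.injEq, Prod.mk.injEq, and_true] at h ⊢
        omega }
  exact e.hasSum_iff.2 h3

theorem abs_besselTerm_le (n l : ℕ) {x : ℝ} (hx : 0 ≤ x) :
    |besselTerm x (l + n, l)| ≤ (x / 2) ^ n / n.factorial * ((x ^ 2 / 4) ^ l / l.factorial) := by
  have h0 : 0 ≤ x / 2 := by positivity
  rw [besselTerm, abs_mul, abs_div, abs_div, abs_pow, abs_pow, abs_neg, abs_of_nonneg h0,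
    Nat.abs_cast, Nat.abs_cast]
  have h1 : (n.factorial : ℝ) ≤ (l + n).factorial := by
    exact_mod_cast Nat.factorial_le (by omega)
  have h2 : (x ^ 2 / 4) ^ l = (x / 2) ^ l * (x / 2) ^ l := by
    rw [← mul_pow]; congr 1; ring
  calc (x / 2) ^ (l + n) / (l + n).factorial * ((x / 2) ^ l / l.factorial)
      ≤ (x / 2) ^ (l + n) / n.factorial * ((x / 2) ^ l / l.factorial) := by gcongr
    _ = _ := by rw [h2, pow_add]; ring

theorem abs_besselTerm_succ_le (n l : ℕ) {x : ℝ} (hx : 0 ≤ x) :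
    |besselTerm x (l + 1 + n, l + 1)| ≤ (x / 2) ^ n / n.factorial / (n + 1) *
      ((x ^ 2 / 4) ^ (l + 1) / (l + 1).factorial) := by
  have h0 : 0 ≤ x / 2 := by positivity
  rw [besselTerm, abs_mul, abs_div, abs_div, abs_pow, abs_pow, abs_neg, abs_of_nonneg h0,
    Nat.abs_cast, Nat.abs_cast]
  have h1 : (n.factorial * (n + 1) : ℝ) ≤ (l + 1 + n).factorial := by
    have := Nat.factorial_le (show n + 1 ≤ l + 1 + n by omega)
    rw [Nat.factorial_succ, mul_comm] at this
    exact_mod_cast this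
  have h2 : (x ^ 2 / 4) ^ (l + 1) = (x / 2) ^ (l + 1) * (x / 2) ^ (l + 1) := by
    rw [← mul_pow]; congr 1; ring
  calc (x / 2) ^ (l + 1 + n) / (l + 1 + n).factorial * ((x / 2) ^ (l + 1) / (l + 1).factorial)
      ≤ (x / 2) ^ (l + 1 + n) / (n.factorial * (n + 1)) *
        ((x / 2) ^ (l + 1) / (l + 1).factorial) := by gcongr
    _ = _ := by rw [h2, pow_add _ (l + 1) n]; field_simp

theorem hasSum_real_exp (y : ℝ) : HasSum (fun l : ℕ => y ^ l / l.factorial) (Real.exp y) := by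
  rw [Real.exp_eq_exp_ℝ]; exact NormedSpace.expSeries_div_hasSum_exp y

theorem abs_besselJ_le (m : ℤ) {x : ℝ} (hx : 0 ≤ x) :
    |besselJ m x| ≤ (x / 2) ^ m.natAbs / m.natAbs.factorial * Real.exp (x ^ 2 / 4) := by
  rw [abs_besselJ_natAbs]
  have h1 := hasSum_besselJ_nat m.natAbs x
  have h2 := (hasSum_real_exp (x ^ 2 / 4)).mul_left ((x / 2) ^ m.natAbs / m.natAbs.factorial)
  rw [← h1.tsum_eq]
  exact tsum_of_norm_bounded (f := fun l => besselTerm x (l + m.natAbs, l)) h2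
    fun l => abs_besselTerm_le _ _ hx

/-- The first term of the power series dominates: every later term has a factorial at least (n+1)!
in its denominator, which gains 1/(n+1). -/
theorem le_besselJ (n : ℕ) {x : ℝ} (hx : 0 ≤ x) :
    (x / 2) ^ n / n.factorial * (1 - Real.exp (x ^ 2 / 4) / (n + 1)) ≤ besselJ n x := by
  have h1 := (hasSum_nat_add_iff' 1).2 (hasSum_besselJ_nat n x)
  have h2 := ((hasSum_nat_add_iff' 1).2 (hasSum_real_exp (x ^ 2 / 4))).mul_left
    ((x / 2) ^ n / n.factorial / (n + 1))
  have h3 := tsum_of_norm_bounded (f := fun l => besselTerm x (l + 1 + n, l + 1)) h2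
    fun l => abs_besselTerm_succ_le _ _ hx
  rw [h1.tsum_eq] at h3
  have h4 : besselTerm x (0 + n, 0) = (x / 2) ^ n / n.factorial := by simp [besselTerm]
  simp only [Finset.range_one, Finset.sum_singleton, h4, pow_zero, Nat.factorial_zero,
    Nat.cast_one, div_one] at h3
  have h5 := (abs_le.1 (Real.norm_eq_abs _ ▸ h3)).1
  have h6 : 0 ≤ (x / 2) ^ n / n.factorial / (n + 1) := by positivity
  have h7 : (x / 2) ^ n / n.factorial * (1 - Real.exp (x ^ 2 / 4) / (n + 1)) =
    (x / 2) ^ n / n.factorial - (x / 2) ^ n / n.factorial / (n + 1) * Real.exp (x ^ 2 / 4) := by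
    ring
  rw [h7]
  nlinarith

/-! ### Exponential moments of `exp (-x sinh t)` -/

theorem integral_pow_mul_exp_neg_mul (m : ℕ) {x : ℝ} (hx : 0 < x) :
    ∫ v in Ioi (0 : ℝ), v ^ m * Real.exp (-(x * v)) = m.factorial / x ^ (m + 1) := by
  have h := Real.integral_rpow_mul_exp_neg_mul_Ioi (a := m + 1) (r := x) (by positivity) hx
  rw [Real.Gamma_nat_eq_factorial] at h
  simp only [add_sub_cancel_right, Real.rpow_natCast] at h
  rw [h, show (m : ℝ) + 1 = ((m + 1 : ℕ) : ℝ) by push_cast; rfl, Real.rpow_natCast, one_div,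
    inv_pow, div_eq_inv_mul]

theorem integrableOn_pow_mul_exp_neg_mul (m : ℕ) {x : ℝ} (hx : 0 < x) :
    IntegrableOn (fun v : ℝ => v ^ m * Real.exp (-(x * v))) (Ioi 0) := by
  refine Integrable.of_integral_ne_zero ?_
  rw [integral_pow_mul_exp_neg_mul m hx]
  positivity

theorem image_sinh_add_Ioi (c : ℝ) : (fun t => Real.sinh t + c) '' Ioi 0 = Ioi c := by
  ext v
  simp only [mem_image, mem_Ioi]
  constructor
  · rintro ⟨t, ht, rfl⟩
    have := Real.sinh_pos_iff.2 ht
    linarith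
  · intro hv
    exact ⟨Real.arsinh (v - c), Real.arsinh_pos_iff.2 (by linarith), by simp⟩

/-- The substitution is v = sinh t + c. The shift c = 1/2 serves the upper bound on the moments and
c = 0 the lower bound. -/
theorem sinh_substitution (m : ℕ) {x c : ℝ} (hx : 0 < x) (hc : 0 ≤ c) :
    IntegrableOn (fun t => Real.cosh t * ((Real.sinh t + c) ^ m *
      Real.exp (-(x * (Real.sinh t + c))))) (Ioi 0) ∧
    ∫ t in Ioi (0 : ℝ), Real.cosh t * ((Real.sinh t + c) ^ m *
      Real.exp (-(x * (Real.sinh t + c)))) = ∫ v in Ioi c, v ^ m * Real.exp (-(x * v)) := by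
  have hd : ∀ t ∈ Ioi (0 : ℝ), HasDerivWithinAt (fun t => Real.sinh t + c) (Real.cosh t) (Ioi 0) t :=
    fun t _ => ((Real.hasDerivAt_sinh t).add_const c).hasDerivWithinAt
  have hi : InjOn (fun t => Real.sinh t + c) (Ioi 0) := fun a _ b _ h =>
    Real.sinh_injective (by simpa using h)
  have h1 := integrableOn_image_iff_integrableOn_abs_deriv_smul measurableSet_Ioi hd hi
    (fun v => v ^ m * Real.exp (-(x * v)))
  have h2 := integral_image_eq_integral_abs_deriv_smul measurableSet_Ioi hd hi
    (fun v => v ^ m * Real.exp (-(x * v)))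
  simp only [image_sinh_add_Ioi, abs_of_pos (Real.cosh_pos _), smul_eq_mul] at h1 h2
  exact ⟨h1.1 ((integrableOn_pow_mul_exp_neg_mul m hx).mono_set (Ioi_subset_Ioi hc)), h2.symm⟩

theorem exp_le_two_mul_sinh_add_one {t : ℝ} (ht : 0 ≤ t) : Real.exp t ≤ 2 * Real.sinh t + 1 := by
  have : Real.exp (-t) ≤ 1 := Real.exp_le_one_iff.2 (by linarith)
  rw [Real.sinh_eq]; linarith

theorem exp_le_two_mul_cosh (t : ℝ) : Real.exp t ≤ 2 * Real.cosh t := by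
  have := Real.exp_pos (-t)
  rw [Real.cosh_eq]; linarith

theorem cosh_le_exp {t : ℝ} (ht : 0 ≤ t) : Real.cosh t ≤ Real.exp t := by
  have : Real.exp (-t) ≤ Real.exp t := Real.exp_le_exp.2 (by linarith)
  rw [Real.cosh_eq]; linarith

theorem two_mul_sinh_le_exp (t : ℝ) : 2 * Real.sinh t ≤ Real.exp t := by
  have := Real.exp_pos (-t)
  rw [Real.sinh_eq]; linarith

/-- The moment `∫_0^∞ e^{n t} e^{-x sinh t} dt`. -/
noncomputable def expMoment (n : ℕ) (x : ℝ) : ℝ :=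
  ∫ t in Ioi (0 : ℝ), Real.exp (n * t) * Real.exp (-(x * Real.sinh t))

/-- One of the m+1 factors e^t is spent on 2 cosh t, the Jacobian of the substitution; the others
are bounded by 2 (sinh t + 1/2). The factor e^{x/2} undoes the shift in the exponent. -/
theorem exp_succ_mul_le (m : ℕ) (x : ℝ) {t : ℝ} (ht : 0 ≤ t) :
    Real.exp ((m + 1 : ℕ) * t) * Real.exp (-(x * Real.sinh t)) ≤
      2 ^ (m + 1) * Real.exp (x / 2) * (Real.cosh t * ((Real.sinh t + 1 / 2) ^ m *
        Real.exp (-(x * (Real.sinh t + 1 / 2))))) := by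
  have h0 : Real.exp (-(x * Real.sinh t)) =
      Real.exp (x / 2) * Real.exp (-(x * (Real.sinh t + 1 / 2))) := by
    rw [← Real.exp_add]; congr 1; ring
  have h1 : Real.exp ((m + 1 : ℕ) * t) ≤ (2 * (Real.sinh t + 1 / 2)) ^ m * (2 * Real.cosh t) := by
    rw [Real.exp_nat_mul, pow_succ]
    have := exp_le_two_mul_sinh_add_one ht
    have h3 := exp_le_two_mul_cosh t
    have h4 := Real.exp_pos t
    gcongr
    linarith
  rw [h0]
  calc _ ≤ (2 * (Real.sinh t + 1 / 2)) ^ m * (2 * Real.cosh t) *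
        (Real.exp (x / 2) * Real.exp (-(x * (Real.sinh t + 1 / 2)))) := by gcongr
    _ = _ := by rw [mul_pow, pow_succ]; ring

theorem integrableOn_expMoment_succ (m : ℕ) {x : ℝ} (hx : 0 < x) :
    IntegrableOn (fun t : ℝ => Real.exp ((m + 1 : ℕ) * t) * Real.exp (-(x * Real.sinh t)))
      (Ioi 0) := by
  refine Integrable.mono' ((sinh_substitution m hx (by norm_num : (0 : ℝ) ≤ 1 / 2)).1.const_mul
    (2 ^ (m + 1) * Real.exp (x / 2))) (Continuous.aestronglyMeasurable (by fun_prop)) ?_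
  refine (ae_restrict_mem measurableSet_Ioi).mono fun t ht => ?_
  rw [Real.norm_of_nonneg (by positivity)]
  exact exp_succ_mul_le m x (le_of_lt ht)

theorem integrableOn_expMoment (n : ℕ) {x : ℝ} (hx : 0 < x) :
    IntegrableOn (fun t : ℝ => Real.exp (n * t) * Real.exp (-(x * Real.sinh t))) (Ioi 0) := by
  refine Integrable.mono' (integrableOn_expMoment_succ n hx)
    (Continuous.aestronglyMeasurable (by fun_prop)) ?_
  refine (ae_restrict_mem measurableSet_Ioi).mono fun t ht => ?_
  rw [Real.norm_of_nonneg (by positivity)]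
  have : (0 : ℝ) ≤ t := le_of_lt ht
  gcongr
  linarith

theorem expMoment_nonneg (n : ℕ) (x : ℝ) : 0 ≤ expMoment n x :=
  integral_nonneg fun _ => by positivity

theorem expMoment_mono {m n : ℕ} (h : m ≤ n) {x : ℝ} (hx : 0 < x) :
    expMoment m x ≤ expMoment n x := by
  refine setIntegral_mono_on (integrableOn_expMoment m hx) (integrableOn_expMoment n hx)
    measurableSet_Ioi fun t ht => ?_
  have : (0 : ℝ) ≤ t := le_of_lt ht
  gcongr

theorem expMoment_antitone (n : ℕ) {x y : ℝ} (hx : 0 < x) (hxy : x ≤ y) :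
    expMoment n y ≤ expMoment n x := by
  refine setIntegral_mono_on (integrableOn_expMoment n (hx.trans_le hxy))
    (integrableOn_expMoment n hx) measurableSet_Ioi fun t ht => ?_
  have : 0 < Real.sinh t := Real.sinh_pos_iff.2 ht
  gcongr

theorem expMoment_succ_le (m : ℕ) {x : ℝ} (hx : 0 < x) :
    expMoment (m + 1) x ≤ (2 / x) ^ (m + 1) * m.factorial * Real.exp (x / 2) := by
  have h1 := sinh_substitution m hx (by norm_num : (0 : ℝ) ≤ 1 / 2)
  have h2 : expMoment (m + 1) x ≤ ∫ t in Ioi (0 : ℝ), 2 ^ (m + 1) * Real.exp (x / 2) *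
      (Real.cosh t * ((Real.sinh t + 1 / 2) ^ m * Real.exp (-(x * (Real.sinh t + 1 / 2))))) :=
    setIntegral_mono_on (integrableOn_expMoment_succ m hx) (h1.1.const_mul _)
      measurableSet_Ioi fun t ht => exp_succ_mul_le m x (le_of_lt ht)
  rw [integral_const_mul, h1.2] at h2
  have h3 : ∫ v in Ioi (1 / 2 : ℝ), v ^ m * Real.exp (-(x * v)) ≤ m.factorial / x ^ (m + 1) := by
    rw [← integral_pow_mul_exp_neg_mul m hx]
    refine setIntegral_mono_set (integrableOn_pow_mul_exp_neg_mul m hx) ?_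
      (Ioi_subset_Ioi (by norm_num)).eventuallyLE
    refine (ae_restrict_mem measurableSet_Ioi).mono fun v hv => ?_
    have : (0 : ℝ) < v := hv
    positivity
  calc _ ≤ _ := h2
    _ ≤ 2 ^ (m + 1) * Real.exp (x / 2) * (m.factorial / x ^ (m + 1)) := by gcongr
    _ = _ := by rw [div_pow]; ring

/-- The reverse comparisons 2 sinh t ≤ e^t and cosh t ≤ e^t show that the upper bound is sharp up to
a factor that does not depend on m. -/
theorem le_expMoment_succ (m : ℕ) {x : ℝ} (hx : 0 < x) :
    (2 / x) ^ (m + 1) * m.factorial / 2 ≤ expMoment (m + 1) x := by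
  have h1 := sinh_substitution m hx (le_refl (0 : ℝ))
  rw [integral_pow_mul_exp_neg_mul m hx] at h1
  have h2 : ∫ t in Ioi (0 : ℝ), 2 ^ m *
      (Real.cosh t * ((Real.sinh t + 0) ^ m * Real.exp (-(x * (Real.sinh t + 0))))) ≤
      expMoment (m + 1) x := by
    refine setIntegral_mono_on (h1.1.const_mul _) (integrableOn_expMoment_succ m hx)
      measurableSet_Ioi fun t ht => ?_
    have h0 : 0 < Real.sinh t := Real.sinh_pos_iff.2 ht
    have h3 : (2 * Real.sinh t) ^ m * Real.cosh t ≤ Real.exp ((m + 1 : ℕ) * t) := by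
      rw [Real.exp_nat_mul, pow_succ]
      have := two_mul_sinh_le_exp t
      have h3 := cosh_le_exp (le_of_lt ht)
      gcongr
    rw [add_zero]
    calc _ = (2 * Real.sinh t) ^ m * Real.cosh t * Real.exp (-(x * Real.sinh t)) := by
          rw [mul_pow]; ring
      _ ≤ _ := by gcongr
  rw [integral_const_mul, h1.2] at h2
  refine le_trans (le_of_eq ?_) h2
  rw [div_pow, pow_succ 2]; ring

/-! ### The Hankel functions as a contour integral -/

/-- The trigonometric part `(1/π) ∫_0^π e^{i (x sin t - n t)} dt` of `H_n(x)`. -/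
noncomputable def hankelTrig (n : ℤ) (x : ℝ) : ℂ :=
  (1 / Real.pi : ℂ) * ∫ t in (0 : ℝ)..Real.pi,
    Complex.exp (Complex.I * (x * Real.sin t : ℝ)) * Complex.exp (-(Complex.I * n * t))

/-- The kernel `e^{n t} + (-1)^n e^{-n t}`. -/
noncomputable def hankelKernel (n : ℤ) (t : ℝ) : ℝ :=
  Real.exp (n * t) + (-1 : ℝ) ^ n * Real.exp (-(n * t))

theorem abs_hankelKernel_le (n : ℤ) {t : ℝ} (ht : 0 ≤ t) :
    |hankelKernel n t| ≤ 2 * Real.exp (n.natAbs * t) := by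
  have h1 : (n : ℝ) ≤ n.natAbs := by rw [Nat.cast_natAbs]; exact_mod_cast le_abs_self n
  have h2 : -(n : ℝ) ≤ n.natAbs := by rw [Nat.cast_natAbs]; exact_mod_cast neg_le_abs n
  refine (abs_add_le _ _).trans ?_
  rw [abs_mul, abs_zpow, abs_neg, abs_one, one_zpow, one_mul, Real.abs_exp, Real.abs_exp, two_mul]
  gcongr
  rw [← neg_mul]
  gcongr

theorem continuous_hankelKernel (n : ℤ) : Continuous (hankelKernel n) := by
  unfold hankelKernel; fun_prop

/-- The exponential part of `H_n(x)`. -/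
noncomputable def hankelExp (n : ℤ) (x : ℝ) : ℝ :=
  ∫ t in Ioi (0 : ℝ), hankelKernel n t * Real.exp (-(x * Real.sinh t))

theorem integrableOn_hankelExp (n : ℤ) {x : ℝ} (hx : 0 < x) :
    IntegrableOn (fun t => hankelKernel n t * Real.exp (-(x * Real.sinh t))) (Ioi 0) := by
  refine Integrable.mono' ((integrableOn_expMoment n.natAbs hx).const_mul 2)
    (Continuous.aestronglyMeasurable (by have := continuous_hankelKernel n; fun_prop)) ?_
  refine (ae_restrict_mem measurableSet_Ioi).mono fun t ht => ?_
  rw [norm_mul, Real.norm_eq_abs, Real.norm_eq_abs, Real.abs_exp, ← mul_assoc]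
  gcongr
  exact abs_hankelKernel_le n (le_of_lt ht)

theorem hankel_eq (n : ℤ) (x : ℝ) :
    hankel n x = hankelTrig n x - Complex.I / Real.pi * hankelExp n x := by
  have h1 : (fun t : ℝ => Complex.exp (Complex.I * (x * Real.sin t : ℝ)) *
      Complex.exp (-(Complex.I * n * t))) = fun t : ℝ => ((Real.cos (x * Real.sin t - n * t) : ℝ) : ℂ)
        + Complex.I * ((Real.sin (x * Real.sin t - n * t) : ℝ) : ℂ) := by
    funext t
    rw [← Complex.exp_add, Complex.ofReal_cos, Complex.ofReal_sin,
      show Complex.I * ((x * Real.sin t : ℝ) : ℂ) + -(Complex.I * n * t) =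
        ((x * Real.sin t - n * t : ℝ) : ℂ) * Complex.I by push_cast; ring, Complex.exp_mul_I]
    ring
  have h2 : hankelTrig n x = (1 / Real.pi : ℂ) *
      (((∫ t in (0 : ℝ)..Real.pi, Real.cos (x * Real.sin t - n * t) : ℝ) : ℂ) +
      Complex.I * ((∫ t in (0 : ℝ)..Real.pi, Real.sin (x * Real.sin t - n * t) : ℝ) : ℂ)) := by
    rw [hankelTrig, h1, intervalIntegral.integral_add, intervalIntegral.integral_const_mul,
      intervalIntegral.integral_ofReal, intervalIntegral.integral_ofReal]
    all_goals exact Continuous.intervalIntegrable (by fun_prop) _ _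
  rw [h2, hankel, besselJ, besselY, hankelExp]
  simp only [hankelKernel]
  push_cast
  ring

theorem norm_hankelTrig_le (n : ℤ) (x : ℝ) : ‖hankelTrig n x‖ ≤ 1 := by
  have h := intervalIntegral.norm_integral_le_of_norm_le_const (a := 0) (b := Real.pi)
    (f := fun t : ℝ => Complex.exp (Complex.I * (x * Real.sin t : ℝ)) *
      Complex.exp (-(Complex.I * n * t))) (C := 1) (fun t _ => by
      rw [norm_mul, norm_exp_neg_I_mul_int_mul, mul_one, Complex.norm_exp]; simp)
  have hpi := Real.pi_pos
  rw [sub_zero, abs_of_pos hpi] at h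
  rw [hankelTrig, norm_mul, norm_div, norm_one, Complex.norm_real, Real.norm_of_nonneg hpi.le]
  rw [one_div, inv_mul_le_iff₀ hpi]
  linarith

theorem abs_hankelExp_le (n : ℤ) {x : ℝ} (hx : 0 < x) :
    |hankelExp n x| ≤ 2 * expMoment n.natAbs x := by
  rw [expMoment, ← integral_const_mul, ← Real.norm_eq_abs, hankelExp]
  refine norm_integral_le_of_norm_le ((integrableOn_expMoment n.natAbs hx).const_mul 2) ?_
  refine (ae_restrict_mem measurableSet_Ioi).mono fun t ht => ?_
  rw [norm_mul, Real.norm_eq_abs, Real.norm_eq_abs, Real.abs_exp, ← mul_assoc]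
  gcongr
  exact abs_hankelKernel_le n (le_of_lt ht)

/-- The exponential part decreases in the argument, so a moment at the smallest admissible distance
controls all larger ones; the factor 2/π is at most 1. -/
theorem norm_hankel_le (n : ℤ) {x y : ℝ} (hx : 0 < x) (hxy : x ≤ y) :
    ‖hankel n y‖ ≤ 1 + expMoment n.natAbs x := by
  rw [hankel_eq]
  refine (norm_sub_le _ _).trans ?_
  have h1 := abs_hankelExp_le n (hx.trans_le hxy)
  have h2 := expMoment_antitone n.natAbs hx hxy
  have hpi := Real.pi_gt_three
  have h0 := expMoment_nonneg n.natAbs x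
  gcongr
  · exact norm_hankelTrig_le n y
  · rw [norm_mul, norm_div, Complex.norm_I, Complex.norm_real, Complex.norm_real,
      Real.norm_of_nonneg (by linarith), Real.norm_eq_abs, one_div_mul_eq_div,
      div_le_iff₀ (by linarith)]
    nlinarith

/-- For positive order the growing exponential in the kernel dominates: the other one costs at most
a moment of order 1, and the trigonometric part at most 1. -/
theorem le_norm_hankel (m : ℕ) {x : ℝ} (hx : 0 < x) :
    ((2 / x) ^ (m + 1) * m.factorial / 2 - expMoment 1 x) / Real.pi - 1 ≤
      ‖hankel ((m + 1 : ℕ) : ℤ) x‖ := by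
  have hpi := Real.pi_pos
  have h1 : expMoment (m + 1) x - expMoment 1 x ≤ hankelExp ((m + 1 : ℕ) : ℤ) x := by
    rw [expMoment, expMoment, ← integral_sub (integrableOn_expMoment _ hx)
      (integrableOn_expMoment _ hx)]
    refine setIntegral_mono_on ((integrableOn_expMoment _ hx).sub (integrableOn_expMoment _ hx))
      (integrableOn_hankelExp _ hx) measurableSet_Ioi fun t ht => ?_
    rw [← sub_mul]
    refine mul_le_mul_of_nonneg_right ?_ (Real.exp_pos _).le
    have ht' : (0 : ℝ) < t := ht
    have h3 : |(-1 : ℝ) ^ ((m + 1 : ℕ) : ℤ) * Real.exp (-(((m + 1 : ℕ) : ℤ) * t))| ≤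
        Real.exp ((1 : ℕ) * t) := by
      rw [abs_mul, abs_zpow, abs_neg, abs_one, one_zpow, one_mul, Real.abs_exp, Real.exp_le_exp]
      push_cast
      have : 0 ≤ (m : ℝ) * t := by positivity
      nlinarith
    have h4 := neg_le_of_abs_le h3
    simp only [hankelKernel, Int.cast_natCast] at h4 ⊢
    linarith
  have h2 := le_expMoment_succ m hx
  have h3 : ‖Complex.I / Real.pi * hankelExp ((m + 1 : ℕ) : ℤ) x‖ - 1 ≤
      ‖hankel ((m + 1 : ℕ) : ℤ) x‖ := by
    rw [hankel_eq, norm_sub_rev]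
    have := norm_sub_norm_le (Complex.I / Real.pi * hankelExp ((m + 1 : ℕ) : ℤ) x)
      (hankelTrig ((m + 1 : ℕ) : ℤ) x)
    have h4 := norm_hankelTrig_le ((m + 1 : ℕ) : ℤ) x
    linarith
  refine le_trans ?_ h3
  rw [norm_mul, norm_div, Complex.norm_I, Complex.norm_real, Complex.norm_real,
    Real.norm_of_nonneg hpi.le, one_div_mul_eq_div]
  gcongr
  exact le_trans (by linarith) (le_abs_self _)

/-! ### Rotation of the contour -/

theorem sinh_ofReal_add_mul_I (t χ : ℝ) : Complex.sinh (t + χ * Complex.I) =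
    (Real.sinh t * Real.cos χ : ℝ) + (Real.cosh t * Real.sin χ : ℝ) * Complex.I := by
  rw [Complex.sinh_add, Complex.sinh_mul_I, Complex.cosh_mul_I]
  push_cast; ring

theorem norm_exp_neg_mul_sinh (σ t χ : ℝ) :
    ‖Complex.exp (-(σ * Complex.sinh (t + χ * Complex.I)))‖ =
      Real.exp (-(σ * Real.cos χ * Real.sinh t)) := by
  rw [Complex.norm_exp, sinh_ofReal_add_mul_I]
  congr 1
  simp only [Complex.neg_re, Complex.add_re, Complex.ofReal_re,
    Complex.mul_re, Complex.I_re, Complex.I_im, Complex.ofReal_im]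
  ring

theorem norm_cosh_le (t χ : ℝ) (ht : 0 ≤ t) :
    ‖Complex.cosh (t + χ * Complex.I)‖ ≤ Real.exp t := by
  have h1 : ‖Complex.exp (t + χ * Complex.I)‖ = Real.exp t := by
    rw [Complex.norm_exp]; simp
  have h2 : ‖Complex.exp (-(t + χ * Complex.I))‖ = Real.exp (-t) := by
    rw [Complex.norm_exp]; simp
  have h3 : Real.exp (-t) ≤ Real.exp t := Real.exp_le_exp.2 (by linarith)
  rw [Complex.cosh, norm_div, Complex.norm_two]
  have := norm_add_le (Complex.exp (t + χ * Complex.I)) (Complex.exp (-(t + χ * Complex.I)))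
  linarith

/-- The half-line integral `∫_0^∞ exp (-σ sinh (t + i χ)) dt`. -/
noncomputable def rotatedHalfLine (σ χ : ℝ) : ℂ :=
  ∫ t in Ioi (0 : ℝ), Complex.exp (-(σ * Complex.sinh (t + χ * Complex.I)))

theorem continuous_exp_neg_mul_sinh (σ χ : ℝ) :
    Continuous fun t : ℝ => Complex.exp (-(σ * Complex.sinh (t + χ * Complex.I))) := by
  have := Complex.continuous_sinh
  fun_prop

theorem integrableOn_rotatedHalfLine {σ χ : ℝ} (hσ : 0 < σ) (hχ : 0 < Real.cos χ) :
    IntegrableOn (fun t : ℝ => Complex.exp (-(σ * Complex.sinh (t + χ * Complex.I)))) (Ioi 0) := by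
  refine Integrable.mono' (integrableOn_expMoment 0 (mul_pos hσ hχ))
    (continuous_exp_neg_mul_sinh σ χ).aestronglyMeasurable ?_
  refine Eventually.of_forall fun t => ?_
  rw [norm_exp_neg_mul_sinh]
  simp

theorem cos_le_cos_of_abs_le {a b : ℝ} (h : |a| ≤ b) (hb : b ≤ Real.pi) :
    Real.cos b ≤ Real.cos a := by
  rw [← Real.cos_abs a]
  exact Real.cos_le_cos_of_nonneg_of_le_pi (abs_nonneg a) hb h

theorem tendsto_sinh_atTop : Tendsto Real.sinh atTop atTop :=
  tendsto_atTop_mono' _ ((eventually_ge_atTop 0).mono fun _ h => Real.self_le_sinh_iff.2 h)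
    tendsto_id

/-- The integrand depends on t + iχ only, so its χ-derivative is i times its t-derivative, and the
integral collapses to the boundary value at t = 0. -/
theorem hasDerivAt_rotatedHalfLine {σ χ : ℝ} (hσ : 0 < σ) (hχ : |χ| < Real.pi / 2) :
    HasDerivAt (rotatedHalfLine σ)
      (-Complex.I * Complex.exp (-(Complex.I * (σ * Real.sin χ : ℝ)))) χ := by
  -- The intermediate angle gives decay at the rate cos χ₁ > 0 uniformly near χ, which dominates the
  -- differentiated integrand.
  obtain ⟨χ₁, h1, h2⟩ := exists_between hχ
  have hc : 0 < Real.cos χ₁ :=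
    Real.cos_pos_of_mem_Ioo ⟨by linarith [abs_nonneg χ], h2⟩
  have hpi := Real.pi_pos
  set F' : ℝ → ℝ → ℂ := fun χ t => Complex.exp (-(σ * Complex.sinh (t + χ * Complex.I))) *
    -(σ * (Complex.cosh (t + χ * Complex.I) * Complex.I)) with hF'
  have hF'c : Continuous (F' χ) := by
    have := continuous_exp_neg_mul_sinh σ χ
    have := Complex.continuous_cosh
    fun_prop
  have hnhds : Ioo (-χ₁) χ₁ ∈ 𝓝 χ := Ioo_mem_nhds (neg_lt_of_abs_lt h1) (lt_of_abs_lt h1)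
  have hint : Integrable (fun t : ℝ => σ * (Real.exp ((1 : ℕ) * t) *
      Real.exp (-(σ * Real.cos χ₁ * Real.sinh t)))) (volume.restrict (Ioi 0)) :=
    (integrableOn_expMoment 1 (mul_pos hσ hc)).const_mul σ
  have hbound : ∀ t ∈ Ioi (0 : ℝ), ∀ χ' ∈ Ioo (-χ₁) χ₁, ‖F' χ' t‖ ≤ σ * (Real.exp ((1 : ℕ) * t) *
      Real.exp (-(σ * Real.cos χ₁ * Real.sinh t))) := by
    intro t ht χ' hχ'
    have ht' : (0 : ℝ) ≤ t := le_of_lt ht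
    have hs : 0 ≤ Real.sinh t := Real.sinh_nonneg_iff.2 ht'
    have hcos := cos_le_cos_of_abs_le (abs_le.2 ⟨hχ'.1.le, hχ'.2.le⟩) (by linarith)
    rw [hF', norm_mul, norm_exp_neg_mul_sinh, norm_neg, norm_mul, norm_mul, Complex.norm_I,
      Complex.norm_real, Real.norm_of_nonneg hσ.le, mul_one, mul_comm, mul_assoc]
    have := norm_cosh_le t χ' ht'
    simp only [Nat.cast_one, one_mul]
    gcongr
  have key := hasDerivAt_integral_of_dominated_loc_of_deriv_le (μ := volume.restrict (Ioi 0))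
    (F := fun (χ : ℝ) (t : ℝ) => Complex.exp (-(σ * Complex.sinh (t + χ * Complex.I)))) (F' := F')
    (x₀ := χ) (s := Ioo (-χ₁) χ₁) hnhds
    (Eventually.of_forall fun χ => (continuous_exp_neg_mul_sinh σ χ).aestronglyMeasurable)
    (integrableOn_rotatedHalfLine hσ (hc.trans_le (cos_le_cos_of_abs_le h1.le (by linarith))))
    hF'c.aestronglyMeasurable
    ((ae_restrict_mem measurableSet_Ioi).mono hbound) hint
    (Eventually.of_forall fun t χ' _ => by
      have h : HasDerivAt (fun χ : ℝ => (t : ℂ) + χ * Complex.I) (Complex.I) χ' := by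
        simpa using ((Complex.ofRealCLM.hasDerivAt (x := χ')).mul_const Complex.I).const_add (t : ℂ)
      refine (((Complex.hasDerivAt_sinh _).scomp χ' h).const_mul (σ : ℂ)).neg.cexp.congr_deriv ?_
      simp only [hF', smul_eq_mul, mul_comm Complex.I, Function.comp_apply, Pi.neg_apply])
  have hval : ∫ t in Ioi (0 : ℝ), F' χ t =
      0 - Complex.I * Complex.exp (-(σ * Complex.sinh ((0 : ℝ) + χ * Complex.I))) := by
    refine integral_Ioi_of_hasDerivAt_of_tendsto'
      (f := fun t : ℝ => Complex.I * Complex.exp (-(σ * Complex.sinh (t + χ * Complex.I))))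
      (fun t _ => ?_) (hint.mono' hF'c.aestronglyMeasurable
        ((ae_restrict_mem measurableSet_Ioi).mono fun t ht => hbound t ht χ
          ⟨neg_lt_of_abs_lt h1, lt_of_abs_lt h1⟩)) ?_
    · have h : HasDerivAt (fun t : ℝ => (t : ℂ) + χ * Complex.I) 1 t := by
        simpa using (Complex.ofRealCLM.hasDerivAt (x := t)).add_const (χ * Complex.I)
      have h' := ((((Complex.hasDerivAt_sinh _).scomp t h).const_mul
        (σ : ℂ)).neg.cexp).const_mul Complex.I
      refine h'.congr_deriv ?_
      simp only [hF', one_smul, Function.comp_apply, Pi.neg_apply]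
      ring
    · rw [tendsto_zero_iff_norm_tendsto_zero]
      simp only [norm_mul, Complex.norm_I, one_mul, norm_exp_neg_mul_sinh]
      have hc' := hc.trans_le (cos_le_cos_of_abs_le h1.le (by linarith))
      exact Real.tendsto_exp_atBot.comp (tendsto_neg_atTop_atBot.comp
        (tendsto_sinh_atTop.const_mul_atTop (mul_pos hσ hc')))
  have h3 := key.2
  rw [hval] at h3
  refine h3.congr_deriv ?_
  rw [sinh_ofReal_add_mul_I]
  simp only [Real.sinh_zero, Real.cosh_zero]
  push_cast
  ring_nf

theorem integral_exp_sin_add (σ χ : ℝ) :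
    ∫ t in (0 : ℝ)..Real.pi, Complex.exp (Complex.I * (σ * Real.sin (t + χ) : ℝ)) =
      ∫ t in χ..(χ + Real.pi), Complex.exp (Complex.I * (σ * Real.sin t : ℝ)) := by
  rw [intervalIntegral.integral_comp_add_right
    (fun t : ℝ => Complex.exp (Complex.I * (σ * Real.sin t : ℝ)))]
  rw [zero_add, add_comm]

theorem hasDerivAt_integral_exp_sin (σ χ : ℝ) :
    HasDerivAt (fun χ : ℝ => ∫ t in χ..(χ + Real.pi), Complex.exp (Complex.I * (σ * Real.sin t : ℝ)))
      (Complex.exp (-(Complex.I * (σ * Real.sin χ : ℝ))) -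
        Complex.exp (Complex.I * (σ * Real.sin χ : ℝ))) χ := by
  set f : ℝ → ℂ := fun t => Complex.exp (Complex.I * (σ * Real.sin t : ℝ)) with hf
  have hc : Continuous f := by fun_prop
  have h0 : ∀ x, HasDerivAt (fun x => ∫ t in (0 : ℝ)..x, f t) (f x) x := fun x =>
    intervalIntegral.integral_hasDerivAt_right (hc.intervalIntegrable _ _)
      (hc.stronglyMeasurableAtFilter _ _) hc.continuousAt
  have h1 := ((h0 (χ + Real.pi)).comp_add_const χ Real.pi).sub (h0 χ)
  have e : (fun χ : ℝ => ∫ t in χ..(χ + Real.pi), f t) =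
      (fun x => ∫ t in (0 : ℝ)..x + Real.pi, f t) - fun x => ∫ t in (0 : ℝ)..x, f t := by
    funext x
    exact (intervalIntegral.integral_interval_sub_left (hc.intervalIntegrable _ _)
      (hc.intervalIntegrable _ _)).symm
  rw [e]
  refine h1.congr_deriv ?_
  simp only [hf, Real.sin_add_pi]
  congr 2
  push_cast; ring

/-- This is contour rotation carried out by differentiation: the χ-derivatives of the half-lines
cancel those of the moving end points of the interval, so the right side is constant, and at χ = 0
it is the defining integral. -/
theorem pi_mul_hankel_zero_eq {σ χ : ℝ} (hσ : 0 < σ) (hχ : |χ| < Real.pi / 2) :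
    Real.pi * hankel 0 σ =
      (∫ t in χ..(χ + Real.pi), Complex.exp (Complex.I * (σ * Real.sin t : ℝ))) -
        Complex.I * (rotatedHalfLine σ χ + rotatedHalfLine σ (-χ)) := by
  have hpi := Real.pi_pos
  set G : ℝ → ℂ := fun χ =>
    (∫ t in χ..(χ + Real.pi), Complex.exp (Complex.I * (σ * Real.sin t : ℝ))) -
        Complex.I * (rotatedHalfLine σ χ + rotatedHalfLine σ (-χ)) with hG
  have hd : ∀ χ ∈ Ioo (-(Real.pi / 2)) (Real.pi / 2), HasDerivAt G 0 χ := by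
    intro χ hχ
    have h1 := hasDerivAt_rotatedHalfLine hσ (abs_lt.2 ⟨hχ.1, hχ.2⟩)
    have h2 := hasDerivAt_rotatedHalfLine (χ := -χ) hσ (by rw [abs_neg]; exact abs_lt.2 ⟨hχ.1, hχ.2⟩)
    have h3 := (hasDerivAt_integral_exp_sin σ χ).sub ((h1.add (h2.scomp χ (hasDerivAt_neg χ))).const_mul
      Complex.I)
    refine h3.congr_deriv ?_
    simp only [Real.sin_neg]
    push_cast
    rw [show -(Complex.I * ((σ : ℂ) * -Complex.sin χ)) = Complex.I * (σ * Complex.sin χ) by ring]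
    simp only [neg_smul, one_smul]
    linear_combination (Complex.exp (-(Complex.I * (σ * Complex.sin χ))) -
      Complex.exp (Complex.I * (σ * Complex.sin χ))) * Complex.I_sq
  have hconst : G χ = G 0 := by
    have h0 : (0 : ℝ) ∈ Ioo (-(Real.pi / 2)) (Real.pi / 2) := ⟨by linarith, by linarith⟩
    have := isOpen_Ioo.is_const_of_deriv_eq_zero (𝕜 := ℝ) isPreconnected_Ioo
      (fun x hx => (hd x hx).differentiableAt.differentiableWithinAt)
      (fun x hx => (hd x hx).deriv) (abs_lt.1 hχ) h0
    exact this
  change _ = G χ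
  rw [hconst, hG, hankel_eq, hankelTrig, hankelExp]
  have hV : rotatedHalfLine σ 0 = ((∫ t in Ioi (0 : ℝ), Real.exp (-(σ * Real.sinh t)) : ℝ) : ℂ) := by
    rw [rotatedHalfLine, ← integral_complex_ofReal]
    refine integral_congr_ae (Eventually.of_forall fun t => ?_)
    simp
  have hE : ∫ t in Ioi (0 : ℝ), hankelKernel 0 t * Real.exp (-(σ * Real.sinh t)) =
      2 * ∫ t in Ioi (0 : ℝ), Real.exp (-(σ * Real.sinh t)) := by
    rw [← integral_const_mul]
    refine integral_congr_ae (Eventually.of_forall fun t => ?_)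
    simp only [hankelKernel]
    norm_num
  rw [hE]
  simp only [neg_zero, zero_add, hV, Int.cast_zero, mul_zero, zero_mul, Complex.exp_zero, mul_one]
  have : (Real.pi : ℂ) ≠ 0 := by exact_mod_cast hpi.ne'
  push_cast
  field_simp
  ring

/-! ### Graf's addition theorem -/

theorem summable_geometric_natAbs {r : ℝ} (h0 : 0 ≤ r) (h1 : r < 1) :
    Summable fun m : ℤ => r ^ m.natAbs :=
  Summable.of_nat_of_neg (by simpa using summable_geometric_of_lt_one h0 h1)
    (by simpa using summable_geometric_of_lt_one h0 h1)

/-- The ratio of the radii appears here: κ/2 times 2/(3κ) is 1/3, and the factorials leave 1/(m+1).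
The summand m+1, which makes room for the oscillatory parts, is absorbed by the factorial through
m+1 ≤ 2^m. -/
theorem besselJ_mul_moment_bound {κ : ℝ} (hκ : 0 < κ) (m : ℕ) :
    (κ / 2) ^ (m + 1) / (m + 1).factorial * ((m + 1) + (2 / (3 * κ)) ^ (m + 1) * m.factorial) ≤
      (1 + 3 * κ / 2 * Real.exp (3 * κ)) * ((1 / 3) ^ (m + 1) / (m + 1)) := by
  have hf : ((m + 1).factorial : ℝ) = (m + 1) * m.factorial := by
    rw [Nat.factorial_succ]; push_cast; ring
  have hm : (0 : ℝ) < m.factorial := by positivity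
  have e1 : (κ / 2) ^ (m + 1) / (m + 1).factorial * ((2 / (3 * κ)) ^ (m + 1) * m.factorial) =
      (1 / 3) ^ (m + 1) / (m + 1) := by
    rw [hf, show (1 / 3 : ℝ) = κ / 2 * (2 / (3 * κ)) by field_simp, mul_pow]
    field_simp
  have e2 : (κ / 2) ^ (m + 1) / (m + 1).factorial * (m + 1) =
      (1 / 3) ^ (m + 1) / (m + 1) * (3 * κ / 2 * ((m + 1) * ((3 * κ / 2) ^ m / m.factorial))) := by
    rw [hf, show κ / 2 = 1 / 3 * (3 * κ / 2) by ring, mul_pow, pow_succ (3 * κ / 2)]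
    field_simp
  have h2 : ((m : ℝ) + 1) ≤ 2 ^ m := by exact_mod_cast Nat.lt_two_pow_self
  have h3 : ((m : ℝ) + 1) * ((3 * κ / 2) ^ m / m.factorial) ≤ Real.exp (3 * κ) := by
    calc _ ≤ 2 ^ m * ((3 * κ / 2) ^ m / m.factorial) := by gcongr
      _ = (3 * κ) ^ m / m.factorial := by rw [← mul_div_assoc, ← mul_pow]; congr 2; ring
      _ ≤ _ := Real.pow_div_factorial_le_exp _ (by positivity) m
  rw [mul_add, e1, e2]
  have h4 : 3 * κ / 2 * ((m + 1) * ((3 * κ / 2) ^ m / m.factorial)) ≤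
      3 * κ / 2 * Real.exp (3 * κ) := by gcongr
  have h5 : (0 : ℝ) ≤ (1 / 3) ^ (m + 1) / (m + 1) := by positivity
  nlinarith

/-- A constant that bounds the terms of the multipole expansions. -/
noncomputable def termConst (κ : ℝ) : ℝ :=
  Real.exp (κ ^ 2 / 4) * Real.exp (3 * κ / 2) * (1 + 3 * κ / 2 * Real.exp (3 * κ))

theorem termConst_pos {κ : ℝ} (hκ : 0 < κ) : 0 < termConst κ := by
  unfold termConst; positivity

/-- The factor B is kept general because the same majorant governs both outgoing waves and their
line integrals. -/
theorem abs_besselJ_mul_le {κ x B : ℝ} (hκ : 0 < κ) (hx : 0 ≤ x) (hxκ : x ≤ κ) {m : ℤ} {l : ℕ}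
    (hm : m.natAbs = l + 1)
    (hB : B ≤ Real.exp (3 * κ / 2) * ((l + 1) + (2 / (3 * κ)) ^ (l + 1) * l.factorial)) :
    |besselJ m x| * B ≤ termConst κ * ((1 / 3) ^ (l + 1) / (l + 1)) := by
  have h1 := abs_besselJ_le m hx
  rw [hm] at h1
  have h2 := besselJ_mul_moment_bound hκ l
  calc |besselJ m x| * B
      ≤ |besselJ m x| * (Real.exp (3 * κ / 2) *
        ((l + 1) + (2 / (3 * κ)) ^ (l + 1) * l.factorial)) := by gcongr
    _ ≤ (x / 2) ^ (l + 1) / (l + 1).factorial * Real.exp (x ^ 2 / 4) *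
        (Real.exp (3 * κ / 2) * ((l + 1) + (2 / (3 * κ)) ^ (l + 1) * l.factorial)) := by gcongr
    _ ≤ (κ / 2) ^ (l + 1) / (l + 1).factorial * Real.exp (κ ^ 2 / 4) *
        (Real.exp (3 * κ / 2) * ((l + 1) + (2 / (3 * κ)) ^ (l + 1) * l.factorial)) := by gcongr
    _ = Real.exp (κ ^ 2 / 4) * Real.exp (3 * κ / 2) * ((κ / 2) ^ (l + 1) / (l + 1).factorial *
        ((l + 1) + (2 / (3 * κ)) ^ (l + 1) * l.factorial)) := by ring
    _ ≤ Real.exp (κ ^ 2 / 4) * Real.exp (3 * κ / 2) *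
        ((1 + 3 * κ / 2 * Real.exp (3 * κ)) * ((1 / 3) ^ (l + 1) / (l + 1))) := by gcongr
    _ = _ := by rw [termConst]; ring

theorem one_add_expMoment_succ_le {κ : ℝ} (hκ : 0 < κ) (l : ℕ) :
    1 + expMoment (l + 1) (3 * κ) ≤
      Real.exp (3 * κ / 2) * ((l + 1) + (2 / (3 * κ)) ^ (l + 1) * l.factorial) := by
  have h := expMoment_succ_le l (by positivity : 0 < 3 * κ)
  have h1 : 1 ≤ Real.exp (3 * κ / 2) := Real.one_le_exp (by positivity)
  have h2 : (0 : ℝ) ≤ l := by positivity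
  nlinarith

theorem abs_besselJ_mul_one_add_expMoment_le {κ x : ℝ} (hκ : 0 < κ) (hx : 0 ≤ x) (hxκ : x ≤ κ)
    {m : ℤ} {l : ℕ} (hm : m.natAbs = l + 1) :
    |besselJ m x| * (1 + expMoment m.natAbs (3 * κ)) ≤
      termConst κ * ((1 / 3) ^ (l + 1) / (l + 1)) := by
  refine abs_besselJ_mul_le hκ hx hxκ hm ?_
  rw [hm]
  exact one_add_expMoment_succ_le hκ l

theorem summable_besselJ_mul_one_add_expMoment {κ x : ℝ} (hκ : 0 < κ) (hx : 0 ≤ x) (hxκ : x ≤ κ) :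
    Summable fun m : ℤ => |besselJ m x| * (1 + expMoment m.natAbs (3 * κ)) := by
  have h := summable_geometric_natAbs (by norm_num : (0 : ℝ) ≤ 1 / 3) (by norm_num)
  refine Summable.of_nonneg_of_le (fun m => mul_nonneg (abs_nonneg _)
    (add_nonneg zero_le_one (expMoment_nonneg _ _))) (fun m => ?_)
    (h.mul_left (max (termConst κ) (|besselJ 0 x| * (1 + expMoment 0 (3 * κ)))))
  rcases hm : m.natAbs with _ | l
  · rw [pow_zero, mul_one, Int.natAbs_eq_zero.1 hm]
    exact le_max_right _ _
  · have h2 := abs_besselJ_mul_one_add_expMoment_le hκ hx hxκ hm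
    rw [hm] at h2
    refine h2.trans ?_
    have hpos := termConst_pos hκ
    have h3 : (1 / 3 : ℝ) ^ (l + 1) / (l + 1) ≤ (1 / 3) ^ (l + 1) :=
      div_le_self (by positivity) (by
        have : (0 : ℝ) ≤ l := by positivity
        linarith)
    calc _ ≤ termConst κ * (1 / 3) ^ (l + 1) := by gcongr
      _ ≤ _ := by gcongr; exact le_max_left _ _

/-- In the generating function take T = u⁻¹ e^{-w}. Adding X sinh w to its exponent gives ((X - xu)
e^w - (X - xu⁻¹) e^{-w})/2, and the polar form of X - xu turns this into a shift of w by iχ. -/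
theorem hasSum_exp_rotated {X x σ χ : ℝ} {u : ℂ} (hu : u ≠ 0) (hu' : conj u = u⁻¹)
    (hζ : (σ : ℂ) * Complex.exp (χ * Complex.I) = X - x * u) (w : ℂ) :
    HasSum (fun m : ℤ => (besselJ m x : ℂ) * u ^ (-m) *
      (Complex.exp (-(m * w)) * Complex.exp (X * Complex.sinh w)))
      (Complex.exp (σ * Complex.sinh (w + χ * Complex.I))) := by
  have hζ' : (σ : ℂ) * Complex.exp (-(χ * Complex.I)) = X - x * u⁻¹ := by
    have h := congrArg conj hζ
    rw [map_mul, map_sub, map_mul, ← Complex.exp_conj, map_mul, Complex.conj_I, hu'] at h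
    simpa using h
  have hT : u⁻¹ * Complex.exp (-w) ≠ 0 := mul_ne_zero (inv_ne_zero hu) (Complex.exp_ne_zero _)
  have h := (hasSum_besselJ_mul_zpow x hT).mul_right (Complex.exp (X * Complex.sinh w))
  have e1 : Complex.exp ((x / 2 : ℝ) * (u⁻¹ * Complex.exp (-w) - (u⁻¹ * Complex.exp (-w))⁻¹)) *
      Complex.exp (X * Complex.sinh w) = Complex.exp (σ * Complex.sinh (w + χ * Complex.I)) := by
    rw [← Complex.exp_add]
    congr 1
    have hneg : -(w + χ * Complex.I) = -w + -(χ * Complex.I) := by ring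
    rw [Complex.sinh, Complex.sinh, hneg, Complex.exp_add, Complex.exp_add, mul_inv, inv_inv,
      ← Complex.exp_neg, neg_neg]
    push_cast
    linear_combination -(Complex.exp w / 2) * hζ + (Complex.exp (-w) / 2) * hζ'
  rw [e1] at h
  have e2 : (fun m : ℤ => (besselJ m x : ℂ) * (u⁻¹ * Complex.exp (-w)) ^ m *
      Complex.exp (X * Complex.sinh w)) = fun m : ℤ => (besselJ m x : ℂ) * u ^ (-m) *
      (Complex.exp (-(m * w)) * Complex.exp (X * Complex.sinh w)) := by
    funext m
    rw [mul_zpow, inv_zpow, ← zpow_neg, ← Complex.exp_int_mul, mul_neg]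
    ring
  rwa [e2] at h

theorem integral_exp_mul_exp_sinh_eq_hankelTrig (m : ℤ) (X : ℝ) :
    ∫ t in (0 : ℝ)..Real.pi, Complex.exp (-(m * (t * Complex.I))) *
      Complex.exp (X * Complex.sinh (t * Complex.I)) = Real.pi * hankelTrig m X := by
  have hpi : (Real.pi : ℂ) ≠ 0 := by exact_mod_cast Real.pi_pos.ne'
  rw [hankelTrig, ← mul_assoc, mul_one_div_cancel hpi, one_mul]
  refine intervalIntegral.integral_congr fun t _ => ?_
  simp only [Complex.sinh_mul_I]
  rw [mul_comm]
  push_cast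
  congr 2 <;> ring

/-- This is the segment w = it, 0 ≤ t ≤ π, of the Hankel contour; the shift by iχ moves the interval
of integration. -/
theorem hasSum_trig_part {X x σ χ : ℝ} {u : ℂ} (hu : ‖u‖ = 1)
    (hζ : (σ : ℂ) * Complex.exp (χ * Complex.I) = X - x * u) :
    HasSum (fun m : ℤ => (besselJ m x : ℂ) * u ^ (-m) * (Real.pi * hankelTrig m X))
      (∫ t in χ..(χ + Real.pi), Complex.exp (Complex.I * (σ * Real.sin t : ℝ))) := by
  have hu0 : u ≠ 0 := norm_ne_zero_iff.1 (by rw [hu]; norm_num)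
  rw [← integral_exp_sin_add]
  simp_rw [← integral_exp_mul_exp_sinh_eq_hankelTrig, ← intervalIntegral.integral_const_mul]
  refine intervalIntegral.hasSum_integral_of_dominated_convergence (fun m _ => |besselJ m x|)
    (fun m => Continuous.aestronglyMeasurable (by have := Complex.continuous_sinh; fun_prop))
    (fun m => Eventually.of_forall fun t _ => ?_)
    (Eventually.of_forall fun _ _ => summable_abs_besselJ x) intervalIntegrable_const
    (Eventually.of_forall fun t _ => ?_)
  · rw [norm_mul, norm_mul, norm_mul, norm_zpow, hu, one_zpow, mul_one, Complex.norm_real,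
      Complex.norm_exp, Complex.norm_exp, Complex.sinh_mul_I]
    simp
  · have h := hasSum_exp_rotated (X := X) (x := x) hu0 (Complex.inv_eq_conj hu).symm hζ
      (t * Complex.I)
    rw [← add_mul, Complex.sinh_mul_I (_ + _), show (σ : ℂ) * (Complex.sin (t + χ) * Complex.I) =
      Complex.I * (σ * Real.sin (t + χ) : ℝ) by push_cast; ring] at h
    exact h

/-- These are the two half-lines of the Hankel contour. Exchanging sum and integral needs the
products of |J_m| and the moments to be summable, which is where the separation x ≤ κ, 3κ ≤ X
enters. -/
theorem hasSum_exp_part {κ X x σ χ : ℝ} {u : ℂ} (hκ : 0 < κ) (hx : 0 ≤ x) (hxκ : x ≤ κ)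
    (hX : 3 * κ ≤ X) (hu : ‖u‖ = 1)
    (hσ : 0 < σ) (hχ : |χ| < Real.pi / 2)
    (hζ : (σ : ℂ) * Complex.exp (χ * Complex.I) = X - x * u) :
    HasSum (fun m : ℤ => (besselJ m x : ℂ) * u ^ (-m) * (hankelExp m X : ℂ))
      (rotatedHalfLine σ χ + rotatedHalfLine σ (-χ)) := by
  have hu0 : u ≠ 0 := norm_ne_zero_iff.1 (by rw [hu]; norm_num)
  have hcos : 0 < Real.cos χ := Real.cos_pos_of_mem_Ioo ⟨(abs_lt.1 hχ).1, (abs_lt.1 hχ).2⟩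
  have hX0 : 0 < X := by linarith
  have hint : ∀ m : ℤ, Integrable (fun t : ℝ => (besselJ m x : ℂ) * u ^ (-m) *
      ((hankelKernel m t * Real.exp (-(X * Real.sinh t)) : ℝ) : ℂ)) (volume.restrict (Ioi 0)) :=
    fun m => ((integrableOn_hankelExp m hX0).ofReal).const_mul _
  have hsum : ∀ t : ℝ, HasSum (fun m : ℤ => (besselJ m x : ℂ) * u ^ (-m) *
      ((hankelKernel m t * Real.exp (-(X * Real.sinh t)) : ℝ) : ℂ))
      (Complex.exp (-(σ * Complex.sinh (t + χ * Complex.I))) +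
        Complex.exp (-(σ * Complex.sinh (t + (-χ : ℝ) * Complex.I)))) := by
    intro t
    -- The points w = -t and w = t + iπ have the same factor e^{-X sinh t}; their factors e^{-mw}
    -- are e^{mt} and (-1)^m e^{-mt}, the two terms of the kernel.
    have h1 := hasSum_exp_rotated (X := X) (x := x) hu0 (Complex.inv_eq_conj hu).symm hζ (-t)
    have h2 := hasSum_exp_rotated (X := X) (x := x) hu0 (Complex.inv_eq_conj hu).symm hζ
      (t + Real.pi * Complex.I)
    have h3 := h2.add h1
    have e1 : Complex.sinh (t + Real.pi * Complex.I + χ * Complex.I) =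
        -Complex.sinh (t + χ * Complex.I) := by
      rw [show (t : ℂ) + Real.pi * Complex.I + χ * Complex.I =
        t + χ * Complex.I + Real.pi * Complex.I by ring, Complex.sinh_add _ (Real.pi * Complex.I),
        Complex.sinh_mul_I, Complex.cosh_mul_I]
      simp
    have e2 : Complex.sinh (-t + χ * Complex.I) = -Complex.sinh (t + (-χ : ℝ) * Complex.I) := by
      rw [← Complex.sinh_neg]; congr 1; push_cast; ring
    have e3 : Complex.sinh (t + Real.pi * Complex.I) = -Complex.sinh t := by
      rw [Complex.sinh_add, Complex.sinh_mul_I, Complex.cosh_mul_I]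
      simp
    rw [e1, e2, mul_neg, mul_neg] at h3
    convert h3 using 2 with m
    have e4 : Complex.exp (-(m * (t + Real.pi * Complex.I))) =
        (-1) ^ m * Complex.exp (-(m * t)) := by
      rw [show -((m : ℂ) * (t + Real.pi * Complex.I)) =
        ((-m : ℤ) : ℂ) * (Real.pi * Complex.I) + -(m * t) by push_cast; ring, Complex.exp_add,
        Complex.exp_int_mul, Complex.exp_pi_mul_I, zpow_neg, ← inv_zpow]
      norm_num
    rw [e3, e4, Complex.sinh_neg, hankelKernel]
    push_cast
    ring_nf
  have h := hasSum_integral_of_summable_integral_norm hint ?_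
  · have e1 : ∀ m : ℤ, ∫ t in Ioi (0 : ℝ), (besselJ m x : ℂ) * u ^ (-m) *
        ((hankelKernel m t * Real.exp (-(X * Real.sinh t)) : ℝ) : ℂ) =
        (besselJ m x : ℂ) * u ^ (-m) * (hankelExp m X : ℂ) := by
      intro m
      rw [integral_const_mul, hankelExp, integral_complex_ofReal]
    have e2 : ∫ t in Ioi (0 : ℝ), ∑' m : ℤ, (besselJ m x : ℂ) * u ^ (-m) *
        ((hankelKernel m t * Real.exp (-(X * Real.sinh t)) : ℝ) : ℂ) =
        rotatedHalfLine σ χ + rotatedHalfLine σ (-χ) := by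
      rw [rotatedHalfLine, rotatedHalfLine, ← integral_add (integrableOn_rotatedHalfLine hσ hcos)
        (integrableOn_rotatedHalfLine hσ (by rwa [Real.cos_neg]))]
      exact integral_congr_ae (Eventually.of_forall fun t => (hsum t).tsum_eq)
    rw [e2] at h
    simpa only [e1] using h
  · refine Summable.of_nonneg_of_le (fun m => integral_nonneg fun _ => norm_nonneg _) (fun m => ?_)
      ((summable_besselJ_mul_one_add_expMoment hκ hx hxκ).mul_left 2)
    have h1 : ∫ t in Ioi (0 : ℝ), ‖(besselJ m x : ℂ) * u ^ (-m) *
        ((hankelKernel m t * Real.exp (-(X * Real.sinh t)) : ℝ) : ℂ)‖ ≤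
        ∫ t in Ioi (0 : ℝ), |besselJ m x| * 2 *
          (Real.exp (m.natAbs * t) * Real.exp (-(X * Real.sinh t))) := by
      refine setIntegral_mono_on (hint m).norm ((integrableOn_expMoment _ hX0).const_mul _)
        measurableSet_Ioi fun t ht => ?_
      have := abs_hankelKernel_le m (le_of_lt ht)
      rw [norm_mul, norm_mul, norm_zpow, hu, one_zpow, mul_one, Complex.norm_real,
        Complex.norm_real, Real.norm_eq_abs, Real.norm_eq_abs, abs_mul, Real.abs_exp, mul_assoc,
        ← mul_assoc 2]
      gcongr
    rw [integral_const_mul] at h1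
    have h2 : ∫ t in Ioi (0 : ℝ), Real.exp (m.natAbs * t) * Real.exp (-(X * Real.sinh t)) ≤
        expMoment m.natAbs (3 * κ) := expMoment_antitone _ (by positivity) hX
    have h3 := abs_nonneg (besselJ m x)
    nlinarith

/-- Graf's addition theorem for `H_0`, with the sources in a disc of radius `R` and the target at
distance at least `3 R` from its centre. -/
theorem hasSum_graf {k R : ℝ} (hk : 0 < k) (hR : 0 < R) {y z : ℂ} (hy : ‖y‖ ≤ R)
    (hz : 3 * R ≤ ‖z‖) :
    HasSum (fun m : ℤ => Complex.exp (-(Complex.I * m * Complex.arg y)) * besselJ m (k * ‖y‖) *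
      outgoingWave k m z) (hankel 0 (k * ‖z - y‖)) := by
  have hpi := Real.pi_pos
  -- The plane is rotated so that the target lies on the positive real axis; ζ is then k (z - y) in
  -- the rotated frame.
  set u : ℂ := Complex.exp ((Complex.arg y - Complex.arg z : ℝ) * Complex.I) with hu
  have hun : ‖u‖ = 1 := Complex.norm_exp_ofReal_mul_I _
  set ζ : ℂ := (k * ‖z‖ : ℝ) - (k * ‖y‖ : ℝ) * u with hζ
  have hζ' : ζ = k * (z - y) * Complex.exp (-(Complex.arg z * Complex.I)) := by
    have h1 : (‖z‖ : ℂ) = z * Complex.exp (-(Complex.arg z * Complex.I)) := by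
      rw [Complex.exp_neg, eq_mul_inv_iff_mul_eq₀ (Complex.exp_ne_zero _)]
      exact Complex.norm_mul_exp_arg_mul_I z
    have h2 : (‖y‖ : ℂ) * u = y * Complex.exp (-(Complex.arg z * Complex.I)) := by
      conv_rhs => rw [← Complex.norm_mul_exp_arg_mul_I y]
      rw [mul_assoc, ← Complex.exp_add, hu]
      congr 2
      push_cast; ring
    rw [hζ]
    push_cast
    linear_combination (k : ℂ) * h1 - (k : ℂ) * h2
  have hσ : ‖ζ‖ = k * ‖z - y‖ := by
    rw [hζ', norm_mul, norm_mul, Complex.norm_real, Real.norm_of_nonneg hk.le, Complex.norm_exp]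
    simp
  -- Since k‖y‖ ≤ kR and k‖z‖ ≥ 3kR, the argument of ζ is less than π/2 in absolute value, as the
  -- contour rotation requires.
  have hre : 0 < ζ.re := by
    have h1 : ((k * ‖y‖ : ℝ) * u : ℂ).re ≤ k * ‖y‖ := by
      refine (Complex.re_le_norm _).trans ?_
      rw [norm_mul, hun, mul_one, Complex.norm_real, Real.norm_of_nonneg (by positivity)]
    rw [hζ, Complex.sub_re, Complex.ofReal_re]
    nlinarith
  have hσ0 : 0 < ‖ζ‖ := norm_pos_iff.2 fun h => by simp [h] at hre
  have hχ : |Complex.arg ζ| < Real.pi / 2 := Complex.abs_arg_lt_pi_div_two_iff.2 (Or.inl hre)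
  have hpol : (‖ζ‖ : ℂ) * Complex.exp (Complex.arg ζ * Complex.I) =
      (k * ‖z‖ : ℝ) - (k * ‖y‖ : ℝ) * u := Complex.norm_mul_exp_arg_mul_I ζ
  have h1 := hasSum_trig_part hun hpol
  have h2 := hasSum_exp_part (κ := k * R) (by positivity) (by positivity) (by gcongr)
    (by nlinarith) hun hσ0 hχ hpol
  have h3 := (h1.sub (h2.mul_left Complex.I)).div_const (Real.pi : ℂ)
  have hpi' : (Real.pi : ℂ) ≠ 0 := by exact_mod_cast hpi.ne'
  rw [← pi_mul_hankel_zero_eq hσ0 hχ, mul_div_cancel_left₀ _ hpi', hσ] at h3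
  have e : ∀ m : ℤ, u ^ (-m) = Complex.exp (-(Complex.I * m * Complex.arg y)) *
      Complex.exp (Complex.I * m * Complex.arg z) := by
    intro m
    rw [hu, ← Complex.exp_int_mul, ← Complex.exp_add]
    congr 1
    push_cast; ring
  refine h3.congr_fun fun m => ?_
  rw [outgoingWave, hankel_eq, e]
  field_simp

/-! ### Truncation of two-sided series -/

theorem hasSum_indicator_compl_Icc {a : ℤ → ℂ} {S : ℂ} (h : HasSum a S) (P : ℕ) :
    HasSum (fun m => if m ∈ Finset.Icc (-(P : ℤ)) P then 0 else a m)
      (S - ∑ m ∈ Finset.Icc (-(P : ℤ)) P, a m) := by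
  have h1 : HasSum (fun m => if m ∈ Finset.Icc (-(P : ℤ)) P then a m else 0)
      (∑ m ∈ Finset.Icc (-(P : ℤ)) P, a m) := by
    have h0 : HasSum (fun m => if m ∈ Finset.Icc (-(P : ℤ)) P then a m else 0)
        (∑ m ∈ Finset.Icc (-(P : ℤ)) P, if m ∈ Finset.Icc (-(P : ℤ)) P then a m else 0) :=
      hasSum_sum_of_ne_finset_zero fun b hb => if_neg hb
    rwa [Finset.sum_congr rfl fun m hm => if_pos hm] at h0
  refine (h.sub h1).congr_fun fun m => ?_
  split_ifs <;> simp

theorem hasSum_truncated_geometric (P : ℕ) (E : ℝ) :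
    HasSum (fun m : ℤ => if m.natAbs ≤ P then 0 else E * (1 / 3) ^ (m.natAbs - (P + 1))) (3 * E) := by
  have hg : HasSum (fun j : ℕ => E * (1 / 3 : ℝ) ^ j) (E * (3 / 2)) := by
    have := (hasSum_geometric_of_lt_one (by norm_num : (0 : ℝ) ≤ 1 / 3) (by norm_num)).mul_left E
    norm_num at this ⊢
    exact this
  set g : ℤ → ℝ := fun m => if m.natAbs ≤ P then 0 else E * (1 / 3) ^ (m.natAbs - (P + 1)) with hgdef
  have hg0 : ∀ m : ℤ, m.natAbs ≤ P → g m = 0 := fun m hm => if_pos hm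
  have hg1 : ∀ (m : ℤ) (j : ℕ), m.natAbs = P + 1 + j → g m = E * (1 / 3) ^ j := fun m j hm => by
    rw [hgdef]
    beta_reduce
    rw [if_neg (by omega), hm, Nat.add_sub_cancel_left]
  clear_value g
  have h1 : HasSum (fun n : ℕ => g n) (E * (3 / 2)) := by
    rw [← hasSum_nat_add_iff' (P + 1), Finset.sum_eq_zero, sub_zero]
    · exact hg.congr_fun fun j => hg1 _ _ (by omega)
    · intro n hn
      exact hg0 _ (by have := Finset.mem_range.1 hn; omega)
  have h2 : HasSum (fun n : ℕ => g (-((n : ℤ) + 1))) (E * (3 / 2)) := by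
    -- Negative indices are written as -(n+1), so the tail starts at n = P and not at P + 1.
    rw [← hasSum_nat_add_iff' P, Finset.sum_eq_zero, sub_zero]
    · exact hg.congr_fun fun j => hg1 _ _ (by omega)
    · intro n hn
      exact hg0 _ (by have := Finset.mem_range.1 hn; omega)
  have h3 := HasSum.of_nat_of_neg_add_one h1 h2
  rwa [show E * (3 / 2) + E * (3 / 2) = 3 * E by ring] at h3

/-- Both tails are compared with a geometric series of ratio 1/3. The factor 1/(P+1) is retained
because the lower bound for ε carries it too. -/
theorem norm_sub_sum_Icc_le {a : ℤ → ℂ} {S : ℂ} {D : ℝ} (P : ℕ) (h : HasSum a S) (hD : 0 ≤ D)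
    (hb : ∀ (l : ℕ) (m : ℤ), m.natAbs = l + 1 → ‖a m‖ ≤ D * ((1 / 3) ^ (l + 1) / (l + 1))) :
    ‖S - ∑ m ∈ Finset.Icc (-(P : ℤ)) P, a m‖ ≤ 3 * (D * ((1 / 3) ^ (P + 1) / (P + 1))) := by
  have h1 := hasSum_indicator_compl_Icc h P
  rw [← h1.tsum_eq]
  refine tsum_of_norm_bounded (hasSum_truncated_geometric P (D * ((1 / 3) ^ (P + 1) / (P + 1))))
    fun m => ?_
  have hiff : m ∈ Finset.Icc (-(P : ℤ)) P ↔ m.natAbs ≤ P := by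
    rw [Finset.mem_Icc]; omega
  by_cases hm : m.natAbs ≤ P
  · rw [if_pos (hiff.2 hm), if_pos hm, norm_zero]
  · rw [if_neg (mt hiff.1 hm), if_neg hm]
    obtain ⟨j, hj⟩ : ∃ j, m.natAbs = P + j + 1 := ⟨m.natAbs - (P + 1), by omega⟩
    refine (hb (P + j) m hj).trans ?_
    rw [hj, show P + j + 1 - (P + 1) = j by omega, mul_assoc]
    gcongr
    rw [show P + j + 1 = (P + 1) + j by ring, pow_add, mul_div_right_comm]
    gcongr
    linarith [(by positivity : (0 : ℝ) ≤ j)]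

/-! ### Accuracy of the free-space expansion -/

/-- The multipole coefficient of a unit source at `y`, relative to the centre. -/
noncomputable def sourceCoeff (k : ℝ) (y : ℂ) (m : ℤ) : ℂ :=
  Complex.exp (-(Complex.I * m * Complex.arg y)) * besselJ m (k * ‖y‖)

theorem norm_sourceCoeff (k : ℝ) (y : ℂ) (m : ℤ) : ‖sourceCoeff k y m‖ = |besselJ m (k * ‖y‖)| := by
  rw [sourceCoeff, norm_mul, norm_exp_neg_I_mul_int_mul, one_mul, Complex.norm_real,
    Real.norm_eq_abs]

theorem norm_outgoingWave (k : ℝ) (m : ℤ) (z : ℂ) :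
    ‖outgoingWave k m z‖ = ‖hankel m (k * ‖z‖)‖ := by
  rw [outgoingWave, norm_mul, norm_exp_I_mul_int_mul, mul_one]

theorem norm_outgoingWave_le {k R : ℝ} (hk : 0 < k) (hR : 0 < R) (m : ℤ) {z : ℂ}
    (hz : 3 * R ≤ ‖z‖) : ‖outgoingWave k m z‖ ≤ 1 + expMoment m.natAbs (3 * (k * R)) := by
  rw [norm_outgoingWave]
  refine norm_hankel_le m (by positivity) ?_
  nlinarith

theorem norm_hankel_sub_le {k R : ℝ} (hk : 0 < k) (hR : 0 < R) (P : ℕ) {y z : ℂ} (hy : ‖y‖ ≤ R)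
    (hz : 3 * R ≤ ‖z‖) :
    ‖hankel 0 (k * ‖z - y‖) - ∑ m ∈ Finset.Icc (-(P : ℤ)) P, sourceCoeff k y m * outgoingWave k m z‖
      ≤ 3 * (termConst (k * R) * ((1 / 3) ^ (P + 1) / (P + 1))) := by
  have hκ : 0 < k * R := by positivity
  refine norm_sub_sum_Icc_le P (hasSum_graf hk hR hy hz) (termConst_pos hκ).le fun l m hm => ?_
  have h1 := norm_outgoingWave_le hk hR m hz
  have h2 := abs_besselJ_mul_one_add_expMoment_le hκ (x := k * ‖y‖) (by positivity) (by gcongr) hm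
  calc _ = ‖sourceCoeff k y m‖ * ‖outgoingWave k m z‖ := norm_mul _ _
    _ ≤ |besselJ m (k * ‖y‖)| * (1 + expMoment m.natAbs (3 * (k * R))) := by
        rw [norm_sourceCoeff]; gcongr
    _ ≤ _ := h2

theorem multipoleCoeff_eq (k : ℝ) {N : ℕ} (q : Fin N → ℝ) (xs : Fin N → ℂ) (xc : ℂ) (p : ℤ) :
    multipoleCoeff k q xs xc p = ∑ j, (q j : ℂ) * sourceCoeff k (xs j - xc) p := by
  simp only [multipoleCoeff, sourceCoeff, mul_assoc]

theorem sum_sourceCoeff_mul (P : ℕ) {N : ℕ} (q : Fin N → ℝ) (c : Fin N → ℤ → ℂ) (w : ℤ → ℂ) :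
    Complex.I / 4 * ∑ p ∈ Finset.Icc (-(P : ℤ)) P, (∑ j, (q j : ℂ) * c j p) * w p =
      ∑ j, (q j : ℂ) * (Complex.I / 4 * ∑ p ∈ Finset.Icc (-(P : ℤ)) P, c j p * w p) := by
  simp_rw [Finset.mul_sum, Finset.sum_mul, Finset.mul_sum]
  rw [Finset.sum_comm]
  refine Finset.sum_congr rfl fun j _ => Finset.sum_congr rfl fun p _ => ?_
  ring

theorem norm_sum_mul_le {N : ℕ} (q : Fin N → ℝ) (e : Fin N → ℂ) {E : ℝ} (h : ∀ j, ‖e j‖ ≤ E) :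
    ‖∑ j, (q j : ℂ) * e j‖ ≤ E * ∑ j, |q j| := by
  refine (norm_sum_le _ _).trans ?_
  rw [Finset.mul_sum]
  refine Finset.sum_le_sum fun j _ => ?_
  rw [norm_mul, Complex.norm_real, Real.norm_eq_abs, mul_comm]
  exact mul_le_mul_of_nonneg_right (h j) (abs_nonneg _)

theorem freeSpaceAccuracy_termConst {k R : ℝ} (hk : 0 < k) (hR : 0 < R) (P : ℕ) :
    FreeSpaceAccuracy k R P (termConst (k * R) * (1 / 3) ^ P) := by
  intro N q xs xc x hw
  have hpos := termConst_pos (mul_pos hk hR)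
  rw [multipoleExpansion]
  simp_rw [multipoleCoeff_eq]
  rw [sum_sourceCoeff_mul, ← Finset.sum_sub_distrib]
  simp_rw [← mul_sub]
  refine norm_sum_mul_le q _ fun j => ?_
  have h1 := norm_hankel_sub_le hk hR P (hw.1 j) hw.2
  rw [sub_sub_sub_cancel_right] at h1
  rw [freeGreen, ← mul_sub, norm_mul, norm_div, Complex.norm_I]
  have h2 : (1 / 3 : ℝ) ^ (P + 1) / (P + 1) ≤ (1 / 3) ^ P := by
    rw [div_le_iff₀ (by positivity), pow_succ]
    have : (0 : ℝ) < (1 / 3) ^ P := by positivity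
    have h3 : (0 : ℝ) ≤ P := by positivity
    nlinarith
  have h3 : termConst (k * R) * ((1 / 3) ^ (P + 1) / (P + 1)) ≤ termConst (k * R) * (1 / 3) ^ P := by
    gcongr
  have h4 : ‖(4 : ℂ)‖ = 4 := by norm_num
  rw [h4]
  nlinarith [norm_nonneg (hankel 0 (k * ‖x - xs j‖) -
    ∑ m ∈ Finset.Icc (-(P : ℤ)) P, sourceCoeff k (xs j - xc) m * outgoingWave k m (x - xc))]

theorem exp_I_mul_int_mul_arg {z : ℂ} (hz : z ≠ 0) (m : ℤ) :
    Complex.exp (Complex.I * m * Complex.arg z) = (z / ‖z‖) ^ m := by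
  have h : Complex.exp (Complex.arg z * Complex.I) = z / ‖z‖ := by
    rw [eq_div_iff (by exact_mod_cast norm_ne_zero_iff.2 hz), mul_comm]
    exact Complex.norm_mul_exp_arg_mul_I z
  rw [← h, ← Complex.exp_int_mul]
  congr 1
  ring

/-- For one unit source at R and a target moving on the circle of radius 3R, Graf's series minus its
truncation is a Fourier series in θ containing the omitted orders only. It is bounded by ε for every
θ, hence so is each coefficient. -/
theorem FreeSpaceAccuracy.le_of_lt {k R ε : ℝ} {P : ℕ} (h : FreeSpaceAccuracy k R P ε) (hk : 0 < k)
    (hR : 0 < R) {p : ℤ} (hp : (P : ℤ) < p) :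
    |besselJ p (k * R)| * ‖hankel p (3 * (k * R))‖ / 4 ≤ ε := by
  have hκ : 0 < k * R := by positivity
  have hRn : ‖(R : ℂ)‖ = R := by rw [Complex.norm_real, Real.norm_of_nonneg hR.le]
  set x : ℝ → ℂ := fun θ => (3 * R : ℝ) * Complex.exp (θ * Complex.I) with hx
  have hxn : ∀ θ, ‖x θ‖ = 3 * R := fun θ => by
    rw [hx, norm_mul, Complex.norm_exp_ofReal_mul_I, mul_one, Complex.norm_real,
      Real.norm_of_nonneg (by positivity)]
  have hx0 : ∀ θ, x θ ≠ 0 := fun θ => norm_pos_iff.1 (by rw [hxn]; positivity)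
  have hW : ∀ θ (m : ℤ), outgoingWave k m (x θ) =
      hankel m (3 * (k * R)) * Complex.exp (Complex.I * m * θ) := fun θ m => by
    rw [outgoingWave, exp_I_mul_int_mul_arg (hx0 θ), hxn, show k * (3 * R) = 3 * (k * R) by ring]
    congr 1
    have h3R : ((3 * R : ℝ) : ℂ) ≠ 0 := by exact_mod_cast (by positivity : 3 * R ≠ 0)
    rw [hx, mul_div_cancel_left₀ _ h3R, ← Complex.exp_int_mul]
    congr 1; ring
  set c : ℤ → ℂ := fun m => if m ∈ Finset.Icc (-(P : ℤ)) P then 0 else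
    Complex.I / 4 * (sourceCoeff k R m * hankel m (3 * (k * R))) with hc
  set f : ℝ → ℂ := fun θ => Complex.I / 4 * (hankel 0 (k * ‖x θ - R‖) -
    ∑ m ∈ Finset.Icc (-(P : ℤ)) P, sourceCoeff k R m * outgoingWave k m (x θ)) with hf
  have hsum : ∀ θ : ℝ, HasSum (fun m : ℤ => c m * Complex.exp (Complex.I * m * θ)) (f θ) := fun θ => by
    have h1 := (hasSum_indicator_compl_Icc (hasSum_graf hk hR hRn.le (hxn θ).ge) P).mul_left
      (Complex.I / 4)
    refine h1.congr_fun fun m => ?_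
    simp only [hc]
    split_ifs
    · simp
    · rw [hW, sourceCoeff]; ring
  have hcs : Summable fun m => ‖c m‖ := by
    refine Summable.of_nonneg_of_le (fun _ => norm_nonneg _) (fun m => ?_)
      (summable_besselJ_mul_one_add_expMoment hκ hκ.le le_rfl)
    have h0 : 0 ≤ |besselJ m (k * R)| * (1 + expMoment m.natAbs (3 * (k * R))) :=
      mul_nonneg (abs_nonneg _) (add_nonneg zero_le_one (expMoment_nonneg _ _))
    simp only [hc]
    split_ifs
    · rwa [norm_zero]
    · rw [norm_mul, norm_mul, norm_sourceCoeff, hRn, norm_div, Complex.norm_I]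
      have h1 := norm_hankel_le m (by positivity : 0 < 3 * (k * R)) le_rfl
      have h2 : |besselJ m (k * R)| * ‖hankel m (3 * (k * R))‖ ≤
          |besselJ m (k * R)| * (1 + expMoment m.natAbs (3 * (k * R))) := by gcongr
      have h4 : ‖(4 : ℂ)‖ = 4 := by norm_num
      rw [h4]
      linarith
  have hle : ∀ θ, ‖f θ‖ ≤ ε := fun θ => by
    have h1 := h 1 (fun _ => 1) (fun _ => (R : ℂ)) 0 (x θ)
      ⟨fun _ => by rw [sub_zero, hRn], by rw [sub_zero, hxn]⟩
    simp only [multipoleExpansion, multipoleCoeff_eq, Fin.sum_univ_one, Complex.ofReal_one, one_mul,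
      sub_zero, abs_one, mul_one, freeGreen, ← mul_sub] at h1
    exact h1
  have := norm_coeff_le_of_hasSum hcs hsum hle p
  have hpn : p ∉ Finset.Icc (-(P : ℤ)) P := fun hm => by
    rw [Finset.mem_Icc] at hm; omega
  simp only [hc, if_neg hpn] at this
  rw [norm_mul, norm_mul, norm_sourceCoeff, hRn, norm_div, Complex.norm_I] at this
  have h4 : ‖(4 : ℂ)‖ = 4 := by norm_num
  rw [h4] at this
  linarith

/-- For large order the leading parts of both lower bounds survive up to a fixed fraction, and their
product again contains the exact factor 3^(-(m+1))/(m+1). -/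
theorem exists_le_besselJ_mul_hankel {κ : ℝ} (hκ : 0 < κ) : ∃ m₀ : ℕ, ∀ m ≥ m₀,
    1 / (32 * Real.pi) * ((1 / 3) ^ (m + 1) / (m + 1)) ≤
      |besselJ ((m + 1 : ℕ) : ℤ) κ| * ‖hankel ((m + 1 : ℕ) : ℤ) (3 * κ)‖ / 4 := by
  have hpi := Real.pi_pos
  have hM := expMoment_nonneg 1 (3 * κ)
  -- With A = (2/(3κ))^(m+1) m!, the condition (3κ/2)^m/m! ≤ δ says A ≥ 4 (M + π), where M is the
  -- first moment; this is equivalent to (A/2 - M)/π - 1 ≥ A/(4π).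
  set δ : ℝ := 1 / (3 * κ / 2 * (4 * (expMoment 1 (3 * κ) + Real.pi))) with hδ
  have hδ0 : 0 < δ := by positivity
  have h1 := (FloorSemiring.tendsto_pow_div_factorial_atTop (3 * κ / 2)).eventually_le_const hδ0
  have h2 := (tendsto_natCast_atTop_atTop (R := ℝ)).eventually_ge_atTop (2 * Real.exp (κ ^ 2 / 4))
  obtain ⟨m₀, hm₀⟩ := eventually_atTop.1 (h1.and h2)
  refine ⟨m₀, fun m hm => ?_⟩
  obtain ⟨h3, h4⟩ := hm₀ m hm
  have hJ : (κ / 2) ^ (m + 1) / (m + 1).factorial / 2 ≤ |besselJ ((m + 1 : ℕ) : ℤ) κ| := by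
    refine le_trans ?_ ((le_besselJ (m + 1) hκ.le).trans (le_abs_self _))
    rw [div_eq_mul_one_div _ 2]
    gcongr
    have : Real.exp (κ ^ 2 / 4) / ((m + 1 : ℕ) + 1) ≤ 1 / 2 := by
      rw [div_le_iff₀ (by positivity)]
      push_cast
      linarith
    linarith
  have hH : (2 / (3 * κ)) ^ (m + 1) * m.factorial / (4 * Real.pi) ≤
      ‖hankel ((m + 1 : ℕ) : ℤ) (3 * κ)‖ := by
    refine le_trans ?_ (le_norm_hankel m (by positivity : 0 < 3 * κ))
    have h5 : 4 * (expMoment 1 (3 * κ) + Real.pi) ≤ (2 / (3 * κ)) ^ (m + 1) * m.factorial := by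
      rw [hδ, div_le_div_iff₀ (by positivity) (by positivity)] at h3
      rw [show (2 / (3 * κ) : ℝ) = (3 * κ / 2)⁻¹ by field_simp, inv_pow, ← div_eq_inv_mul,
        le_div_iff₀ (by positivity), pow_succ]
      linarith
    rw [div_sub_one hpi.ne', div_le_div_iff₀ (by positivity) (by positivity)]
    nlinarith
  have hmf : (0 : ℝ) < m.factorial := by positivity
  have e : (κ / 2) ^ (m + 1) / (m + 1).factorial / 2 *
      ((2 / (3 * κ)) ^ (m + 1) * m.factorial / (4 * Real.pi)) / 4 =
      1 / (32 * Real.pi) * ((1 / 3) ^ (m + 1) / (m + 1)) := by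
    rw [Nat.factorial_succ, show (1 / 3 : ℝ) = κ / 2 * (2 / (3 * κ)) by field_simp, mul_pow]
    push_cast
    field_simp
    norm_num
  rw [← e]
  gcongr

theorem exists_le_accuracy {κ : ℝ} (hκ : 0 < κ) : ∃ c : ℝ, 0 < c ∧ ∀ k R : ℝ, 0 < k → 0 < R →
    k * R = κ → ∀ (P : ℕ) (ε : ℝ), FreeSpaceAccuracy k R P ε →
      c * ((1 / 3) ^ (P + 1) / (P + 1)) ≤ ε := by
  have hpi := Real.pi_pos
  obtain ⟨m₀, hm₀⟩ := exists_le_besselJ_mul_hankel hκ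
  have hle : ∀ n : ℕ, (1 / 3 : ℝ) ^ (n + 1) / (n + 1) ≤ 1 := fun n => by
    rw [div_le_one (by positivity)]
    refine (pow_le_one₀ (by norm_num) (by norm_num)).trans ?_
    linarith [(by positivity : (0 : ℝ) ≤ n)]
  refine ⟨1 / (32 * Real.pi) * ((1 / 3) ^ (m₀ + 1) / (m₀ + 1)), by positivity, ?_⟩
  rintro k R hk hR rfl P ε h
  -- For P ≥ m₀ the first omitted order P + 1 is tested. For P ≤ m₀ the order m₀ + 1 is omitted as
  -- well, and it bounds ε below by a fixed positive number.
  rcases le_total m₀ P with hP | hP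
  · refine le_trans ?_ ((hm₀ P hP).trans (h.le_of_lt hk hR (by push_cast; omega)))
    have := hle m₀
    gcongr
    exact mul_le_of_le_one_right (by positivity) this
  · refine le_trans ?_ ((hm₀ m₀ le_rfl).trans (h.le_of_lt hk hR (by push_cast; omega)))
    exact mul_le_of_le_one_right (by positivity) (hle P)

/-! ### Polar coordinates along a vertical half-line -/

/-- The distance from the origin along the vertical half-line from `z`. -/
noncomputable def rad (z : ℂ) (s : ℝ) : ℝ := ‖z + s * Complex.I‖

/-- The derivative of `rad z`. -/
noncomputable def slope (z : ℂ) (s : ℝ) : ℝ := (z.im + s) / rad z s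

/-- The angular factor `e^{i p θ}` along the vertical half-line from `z`. -/
noncomputable def phase (z : ℂ) (p : ℤ) (s : ℝ) : ℂ := ((z + s * Complex.I) / (rad z s : ℂ)) ^ p

theorem rad_sq (z : ℂ) (s : ℝ) : rad z s ^ 2 = z.re ^ 2 + (z.im + s) ^ 2 := by
  rw [rad, Complex.sq_norm, Complex.normSq_apply]
  simp
  ring

theorem rad_nonneg (z : ℂ) (s : ℝ) : 0 ≤ rad z s := norm_nonneg _

theorem norm_le_rad {z : ℂ} {s : ℝ} (hz : 0 ≤ z.im) (hs : 0 ≤ s) : ‖z‖ ≤ rad z s := by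
  refine le_of_sq_le_sq ?_ (rad_nonneg z s)
  rw [rad_sq, Complex.sq_norm, Complex.normSq_apply]
  nlinarith [mul_nonneg hz hs]

theorem im_add_le_rad (z : ℂ) (s : ℝ) : z.im + s ≤ rad z s := by
  refine le_of_sq_le_sq ?_ (rad_nonneg z s)
  rw [rad_sq]
  nlinarith [sq_nonneg z.re]

theorem abs_re_le_rad (z : ℂ) (s : ℝ) : |z.re| ≤ rad z s := by
  refine abs_le_of_sq_le_sq ?_ (rad_nonneg z s)
  rw [rad_sq]
  nlinarith [sq_nonneg (z.im + s)]

theorem rad_pos {z : ℂ} {s : ℝ} (hz : 0 ≤ z.im) (hz0 : z ≠ 0) (hs : 0 ≤ s) : 0 < rad z s :=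
  (norm_pos_iff.2 hz0).trans_le (norm_le_rad hz hs)

theorem hasDerivAt_rad {z : ℂ} {s : ℝ} (h : 0 < rad z s) :
    HasDerivAt (rad z) (slope z s) s := by
  have e : rad z = fun s => Real.sqrt (z.re ^ 2 + (z.im + s) ^ 2) := by
    funext s
    rw [← rad_sq, Real.sqrt_sq (rad_nonneg z s)]
  have h0 : z.re ^ 2 + (z.im + s) ^ 2 ≠ 0 := by rw [← rad_sq]; positivity
  have h1 : HasDerivAt (fun s => z.re ^ 2 + (z.im + s) ^ 2) (2 * (z.im + s)) s := by
    have := (((hasDerivAt_id s).const_add z.im).pow 2).const_add (z.re ^ 2)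
    simpa using this
  have h2 := h1.sqrt h0
  rw [← rad_sq, Real.sqrt_sq (rad_nonneg z s)] at h2
  rw [e]
  refine h2.congr_deriv ?_
  rw [slope]
  field_simp

theorem hasDerivAt_slope {z : ℂ} {s : ℝ} (h : 0 < rad z s) :
    HasDerivAt (slope z) (z.re ^ 2 / rad z s ^ 3) s := by
  have h1 := ((hasDerivAt_id s).const_add z.im).div (hasDerivAt_rad h) h.ne'
  refine h1.congr_deriv ?_
  have h2 := rad_sq z s
  simp only [slope, id]
  field_simp
  linarith

theorem slope_nonneg {z : ℂ} {s : ℝ} (hz : 0 ≤ z.im) (hs : 0 ≤ s) : 0 ≤ slope z s :=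
  div_nonneg (by linarith) (rad_nonneg z s)

theorem slope_le_one (z : ℂ) (s : ℝ) : slope z s ≤ 1 :=
  div_le_one_of_le₀ (im_add_le_rad z s) (rad_nonneg z s)

theorem add_mul_I_ne_zero {z : ℂ} {s : ℝ} (h : 0 < rad z s) : z + s * Complex.I ≠ 0 :=
  norm_pos_iff.1 h

theorem norm_phase {z : ℂ} (p : ℤ) {s : ℝ} (h : 0 < rad z s) : ‖phase z p s‖ = 1 := by
  rw [phase, norm_zpow, norm_div, Complex.norm_real, Real.norm_of_nonneg h.le, ← rad,
    div_self h.ne', one_zpow]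

theorem hasDerivAt_phase {z : ℂ} (p : ℤ) {s : ℝ} (h : 0 < rad z s) :
    HasDerivAt (phase z p) (p * (Complex.I * (z.re / rad z s ^ 2 : ℝ)) * phase z p s) s := by
  have hr : (rad z s : ℂ) ≠ 0 := by exact_mod_cast h.ne'
  have h0 := add_mul_I_ne_zero h
  have h1 : HasDerivAt (fun s : ℝ => z + s * Complex.I) Complex.I s := by
    simpa using ((Complex.ofRealCLM.hasDerivAt (x := s)).mul_const Complex.I).const_add z
  have h2 := h1.div (hasDerivAt_rad h).ofReal_comp hr
  have hq : (z + s * Complex.I) / (rad z s : ℂ) ≠ 0 := div_ne_zero h0 hr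
  have h3 := (hasDerivAt_zpow p _ (Or.inl hq)).scomp s h2
  refine h3.congr_deriv ?_
  have hsq : (rad z s : ℂ) ^ 2 = z.re ^ 2 + (z.im + s) ^ 2 := by exact_mod_cast rad_sq z s
  have e : (Complex.I * (rad z s : ℂ) - (z + s * Complex.I) * (slope z s : ℂ)) / (rad z s : ℂ) ^ 2 =
      (Complex.I * (z.re / rad z s ^ 2 : ℝ)) * ((z + s * Complex.I) / (rad z s : ℂ)) := by
    have hz : z + s * Complex.I = z.re + (z.im + s) * Complex.I := by
      conv_lhs => rw [← Complex.re_add_im z]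
      ring
    rw [hz, slope]
    push_cast
    field_simp
    rw [hsq]
    linear_combination (-(z.re : ℂ) * (z.im + s)) * Complex.I_sq
  rw [e, smul_eq_mul, phase, zpow_sub_one₀ hq]
  generalize (z + s * Complex.I) / (rad z s : ℂ) = w at hq ⊢
  field_simp

theorem continuous_rad (z : ℂ) : Continuous (rad z) := by unfold rad; fun_prop

/-- The integrand is the modulus of the derivative of the polar angle, which has an arctangent as
primitive, so its total variation is at most π. -/
theorem integral_variation_le {z : ℂ} (hz : 0 ≤ z.im) (hz0 : z ≠ 0) {T : ℝ} (hT : 0 ≤ T) :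
    ∫ s in (0 : ℝ)..T, |z.re| / rad z s ^ 2 ≤ Real.pi := by
  rcases eq_or_ne z.re 0 with h | h
  · simp [h, Real.pi_pos.le]
  · have ha : 0 < |z.re| := abs_pos.2 h
    have hd : ∀ s ∈ uIcc 0 T, HasDerivAt (fun s => Real.arctan ((z.im + s) / |z.re|))
        (|z.re| / rad z s ^ 2) s := by
      intro s _
      have h1 := ((((hasDerivAt_id s).const_add z.im).div_const |z.re|)).arctan
      refine h1.congr_deriv ?_
      rw [rad_sq, ← sq_abs z.re]
      simp only [id]
      field_simp
    rw [intervalIntegral.integral_eq_sub_of_hasDerivAt hd]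
    · have := Real.arctan_lt_pi_div_two ((z.im + T) / |z.re|)
      have h2 := Real.neg_pi_div_two_lt_arctan ((z.im + 0) / |z.re|)
      linarith
    · refine ContinuousOn.intervalIntegrable fun s hs => ?_
      rw [uIcc_of_le hT] at hs
      have := rad_pos hz hz0 hs.1
      exact (continuousAt_const.div ((continuous_rad z).continuousAt.pow 2)
        (pow_pos this 2).ne').continuousWithinAt

/-! ### The oscillatory part of the line integrals -/

/-- Here Re α ≥ 0 enters: the derivative c r' + α of the complex phase cannot cancel, so there is no
stationary point. -/
theorem norm_le_norm_ofReal_add {α : ℂ} (hα : 0 ≤ α.re) {c : ℝ} (hc : 0 ≤ c) :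
    ‖α‖ ≤ ‖(c : ℂ) + α‖ := by
  refine le_of_sq_le_sq ?_ (norm_nonneg _)
  rw [Complex.sq_norm, Complex.sq_norm, Complex.normSq_apply, Complex.normSq_apply]
  simp
  nlinarith [mul_nonneg hα hc]

theorem sq_add_le_two_mul_norm_sq {α : ℂ} (hα : 0 ≤ α.re) {c : ℝ} (hc : 0 ≤ c) :
    (‖α‖ + c) ^ 2 ≤ 2 * ‖(c : ℂ) + α‖ ^ 2 := by
  have h1 : ‖α‖ ^ 2 + c ^ 2 ≤ ‖(c : ℂ) + α‖ ^ 2 := by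
    rw [Complex.sq_norm, Complex.sq_norm, Complex.normSq_apply, Complex.normSq_apply]
    simp
    nlinarith [mul_nonneg hα hc]
  nlinarith [sq_nonneg (‖α‖ - c)]

theorem ofReal_add_ne_zero {α : ℂ} (hα0 : α ≠ 0) (hα : 0 ≤ α.re) {c : ℝ} (hc : 0 ≤ c) :
    (c : ℂ) + α ≠ 0 :=
  norm_pos_iff.1 ((norm_pos_iff.2 hα0).trans_le (norm_le_norm_ofReal_add hα hc))

theorem continuousAt_phase {z : ℂ} (p : ℤ) {s : ℝ} (h : 0 < rad z s) :
    ContinuousAt (phase z p) s := (hasDerivAt_phase p h).continuousAt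

theorem continuousAt_slope {z : ℂ} {s : ℝ} (h : 0 < rad z s) :
    ContinuousAt (slope z) s := (hasDerivAt_slope h).continuousAt

/-- The oscillating exponential `e^{i (c r(s) + α s)}`. -/
noncomputable def oscExp (z α : ℂ) (c s : ℝ) : ℂ :=
  Complex.exp (Complex.I * (c * rad z s + α * s))

/-- The quotient of the amplitude by the derivative of the complex phase `c r(s) + α s`. -/
noncomputable def oscAmp (z α : ℂ) (p : ℤ) (c s : ℝ) : ℂ :=
  α * phase z p s / ((c * slope z s : ℝ) + α)

/-- The derivative of `oscAmp`. -/
noncomputable def oscAmpDeriv (z α : ℂ) (p : ℤ) (c s : ℝ) : ℂ :=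
  α * (p * (Complex.I * (z.re / rad z s ^ 2 : ℝ)) * phase z p s) / ((c * slope z s : ℝ) + α) -
    α * phase z p s * (c * (z.re ^ 2 / rad z s ^ 3) : ℝ) / ((c * slope z s : ℝ) + α) ^ 2

/-- The factor `e^{i p θ} i α e^{i α s}` common to all line image integrands. -/
noncomputable def lineAmp (z α : ℂ) (p : ℤ) (s : ℝ) : ℂ :=
  phase z p s * (Complex.I * α * Complex.exp (Complex.I * α * s))

theorem norm_exp_I_mul_mul_le {α : ℂ} (hα : 0 ≤ α.im) {s : ℝ} (hs : 0 ≤ s) :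
    ‖Complex.exp (Complex.I * α * s)‖ ≤ 1 := by
  rw [Complex.norm_exp, Real.exp_le_one_iff]
  simp
  positivity

theorem norm_oscExp_le {z α : ℂ} (hα : 0 ≤ α.im) (c : ℝ) {s : ℝ} (hs : 0 ≤ s) :
    ‖oscExp z α c s‖ ≤ 1 := by
  rw [oscExp, Complex.norm_exp, Real.exp_le_one_iff]
  simp
  positivity

theorem norm_oscAmp_le {z α : ℂ} (hz : 0 ≤ z.im) (hz0 : z ≠ 0) (hα : 0 ≤ α.re) (p : ℤ) {c s : ℝ}
    (hc : 0 ≤ c) (hs : 0 ≤ s) : ‖oscAmp z α p c s‖ ≤ 1 := by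
  have hr := rad_pos hz hz0 hs
  rw [oscAmp, norm_div, norm_mul, norm_phase p hr, mul_one]
  exact div_le_one_of_le₀ (norm_le_norm_ofReal_add hα (mul_nonneg hc (slope_nonneg hz hs)))
    (norm_nonneg _)

theorem norm_lineAmp_le {z α : ℂ} (hz : 0 ≤ z.im) (hz0 : z ≠ 0) (hα : 0 ≤ α.im) (p : ℤ) {s : ℝ}
    (hs : 0 ≤ s) : ‖lineAmp z α p s‖ ≤ ‖α‖ := by
  rw [lineAmp, norm_mul, norm_phase p (rad_pos hz hz0 hs), one_mul, norm_mul, norm_mul,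
    Complex.norm_I, one_mul]
  exact mul_le_of_le_one_right (norm_nonneg _) (norm_exp_I_mul_mul_le hα hs)

/-- This is the integration by parts for a non-stationary phase: the amplitude is divided by the
phase derivative, and differentiating the exponential restores the integrand. -/
theorem hasDerivAt_oscAmp_mul_oscExp {z α : ℂ} (hz : 0 ≤ z.im) (hz0 : z ≠ 0) (hα0 : α ≠ 0)
    (hα : 0 ≤ α.re) (p : ℤ) {c s : ℝ} (hc : 0 ≤ c) (hs : 0 ≤ s) :
    HasDerivAt (fun s => oscAmp z α p c s * oscExp z α c s)
      (oscAmpDeriv z α p c s * oscExp z α c s +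
        Complex.exp (Complex.I * c * rad z s) * lineAmp z α p s) s := by
  have hr := rad_pos hz hz0 hs
  have hD := ofReal_add_ne_zero hα0 hα (mul_nonneg hc (slope_nonneg hz hs))
  have h1 : HasDerivAt (fun s => (((c * slope z s : ℝ) : ℂ) + α))
      ((c * (z.re ^ 2 / rad z s ^ 3) : ℝ) : ℂ) s :=
    (((hasDerivAt_slope hr).const_mul c).ofReal_comp).add_const α
  have h2 := ((hasDerivAt_phase p hr).const_mul α).div h1 hD
  have h3 : HasDerivAt (fun s : ℝ => Complex.I * (c * (rad z s : ℂ) + α * s))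
      (Complex.I * ((c * slope z s : ℝ) + α)) s := by
    have h := (((hasDerivAt_rad hr).ofReal_comp.const_mul (c : ℂ)).add
      ((Complex.ofRealCLM.hasDerivAt (x := s)).const_mul α)).const_mul Complex.I
    refine h.congr_deriv ?_
    simp
  have h4 := h2.mul h3.cexp
  refine h4.congr_deriv ?_
  have e : Complex.exp (Complex.I * c * rad z s) * Complex.exp (Complex.I * α * s) =
      Complex.exp (Complex.I * (c * rad z s + α * s)) := by
    rw [← Complex.exp_add]; congr 1; ring
  rw [lineAmp, oscAmpDeriv, oscExp,
    show Complex.exp (Complex.I * c * rad z s) * (phase z p s * (Complex.I * α *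
      Complex.exp (Complex.I * α * s))) = phase z p s * Complex.I * α *
      (Complex.exp (Complex.I * c * rad z s) * Complex.exp (Complex.I * α * s)) by ring, e]
  simp only [Pi.div_apply]
  generalize (((c * slope z s : ℝ) : ℂ) + α) = D at hD ⊢
  generalize Complex.exp (Complex.I * (c * rad z s + α * s)) = E
  field_simp

/-- The two terms come from the turning of the angle and from the change of slope. In the second, |c
r' + α|² is replaced by (|α| + c r')²/2, which makes it an exact derivative. -/
theorem norm_oscAmpDeriv_le {z α : ℂ} (hz : 0 ≤ z.im) (hz0 : z ≠ 0) (hα0 : α ≠ 0)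
    (hα : 0 ≤ α.re) (p : ℤ) {c s : ℝ} (hc : 0 ≤ c) (hs : 0 ≤ s) :
    ‖oscAmpDeriv z α p c s‖ ≤ |(p : ℝ)| * (|z.re| / rad z s ^ 2) +
      2 * ‖α‖ * (c * (z.re ^ 2 / rad z s ^ 3)) / (‖α‖ + c * slope z s) ^ 2 := by
  have hr := rad_pos hz hz0 hs
  have hcs := mul_nonneg hc (slope_nonneg hz hs)
  have hD := ofReal_add_ne_zero hα0 hα hcs
  have hαp := norm_pos_iff.2 hα0
  have h1 := norm_le_norm_ofReal_add hα hcs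
  have h2 := sq_add_le_two_mul_norm_sq hα hcs
  have hDp := norm_pos_iff.2 hD
  refine (norm_sub_le _ _).trans (add_le_add ?_ ?_)
  · rw [norm_div, norm_mul, norm_mul, norm_mul, norm_mul, norm_phase p hr, Complex.norm_I,
      Complex.norm_real, Complex.norm_intCast, Real.norm_eq_abs, abs_div, abs_of_pos (pow_pos hr 2),
      mul_one, one_mul, div_le_iff₀ hDp, mul_comm]
    gcongr
  · have h0 : 0 ≤ c * (z.re ^ 2 / rad z s ^ 3) := by positivity
    rw [norm_div, norm_mul, norm_mul, norm_phase p hr, mul_one, Complex.norm_real,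
      Real.norm_of_nonneg h0, norm_pow, div_le_div_iff₀ (by positivity) (by positivity)]
    calc _ ≤ ‖α‖ * (c * (z.re ^ 2 / rad z s ^ 3)) * (2 * ‖((c * slope z s : ℝ) : ℂ) + α‖ ^ 2) := by
          gcongr
      _ = _ := by ring

/-- A primitive is -2|α|/(|α| + c r'), whose values lie in [-2, 0] whatever c, α and T are. -/
theorem integral_slope_variation_le {z α : ℂ} (hz : 0 ≤ z.im) (hz0 : z ≠ 0) (hα0 : α ≠ 0)
    {c T : ℝ} (hc : 0 ≤ c) (hT : 0 ≤ T) :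
    IntervalIntegrable (fun s => 2 * ‖α‖ * (c * (z.re ^ 2 / rad z s ^ 3)) /
      (‖α‖ + c * slope z s) ^ 2) volume 0 T ∧
    ∫ s in (0 : ℝ)..T, 2 * ‖α‖ * (c * (z.re ^ 2 / rad z s ^ 3)) / (‖α‖ + c * slope z s) ^ 2 ≤ 2 := by
  have hαp := norm_pos_iff.2 hα0
  have hden : ∀ s, 0 ≤ s → 0 < ‖α‖ + c * slope z s := fun s hs => by
    have := mul_nonneg hc (slope_nonneg hz hs)
    linarith
  have hd : ∀ s ∈ uIcc 0 T, HasDerivAt (fun s => -(2 * ‖α‖) / (‖α‖ + c * slope z s))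
      (2 * ‖α‖ * (c * (z.re ^ 2 / rad z s ^ 3)) / (‖α‖ + c * slope z s) ^ 2) s := by
    intro s hs
    rw [uIcc_of_le hT] at hs
    have hr := rad_pos hz hz0 hs.1
    have h1 := (hasDerivAt_const s (-(2 * ‖α‖))).div
      (((hasDerivAt_slope hr).const_mul c).const_add ‖α‖) (hden s hs.1).ne'
    refine h1.congr_deriv ?_
    ring
  have hi : IntervalIntegrable (fun s => 2 * ‖α‖ * (c * (z.re ^ 2 / rad z s ^ 3)) /
      (‖α‖ + c * slope z s) ^ 2) volume 0 T := by
    refine ContinuousOn.intervalIntegrable fun s hs => ContinuousAt.continuousWithinAt ?_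
    rw [uIcc_of_le hT] at hs
    have hr := rad_pos hz hz0 hs.1
    have h1 := continuousAt_slope hr
    have h2 := (continuous_rad z).continuousAt (x := s)
    have h3 := (hden s hs.1).ne'
    have h4 := hr.ne'
    fun_prop (disch := positivity)
  refine ⟨hi, ?_⟩
  rw [intervalIntegral.integral_eq_sub_of_hasDerivAt hd hi]
  have h1 : ‖α‖ / (‖α‖ + c * slope z 0) ≤ 1 := by
    rw [div_le_one (hden 0 le_rfl)]
    have := mul_nonneg hc (slope_nonneg hz le_rfl)
    linarith
  have h2 : 0 ≤ ‖α‖ / (‖α‖ + c * slope z T) := div_nonneg hαp.le (hden T hT).le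
  have e : ∀ x : ℝ, -(2 * ‖α‖) / x = -2 * (‖α‖ / x) := fun x => by ring
  rw [e, e]
  linarith

theorem intervalIntegrable_variation {z : ℂ} (hz : 0 ≤ z.im) (hz0 : z ≠ 0) {T : ℝ} (hT : 0 ≤ T) :
    IntervalIntegrable (fun s => |z.re| / rad z s ^ 2) volume 0 T := by
  refine ContinuousOn.intervalIntegrable fun s hs => ContinuousAt.continuousWithinAt ?_
  rw [uIcc_of_le hT] at hs
  have h4 := rad_pos hz hz0 hs.1
  exact continuousAt_const.div ((continuous_rad z).continuousAt.pow 2) (pow_pos h4 2).ne'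

theorem continuousAt_oscAmpDeriv_mul_oscExp {z α : ℂ} (hz : 0 ≤ z.im) (hz0 : z ≠ 0) (hα0 : α ≠ 0)
    (hα : 0 ≤ α.re) (p : ℤ) {c s : ℝ} (hc : 0 ≤ c) (hs : 0 ≤ s) :
    ContinuousAt (fun s => oscAmpDeriv z α p c s * oscExp z α c s) s := by
  have hr := rad_pos hz hz0 hs
  have hD := ofReal_add_ne_zero hα0 hα (mul_nonneg hc (slope_nonneg hz hs))
  have h1 := continuousAt_slope hr
  have h2 := (continuous_rad z).continuousAt (x := s)
  have h3 := continuousAt_phase p hr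
  have h4 := hr.ne'
  have h5 : ContinuousAt (fun s => z.re / rad z s ^ 2) s := by
    fun_prop (disch := positivity)
  have h6 : ContinuousAt (fun s => c * (z.re ^ 2 / rad z s ^ 3)) s := by
    fun_prop (disch := positivity)
  have h7 : ContinuousAt (fun s => ((c * slope z s : ℝ) : ℂ) + α) s := by fun_prop
  have h8 : ContinuousAt (fun s => oscExp z α c s) s := by unfold oscExp; fun_prop
  unfold oscAmpDeriv
  refine ContinuousAt.mul (ContinuousAt.sub (ContinuousAt.div ?_ h7 hD)
    (ContinuousAt.div ?_ (h7.pow 2) (pow_ne_zero 2 hD))) h8 <;> fun_prop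

theorem continuousAt_lineAmp {z : ℂ} (α : ℂ) (hz : 0 ≤ z.im) (hz0 : z ≠ 0) (p : ℤ) {s : ℝ}
    (hs : 0 ≤ s) : ContinuousAt (lineAmp z α p) s := by
  have h3 := continuousAt_phase p (rad_pos hz hz0 hs)
  unfold lineAmp
  fun_prop

theorem integral_norm_oscAmpDeriv_le {z α : ℂ} (hz : 0 ≤ z.im) (hz0 : z ≠ 0) (hα0 : α ≠ 0)
    (hα : 0 ≤ α.re) (hα' : 0 ≤ α.im) (p : ℤ) {c T : ℝ} (hc : 0 ≤ c) (hT : 0 ≤ T) :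
    ∫ s in (0 : ℝ)..T, ‖oscAmpDeriv z α p c s * oscExp z α c s‖ ≤ |(p : ℝ)| * Real.pi + 2 := by
  obtain ⟨h1, h2⟩ := integral_slope_variation_le hz hz0 hα0 hc hT
  have h3 := intervalIntegrable_variation hz hz0 hT
  calc _ ≤ ∫ s in (0 : ℝ)..T, (|(p : ℝ)| * (|z.re| / rad z s ^ 2) +
      2 * ‖α‖ * (c * (z.re ^ 2 / rad z s ^ 3)) / (‖α‖ + c * slope z s) ^ 2) := by
        refine intervalIntegral.integral_mono_on hT ?_ ((h3.const_mul _).add h1) fun s hs => ?_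
        · refine ContinuousOn.intervalIntegrable fun s hs => ?_
          rw [uIcc_of_le hT] at hs
          exact (continuousAt_oscAmpDeriv_mul_oscExp hz hz0 hα0 hα p hc hs.1).norm.continuousWithinAt
        · rw [norm_mul]
          exact (mul_le_of_le_one_right (norm_nonneg _) (norm_oscExp_le hα' c hs.1)).trans
            (norm_oscAmpDeriv_le hz hz0 hα0 hα p hc hs.1)
    _ ≤ _ := by
        rw [intervalIntegral.integral_add (h3.const_mul _) h1, intervalIntegral.integral_const_mul]
        have := integral_variation_le hz hz0 hT
        gcongr

/-- The integral of the line amplitude against `e^{c r(s)}`. -/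
noncomputable def lineKernelIntegral (z α : ℂ) (p : ℤ) (c : ℂ) (T : ℝ) : ℂ :=
  ∫ s in (0 : ℝ)..T, Complex.exp (c * rad z s) * lineAmp z α p s

theorem lineKernelIntegral_osc_eq {z α : ℂ} (hz : 0 ≤ z.im) (hz0 : z ≠ 0) (hα0 : α ≠ 0)
    (hα : 0 ≤ α.re) (p : ℤ) {c T : ℝ} (hc : 0 ≤ c) (hT : 0 ≤ T) :
    lineKernelIntegral z α p (Complex.I * c) T =
      oscAmp z α p c T * oscExp z α c T - oscAmp z α p c 0 * oscExp z α c 0 -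
        ∫ s in (0 : ℝ)..T, oscAmpDeriv z α p c s * oscExp z α c s := by
  have h1 : IntervalIntegrable (fun s => oscAmpDeriv z α p c s * oscExp z α c s) volume 0 T := by
    refine ContinuousOn.intervalIntegrable fun s hs => ?_
    rw [uIcc_of_le hT] at hs
    exact (continuousAt_oscAmpDeriv_mul_oscExp hz hz0 hα0 hα p hc hs.1).continuousWithinAt
  have h2 : IntervalIntegrable (fun s => Complex.exp (Complex.I * c * rad z s) * lineAmp z α p s)
      volume 0 T := by
    refine ContinuousOn.intervalIntegrable fun s hs => ContinuousAt.continuousWithinAt ?_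
    rw [uIcc_of_le hT] at hs
    have h3 := continuousAt_lineAmp α hz hz0 p hs.1
    have h4 := (continuous_rad z).continuousAt (x := s)
    fun_prop
  have h3 := intervalIntegral.integral_eq_sub_of_hasDerivAt (a := 0) (b := T)
    (fun s hs => by
      rw [uIcc_of_le hT] at hs
      exact hasDerivAt_oscAmp_mul_oscExp hz hz0 hα0 hα p hc hs.1) (h1.add h2)
  rw [intervalIntegral.integral_add h1 h2] at h3
  rw [lineKernelIntegral, ← h3]
  ring

/-- The two boundary terms contribute 1 each, the slope 2 and the angle |p|π. The factor α of the
density has been absorbed by the division by the phase derivative. -/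
theorem norm_lineKernelIntegral_osc_le {z α : ℂ} (hz : 0 ≤ z.im) (hz0 : z ≠ 0)
    (hα : 0 ≤ α.re) (hα' : 0 ≤ α.im) (p : ℤ) {c T : ℝ} (hc : 0 ≤ c) (hT : 0 ≤ T) :
    ‖lineKernelIntegral z α p (Complex.I * c) T‖ ≤ 4 + |(p : ℝ)| * Real.pi := by
  rcases eq_or_ne α 0 with rfl | hα0
  · simp only [lineKernelIntegral, lineAmp, mul_zero, zero_mul, intervalIntegral.integral_zero,
      norm_zero]
    have := Real.pi_pos
    positivity
  rw [lineKernelIntegral_osc_eq hz hz0 hα0 hα p hc hT]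
  have h1 : ∀ s, 0 ≤ s → ‖oscAmp z α p c s * oscExp z α c s‖ ≤ 1 := fun s hs => by
    rw [norm_mul]
    exact mul_le_one₀ (norm_oscAmp_le hz hz0 hα p hc hs) (norm_nonneg _) (norm_oscExp_le hα' c hs)
  have h2 := (intervalIntegral.norm_integral_le_integral_norm hT).trans
    (integral_norm_oscAmpDeriv_le hz hz0 hα0 hα hα' p hc hT)
  refine (norm_sub_le _ _).trans ?_
  have h3 := (norm_sub_le (oscAmp z α p c T * oscExp z α c T)
    (oscAmp z α p c 0 * oscExp z α c 0))
  have h4 := h1 T hT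
  have h5 := h1 0 le_rfl
  linarith

/-! ### The exponentially decaying part of the line integrals -/

theorem norm_exp_neg_mul_rad (z : ℂ) (c s : ℝ) :
    ‖Complex.exp (-(c : ℂ) * rad z s)‖ = Real.exp (-(c * rad z s)) := by
  rw [Complex.norm_exp]; simp

/-- The decaying amplitude `e^{-c r(s)} e^{i p θ(s)}`. -/
noncomputable def decAmp (z : ℂ) (p : ℤ) (c s : ℝ) : ℂ :=
  Complex.exp (-(c : ℂ) * rad z s) * phase z p s

/-- The derivative of `decAmp`. -/
noncomputable def decAmpDeriv (z : ℂ) (p : ℤ) (c s : ℝ) : ℂ :=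
  decAmp z p c s * (-(c * slope z s : ℝ) + p * (Complex.I * (z.re / rad z s ^ 2 : ℝ)))

theorem norm_decAmp {z : ℂ} (hz : 0 ≤ z.im) (hz0 : z ≠ 0) (p : ℤ) (c : ℝ) {s : ℝ} (hs : 0 ≤ s) :
    ‖decAmp z p c s‖ = Real.exp (-(c * rad z s)) := by
  rw [decAmp, norm_mul, norm_exp_neg_mul_rad, norm_phase p (rad_pos hz hz0 hs), mul_one]

theorem exp_neg_mul_rad_le {z : ℂ} (hz : 0 ≤ z.im) {c s : ℝ} (hc : 0 ≤ c) (hs : 0 ≤ s) :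
    Real.exp (-(c * rad z s)) ≤ Real.exp (-(c * ‖z‖)) := by
  have := norm_le_rad hz hs
  gcongr

theorem hasDerivAt_decAmp {z : ℂ} (hz : 0 ≤ z.im) (hz0 : z ≠ 0) (p : ℤ) (c : ℝ) {s : ℝ}
    (hs : 0 ≤ s) : HasDerivAt (decAmp z p c) (decAmpDeriv z p c s) s := by
  have hr := rad_pos hz hz0 hs
  have h := ((hasDerivAt_rad hr).ofReal_comp.const_mul (-(c : ℂ))).cexp.mul (hasDerivAt_phase p hr)
  refine h.congr_deriv ?_
  rw [decAmpDeriv, decAmp]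
  push_cast
  ring

theorem norm_decAmpDeriv_le {z : ℂ} (hz : 0 ≤ z.im) (hz0 : z ≠ 0) (p : ℤ) {c s : ℝ} (hc : 0 ≤ c)
    (hs : 0 ≤ s) : ‖decAmpDeriv z p c s‖ ≤ c * slope z s * Real.exp (-(c * rad z s)) +
      |(p : ℝ)| * (|z.re| / rad z s ^ 2 * Real.exp (-(c * rad z s))) := by
  have hr := rad_pos hz hz0 hs
  rw [decAmpDeriv, norm_mul, norm_decAmp hz hz0 p c hs]
  have h := norm_add_le (-(c * slope z s : ℝ) : ℂ) (p * (Complex.I * (z.re / rad z s ^ 2 : ℝ)))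
  rw [norm_neg, norm_mul, norm_mul, Complex.norm_I, one_mul, Complex.norm_real, Complex.norm_real,
    Complex.norm_intCast, Real.norm_of_nonneg (mul_nonneg hc (slope_nonneg hz hs)),
    Real.norm_eq_abs, abs_div, abs_of_pos (pow_pos hr 2)] at h
  calc _ ≤ Real.exp (-(c * rad z s)) * (c * slope z s + |(p : ℝ)| * (|z.re| / rad z s ^ 2)) := by
        gcongr
    _ = _ := by ring

theorem integral_slope_mul_exp_le {z : ℂ} (hz : 0 ≤ z.im) (hz0 : z ≠ 0) (c : ℝ) {T : ℝ}
    (hT : 0 ≤ T) :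
    IntervalIntegrable (fun s => c * slope z s * Real.exp (-(c * rad z s))) volume 0 T ∧
    ∫ s in (0 : ℝ)..T, c * slope z s * Real.exp (-(c * rad z s)) ≤ Real.exp (-(c * ‖z‖)) := by
  have hi : IntervalIntegrable (fun s => c * slope z s * Real.exp (-(c * rad z s))) volume 0 T := by
    refine ContinuousOn.intervalIntegrable fun s hs => ContinuousAt.continuousWithinAt ?_
    rw [uIcc_of_le hT] at hs
    have h1 := continuousAt_slope (rad_pos hz hz0 hs.1)
    have h2 := (continuous_rad z).continuousAt (x := s)
    fun_prop
  have hd : ∀ s ∈ uIcc 0 T, HasDerivAt (fun s => -Real.exp (-(c * rad z s)))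
      (c * slope z s * Real.exp (-(c * rad z s))) s := by
    intro s hs
    rw [uIcc_of_le hT] at hs
    have h := ((hasDerivAt_rad (rad_pos hz hz0 hs.1)).const_mul c).neg.exp.neg
    refine h.congr_deriv ?_
    simp only [Pi.neg_apply]
    ring
  refine ⟨hi, ?_⟩
  rw [intervalIntegral.integral_eq_sub_of_hasDerivAt hd hi]
  have h0 : rad z 0 = ‖z‖ := by simp [rad]
  have := Real.exp_pos (-(c * rad z T))
  rw [h0]
  linarith

theorem intervalIntegrable_variation_mul_exp {z : ℂ} (hz : 0 ≤ z.im) (hz0 : z ≠ 0) (c : ℝ) {T : ℝ}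
    (hT : 0 ≤ T) :
    IntervalIntegrable (fun s => |z.re| / rad z s ^ 2 * Real.exp (-(c * rad z s))) volume 0 T := by
  refine ContinuousOn.intervalIntegrable fun s hs => ContinuousAt.continuousWithinAt ?_
  rw [uIcc_of_le hT] at hs
  have h4 := rad_pos hz hz0 hs.1
  have h2 := (continuous_rad z).continuousAt (x := s)
  have h3 := h4.ne'
  fun_prop (disch := positivity)

theorem integral_variation_mul_exp_le {z : ℂ} (hz : 0 ≤ z.im) (hz0 : z ≠ 0) {c T : ℝ}
    (hc : 0 ≤ c) (hT : 0 ≤ T) :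
    ∫ s in (0 : ℝ)..T, |z.re| / rad z s ^ 2 * Real.exp (-(c * rad z s)) ≤
      Real.pi * Real.exp (-(c * ‖z‖)) := by
  calc _ ≤ ∫ s in (0 : ℝ)..T, |z.re| / rad z s ^ 2 * Real.exp (-(c * ‖z‖)) := by
        refine intervalIntegral.integral_mono_on hT
          (intervalIntegrable_variation_mul_exp hz hz0 c hT)
          ((intervalIntegrable_variation hz hz0 hT).mul_const _) fun s hs => ?_
        have := exp_neg_mul_rad_le hz hc hs.1
        gcongr
    _ ≤ _ := by
        rw [intervalIntegral.integral_mul_const]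
        have := integral_variation_le hz hz0 hT
        gcongr

/-- From R ≤ Im z + s and |Re z| ≤ r the angular speed is at most r'/R, and c r' e^{-cr} integrates
exactly. This is the gain of 1/(cR) for large c. -/
theorem mul_integral_variation_mul_exp_le {z : ℂ} {R : ℝ} (hR : 0 < R) (hz : R ≤ z.im) {c T : ℝ}
    (hc : 0 ≤ c) (hT : 0 ≤ T) :
    c * R * ∫ s in (0 : ℝ)..T, |z.re| / rad z s ^ 2 * Real.exp (-(c * rad z s)) ≤
      Real.exp (-(c * ‖z‖)) := by
  have hz' : 0 ≤ z.im := hR.le.trans hz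
  have hz0 : z ≠ 0 := fun h => by simp [h] at hz; linarith
  obtain ⟨h1, h2⟩ := integral_slope_mul_exp_le hz' hz0 c hT
  refine le_trans ?_ h2
  rw [← intervalIntegral.integral_const_mul]
  refine intervalIntegral.integral_mono_on hT
    ((intervalIntegrable_variation_mul_exp hz' hz0 c hT).const_mul _) h1 fun s hs => ?_
  have hr := rad_pos hz' hz0 hs.1
  rw [← mul_assoc]
  refine mul_le_mul_of_nonneg_right ?_ (Real.exp_pos _).le
  rw [mul_assoc]
  refine mul_le_mul_of_nonneg_left ?_ hc
  rw [slope, ← mul_div_assoc, div_le_div_iff₀ (by positivity) hr, sq]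
  have h3 := abs_re_le_rad z s
  have h4 : R ≤ z.im + s := by linarith [hs.1]
  have h5 : R * |z.re| ≤ (z.im + s) * rad z s := by gcongr; linarith
  nlinarith

/-- Now iα e^{iαs} is integrated, with primitive bounded by 1 since Im α ≥ 0. The 3 counts two
boundary terms and the variation of e^{-cr}. -/
theorem norm_lineKernelIntegral_exp_le {z α : ℂ} (hz : 0 ≤ z.im) (hz0 : z ≠ 0)
    (hα' : 0 ≤ α.im) (p : ℤ) {c T : ℝ} (hc : 0 ≤ c) (hT : 0 ≤ T) :
    ‖lineKernelIntegral z α p (-(c : ℂ)) T‖ ≤ 3 * Real.exp (-(c * ‖z‖)) +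
      |(p : ℝ)| * ∫ s in (0 : ℝ)..T, |z.re| / rad z s ^ 2 * Real.exp (-(c * rad z s)) := by
  have hE : ∀ s : ℝ, HasDerivAt (fun s : ℝ => Complex.exp (Complex.I * α * s))
      (Complex.I * α * Complex.exp (Complex.I * α * s)) s := fun s => by
    have h := ((Complex.ofRealCLM.hasDerivAt (x := s)).const_mul (Complex.I * α)).cexp
    refine h.congr_deriv ?_
    simp [mul_comm]
  have hdc : ∀ s, 0 ≤ s → ContinuousAt (decAmp z p c) s := fun s hs =>
    (hasDerivAt_decAmp hz hz0 p c hs).continuousAt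
  have h1 : IntervalIntegrable (fun s : ℝ => decAmpDeriv z p c s * Complex.exp (Complex.I * α * s))
      volume 0 T := by
    refine ContinuousOn.intervalIntegrable fun s hs => ContinuousAt.continuousWithinAt ?_
    rw [uIcc_of_le hT] at hs
    have hr := rad_pos hz hz0 hs.1
    have h2 := hdc s hs.1
    have h3 := continuousAt_slope hr
    have h4 := (continuous_rad z).continuousAt (x := s)
    have h5 := hr.ne'
    have h6 : ContinuousAt (fun s => z.re / rad z s ^ 2) s := by
      fun_prop (disch := positivity)
    unfold decAmpDeriv
    fun_prop
  have h2 : IntervalIntegrable (fun s => Complex.exp (-(c : ℂ) * rad z s) * lineAmp z α p s)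
      volume 0 T := by
    refine ContinuousOn.intervalIntegrable fun s hs => ContinuousAt.continuousWithinAt ?_
    rw [uIcc_of_le hT] at hs
    have h3 := continuousAt_lineAmp α hz hz0 p hs.1
    have h4 := (continuous_rad z).continuousAt (x := s)
    fun_prop
  have h3 := intervalIntegral.integral_eq_sub_of_hasDerivAt (a := 0) (b := T)
    (f := fun s : ℝ => decAmp z p c s * Complex.exp (Complex.I * α * s))
    (fun s hs => by
      rw [uIcc_of_le hT] at hs
      refine ((hasDerivAt_decAmp hz hz0 p c hs.1).mul (hE s)).congr_deriv
        (g' := decAmpDeriv z p c s * Complex.exp (Complex.I * α * s) +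
          Complex.exp (-(c : ℂ) * rad z s) * lineAmp z α p s) ?_
      rw [lineAmp, decAmp]
      ring) (h1.add h2)
  rw [intervalIntegral.integral_add h1 h2] at h3
  have h4 : lineKernelIntegral z α p (-(c : ℂ)) T =
      decAmp z p c T * Complex.exp (Complex.I * α * T) -
      decAmp z p c 0 * Complex.exp (Complex.I * α * (0 : ℝ)) -
      ∫ s in (0 : ℝ)..T, decAmpDeriv z p c s * Complex.exp (Complex.I * α * s) := by
    rw [lineKernelIntegral, ← h3]; ring
  have hb : ∀ s : ℝ, 0 ≤ s → ‖decAmp z p c s * Complex.exp (Complex.I * α * s)‖ ≤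
      Real.exp (-(c * ‖z‖)) := fun s hs => by
    rw [norm_mul, norm_decAmp hz hz0 p c hs]
    exact (mul_le_of_le_one_right (Real.exp_pos _).le (norm_exp_I_mul_mul_le hα' hs)).trans
      (exp_neg_mul_rad_le hz hc hs)
  obtain ⟨h5, h6⟩ := integral_slope_mul_exp_le hz hz0 c hT
  have h7 := (intervalIntegrable_variation_mul_exp hz hz0 c hT).const_mul |(p : ℝ)|
  have h8 : ‖∫ s in (0 : ℝ)..T, decAmpDeriv z p c s * Complex.exp (Complex.I * α * s)‖ ≤
      ∫ s in (0 : ℝ)..T, (c * slope z s * Real.exp (-(c * rad z s)) +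
      |(p : ℝ)| * (|z.re| / rad z s ^ 2 * Real.exp (-(c * rad z s)))) := by
    refine intervalIntegral.norm_integral_le_of_norm_le hT
      (Eventually.of_forall fun s hs => ?_) (h5.add h7)
    rw [norm_mul]
    exact (mul_le_of_le_one_right (norm_nonneg _) (norm_exp_I_mul_mul_le hα' hs.1.le)).trans
      (norm_decAmpDeriv_le hz hz0 p hc hs.1.le)
  rw [intervalIntegral.integral_add h5 h7, intervalIntegral.integral_const_mul |(p : ℝ)|] at h8
  rw [h4]
  have h9 := norm_sub_le (decAmp z p c T * Complex.exp (Complex.I * α * T) -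
      decAmp z p c 0 * Complex.exp (Complex.I * α * (0 : ℝ)))
      (∫ s in (0 : ℝ)..T, decAmpDeriv z p c s * Complex.exp (Complex.I * α * s))
  have h10 := norm_sub_le (decAmp z p c T * Complex.exp (Complex.I * α * T))
      (decAmp z p c 0 * Complex.exp (Complex.I * α * (0 : ℝ)))
  have h11 := hb T hT
  have h12 := hb 0 le_rfl
  linarith

theorem norm_lineKernelIntegral_exp_le_pi {z α : ℂ} (hz : 0 ≤ z.im) (hz0 : z ≠ 0)
    (hα' : 0 ≤ α.im) (p : ℤ) {c T : ℝ} (hc : 0 ≤ c) (hT : 0 ≤ T) :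
    ‖lineKernelIntegral z α p (-(c : ℂ)) T‖ ≤
      (3 + |(p : ℝ)| * Real.pi) * Real.exp (-(c * ‖z‖)) := by
  refine (norm_lineKernelIntegral_exp_le hz hz0 hα' p hc hT).trans ?_
  rw [add_mul, mul_assoc |(p : ℝ)|]
  have := integral_variation_mul_exp_le hz hz0 hc hT
  gcongr

/-- The bounds π and 1/(kvR) for the angular variation are merged into one. The denominator 2v + 1
is chosen because at v = sinh t it dominates e^t. -/
theorem norm_lineKernelIntegral_exp_le_div {k R : ℝ} (hk : 0 < k) (hR : 0 < R) {z α : ℂ}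
    (hz : R ≤ z.im) (hα' : 0 ≤ α.im) (p : ℤ) {v T : ℝ} (hv : 0 ≤ v) (hT : 0 ≤ T) :
    ‖lineKernelIntegral z α p (-((k * v : ℝ) : ℂ)) T‖ ≤
      (3 + |(p : ℝ)| * ((Real.pi + 2 / (k * R)) / (2 * v + 1))) * Real.exp (-(k * v * ‖z‖)) := by
  have hz' : 0 ≤ z.im := hR.le.trans hz
  have hz0 : z ≠ 0 := fun h => by simp [h] at hz; linarith
  have hc : 0 ≤ k * v := by positivity
  refine (norm_lineKernelIntegral_exp_le hz' hz0 hα' p hc hT).trans ?_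
  rw [add_mul, mul_assoc |(p : ℝ)|]
  have h1 := integral_variation_mul_exp_le hz' hz0 hc hT
  have h2 := mul_integral_variation_mul_exp_le hR hz hc hT
  gcongr
  rw [div_mul_eq_mul_div, le_div_iff₀ (by positivity)]
  generalize ∫ s in (0 : ℝ)..T, |z.re| / rad z s ^ 2 * Real.exp (-(k * v * rad z s)) = J at h1 h2 ⊢
  have h3 : J * (2 * v) = 2 / (k * R) * (k * v * R * J) := by field_simp
  have h4 : 2 / (k * R) * (k * v * R * J) ≤ 2 / (k * R) * Real.exp (-(k * v * ‖z‖)) := by gcongr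
  nlinarith

/-! ### Line integrals of outgoing waves -/

theorem measurable_lineAmp (z α : ℂ) (p : ℤ) : Measurable (lineAmp z α p) := by
  have h := (continuous_rad z).measurable
  unfold lineAmp phase
  have h1 : Measurable fun s : ℝ => (z + s * Complex.I) / (rad z s : ℂ) := by fun_prop
  exact (h1.pow_const p).mul (by fun_prop)

/-- The integrand of the line image of an outgoing wave. -/
noncomputable def lineIntegrand (k : ℝ) (α : ℂ) (p : ℤ) (z : ℂ) (s : ℝ) : ℂ :=
  outgoingWave k p (z + s * Complex.I) * lineDensity α s

theorem lineIntegrand_eq (k : ℝ) (α : ℂ) (p : ℤ) {z : ℂ} (hz : 0 ≤ z.im) (hz0 : z ≠ 0) {s : ℝ}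
    (hs : 0 ≤ s) : lineIntegrand k α p z s =
      2 * (hankelTrig p (k * rad z s) * lineAmp z α p s) -
        2 * Complex.I / Real.pi * (hankelExp p (k * rad z s) * lineAmp z α p s) := by
  have hne := add_mul_I_ne_zero (rad_pos hz hz0 hs)
  rw [lineIntegrand, outgoingWave, exp_I_mul_int_mul_arg hne, ← rad, hankel_eq, lineDensity, lineAmp,
    phase]
  ring

theorem integrable_trig_kernel (k : ℝ) {α : ℂ} (hα' : 0 ≤ α.im) (p : ℤ) {z : ℂ} (hz : 0 ≤ z.im)
    (hz0 : z ≠ 0) (T : ℝ) :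
    Integrable (fun q : ℝ × ℝ => Complex.exp (-(Complex.I * p * q.2)) *
      (Complex.exp (Complex.I * (k * Real.sin q.2 : ℝ) * rad z q.1) * lineAmp z α p q.1))
      ((volume.restrict (Ioc 0 T)).prod (volume.restrict (Ioc 0 Real.pi))) := by
  have h1 : Measurable fun q : ℝ × ℝ => lineAmp z α p q.1 :=
    (measurable_lineAmp z α p).comp measurable_fst
  have h2 : Measurable fun q : ℝ × ℝ => rad z q.1 := (continuous_rad z).measurable.comp measurable_fst
  refine Integrable.of_bound (C := ‖α‖) (Measurable.aestronglyMeasurable ?_) ?_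
  · refine Measurable.mul (by fun_prop) (Measurable.mul ?_ h1)
    fun_prop
  · rw [Measure.prod_restrict]
    refine (ae_restrict_mem (measurableSet_Ioc.prod measurableSet_Ioc)).mono fun q hq => ?_
    rw [norm_mul, norm_mul, norm_exp_neg_I_mul_int_mul, one_mul, Complex.norm_exp]
    have := norm_lineAmp_le hz hz0 hα' p hq.1.1.le
    simpa using this

theorem integrable_exp_kernel {k : ℝ} (hk : 0 < k) {α : ℂ} (hα' : 0 ≤ α.im) (p : ℤ) {z : ℂ}
    (hz : 0 ≤ z.im) (hz0 : z ≠ 0) (T : ℝ) :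
    Integrable (fun q : ℝ × ℝ => (hankelKernel p q.2 : ℂ) *
      (Complex.exp (-((k * Real.sinh q.2 : ℝ) : ℂ) * rad z q.1) * lineAmp z α p q.1))
      ((volume.restrict (Ioc 0 T)).prod (volume.restrict (Ioi 0))) := by
  have hkz : 0 < k * ‖z‖ := mul_pos hk (norm_pos_iff.2 hz0)
  have h1 : Measurable fun q : ℝ × ℝ => lineAmp z α p q.1 :=
    (measurable_lineAmp z α p).comp measurable_fst
  have h2 : Measurable fun q : ℝ × ℝ => rad z q.1 := (continuous_rad z).measurable.comp measurable_fst
  have h3 : Measurable fun q : ℝ × ℝ => hankelKernel p q.2 :=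
    (continuous_hankelKernel p).measurable.comp measurable_snd
  have h4 : Measurable fun q : ℝ × ℝ => Real.sinh q.2 :=
    Real.continuous_sinh.measurable.comp measurable_snd
  refine Integrable.mono' (((integrableOn_expMoment p.natAbs hkz).const_mul (2 * ‖α‖)).comp_snd
    (volume.restrict (Ioc 0 T))) (Measurable.aestronglyMeasurable ?_) ?_
  · refine Measurable.mul (by fun_prop) (Measurable.mul ?_ h1)
    fun_prop
  · rw [Measure.prod_restrict]
    refine (ae_restrict_mem (measurableSet_Ioc.prod measurableSet_Ioi)).mono fun q hq => ?_
    have hs : 0 ≤ Real.sinh q.2 := Real.sinh_nonneg_iff.2 (le_of_lt hq.2)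
    have h5 := norm_lineAmp_le hz hz0 hα' p hq.1.1.le
    have h6 := abs_hankelKernel_le p (le_of_lt hq.2)
    have h7 := exp_neg_mul_rad_le hz (mul_nonneg hk.le hs) hq.1.1.le
    rw [norm_mul, norm_mul, norm_exp_neg_mul_rad, Complex.norm_real, Real.norm_eq_abs]
    calc _ ≤ 2 * Real.exp (p.natAbs * q.2) * (Real.exp (-(k * Real.sinh q.2 * ‖z‖)) * ‖α‖) := by
          gcongr
      _ = _ := by
          rw [show k * Real.sinh q.2 * ‖z‖ = k * ‖z‖ * Real.sinh q.2 by ring]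
          ring

/-- The trigonometric part of the line integral of an outgoing wave. -/
noncomputable def trigPart (k : ℝ) (α : ℂ) (p : ℤ) (z : ℂ) (T : ℝ) : ℂ :=
  ∫ t in (0 : ℝ)..Real.pi, Complex.exp (-(Complex.I * p * t)) *
    lineKernelIntegral z α p (Complex.I * (k * Real.sin t : ℝ)) T

/-- The exponential part of the line integral of an outgoing wave. -/
noncomputable def expPart (k : ℝ) (α : ℂ) (p : ℤ) (z : ℂ) (T : ℝ) : ℂ :=
  ∫ t in Ioi (0 : ℝ), (hankelKernel p t : ℂ) *
    lineKernelIntegral z α p (-((k * Real.sinh t : ℝ) : ℂ)) T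

theorem integral_trig (k : ℝ) {α : ℂ} (hα' : 0 ≤ α.im) (p : ℤ) {z : ℂ} (hz : 0 ≤ z.im)
    (hz0 : z ≠ 0) {T : ℝ} (hT : 0 ≤ T) :
    IntervalIntegrable (fun s => hankelTrig p (k * rad z s) * lineAmp z α p s) volume 0 T ∧
    ∫ s in (0 : ℝ)..T, hankelTrig p (k * rad z s) * lineAmp z α p s =
      1 / Real.pi * trigPart k α p z T ∧
    IntervalIntegrable (fun t : ℝ => Complex.exp (-(Complex.I * p * t)) *
      lineKernelIntegral z α p (Complex.I * (k * Real.sin t : ℝ)) T) volume 0 Real.pi := by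
  have hpi := Real.pi_pos
  have hF := integrable_trig_kernel k hα' p hz hz0 T
  have e1 : (fun s => hankelTrig p (k * rad z s) * lineAmp z α p s) = fun s => (1 / Real.pi : ℂ) *
      ∫ t in Ioc 0 Real.pi, Complex.exp (-(Complex.I * p * t)) *
      (Complex.exp (Complex.I * (k * Real.sin t : ℝ) * rad z s) * lineAmp z α p s) := by
    funext s
    rw [hankelTrig, intervalIntegral.integral_of_le hpi.le, mul_assoc, ← integral_mul_const]
    congr 1
    refine integral_congr_ae (Eventually.of_forall fun t => ?_)
    push_cast
    ring_nf
  have e2 : (fun t : ℝ => Complex.exp (-(Complex.I * p * t)) *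
      lineKernelIntegral z α p (Complex.I * (k * Real.sin t : ℝ)) T) = fun t : ℝ =>
      ∫ s in Ioc 0 T, Complex.exp (-(Complex.I * p * t)) *
      (Complex.exp (Complex.I * (k * Real.sin t : ℝ) * rad z s) * lineAmp z α p s) := by
    funext t
    rw [lineKernelIntegral, intervalIntegral.integral_of_le hT, ← integral_const_mul]
  refine ⟨?_, ?_, ?_⟩
  · rw [e1, intervalIntegrable_iff_integrableOn_Ioc_of_le hT]
    exact hF.integral_prod_left.const_mul _
  · rw [e1, intervalIntegral.integral_of_le hT, integral_const_mul, trigPart, e2,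
      intervalIntegral.integral_of_le hpi.le, integral_integral_swap hF]
  · rw [e2, intervalIntegrable_iff_integrableOn_Ioc_of_le hpi.le]
    exact hF.integral_prod_right

theorem integral_exp {k : ℝ} (hk : 0 < k) {α : ℂ} (hα' : 0 ≤ α.im) (p : ℤ) {z : ℂ} (hz : 0 ≤ z.im)
    (hz0 : z ≠ 0) {T : ℝ} (hT : 0 ≤ T) :
    IntervalIntegrable (fun s => hankelExp p (k * rad z s) * lineAmp z α p s) volume 0 T ∧
    ∫ s in (0 : ℝ)..T, hankelExp p (k * rad z s) * lineAmp z α p s = expPart k α p z T ∧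
    IntegrableOn (fun t : ℝ => (hankelKernel p t : ℂ) *
      lineKernelIntegral z α p (-((k * Real.sinh t : ℝ) : ℂ)) T) (Ioi 0) := by
  have hF := integrable_exp_kernel hk hα' p hz hz0 T
  have e1 : (fun s => (hankelExp p (k * rad z s) : ℂ) * lineAmp z α p s) = fun s =>
      ∫ t in Ioi (0 : ℝ), (hankelKernel p t : ℂ) *
      (Complex.exp (-((k * Real.sinh t : ℝ) : ℂ) * rad z s) * lineAmp z α p s) := by
    funext s
    rw [hankelExp, ← integral_complex_ofReal, ← integral_mul_const]
    refine integral_congr_ae (Eventually.of_forall fun t => ?_)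
    push_cast
    ring_nf
  have e2 : (fun t : ℝ => (hankelKernel p t : ℂ) *
      lineKernelIntegral z α p (-((k * Real.sinh t : ℝ) : ℂ)) T) = fun t : ℝ =>
      ∫ s in Ioc 0 T, (hankelKernel p t : ℂ) *
      (Complex.exp (-((k * Real.sinh t : ℝ) : ℂ) * rad z s) * lineAmp z α p s) := by
    funext t
    rw [lineKernelIntegral, intervalIntegral.integral_of_le hT, ← integral_const_mul]
  refine ⟨?_, ?_, ?_⟩
  · rw [e1, intervalIntegrable_iff_integrableOn_Ioc_of_le hT]
    exact hF.integral_prod_left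
  · rw [e1, intervalIntegral.integral_of_le hT, expPart, e2, integral_integral_swap hF]
  · rw [e2]
    exact hF.integral_prod_right

theorem integral_lineIntegrand {k : ℝ} (hk : 0 < k) {α : ℂ} (hα' : 0 ≤ α.im) (p : ℤ) {z : ℂ}
    (hz : 0 ≤ z.im) (hz0 : z ≠ 0) {T : ℝ} (hT : 0 ≤ T) :
    IntervalIntegrable (lineIntegrand k α p z) volume 0 T ∧
    ∫ s in (0 : ℝ)..T, lineIntegrand k α p z s =
      2 / Real.pi * trigPart k α p z T - 2 * Complex.I / Real.pi * expPart k α p z T := by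
  obtain ⟨h1, h2, -⟩ := integral_trig k hα' p hz hz0 hT
  obtain ⟨h3, h4, -⟩ := integral_exp hk hα' p hz hz0 hT
  have e : EqOn (lineIntegrand k α p z) (fun s =>
      2 * (hankelTrig p (k * rad z s) * lineAmp z α p s) -
        2 * Complex.I / Real.pi * (hankelExp p (k * rad z s) * lineAmp z α p s)) (uIcc 0 T) := by
    intro s hs
    rw [uIcc_of_le hT] at hs
    exact lineIntegrand_eq k α p hz hz0 hs.1
  have h5 := (h1.const_mul 2).sub (h3.const_mul (2 * Complex.I / Real.pi))
  refine ⟨h5.congr (e.symm.mono uIoc_subset_uIcc), ?_⟩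
  rw [intervalIntegral.integral_congr e, intervalIntegral.integral_sub (h1.const_mul 2)
    (h3.const_mul _), intervalIntegral.integral_const_mul, intervalIntegral.integral_const_mul,
    h2, h4]
  ring

/-! ### Uniform bounds for the partial line integrals -/

theorem norm_trigPart_le {k : ℝ} (hk : 0 < k) {α : ℂ} (hα : 0 ≤ α.re) (hα' : 0 ≤ α.im) (p : ℤ)
    {z : ℂ} (hz : 0 ≤ z.im) (hz0 : z ≠ 0) {T : ℝ} (hT : 0 ≤ T) :
    ‖trigPart k α p z T‖ ≤ (4 + |(p : ℝ)| * Real.pi) * Real.pi := by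
  have hpi := Real.pi_pos
  have h := intervalIntegral.norm_integral_le_of_norm_le_const (a := 0) (b := Real.pi)
    (C := 4 + |(p : ℝ)| * Real.pi) (f := fun t : ℝ => Complex.exp (-(Complex.I * p * t)) *
      lineKernelIntegral z α p (Complex.I * (k * Real.sin t : ℝ)) T) (fun t ht => by
      rw [uIoc_of_le hpi.le] at ht
      rw [norm_mul, norm_exp_neg_I_mul_int_mul, one_mul]
      exact norm_lineKernelIntegral_osc_le hz hz0 hα hα' p
        (mul_nonneg hk.le (Real.sin_nonneg_of_nonneg_of_le_pi ht.1.le ht.2)) hT)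
  rwa [sub_zero, abs_of_pos hpi] at h

theorem exp_div_le (l : ℕ) {t : ℝ} (ht : 0 ≤ t) :
    Real.exp ((l + 1 : ℕ) * t) / (2 * Real.sinh t + 1) ≤ Real.exp (l * t) := by
  have hs : 0 ≤ Real.sinh t := Real.sinh_nonneg_iff.2 ht
  rw [div_le_iff₀ (by positivity), show ((l + 1 : ℕ) : ℝ) * t = l * t + t by push_cast; ring,
    Real.exp_add]
  have := exp_le_two_mul_sinh_add_one ht
  gcongr

/-- The factor l + 1 from the angular variation is attached only to the moment of order l, because
division by 2 sinh t + 1 removes one factor e^t. -/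
theorem norm_expPart_le {k R : ℝ} (hk : 0 < k) (hR : 0 < R) {α : ℂ} (hα' : 0 ≤ α.im)
    {p : ℤ} {l : ℕ} (hp : p.natAbs = l + 1) {z : ℂ} (hz : R ≤ z.im) (hzR : 3 * R ≤ ‖z‖) {T : ℝ}
    (hT : 0 ≤ T) :
    ‖expPart k α p z T‖ ≤ 6 * expMoment (l + 1) (3 * (k * R)) +
      2 * (Real.pi + 2 / (k * R)) * ((l + 1) * expMoment l (3 * (k * R))) := by
  have hx : 0 < 3 * (k * R) := by positivity
  have hpi := Real.pi_pos
  have hpl : |(p : ℝ)| = l + 1 := by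
    rw [← Int.cast_abs, ← Nat.cast_natAbs, hp]; push_cast; rfl
  have h1 := (integrableOn_expMoment (l + 1) hx).const_mul 6
  have h2 := (integrableOn_expMoment l hx).const_mul (2 * (Real.pi + 2 / (k * R)) * (l + 1))
  have h3 : ‖expPart k α p z T‖ ≤ ∫ t in Ioi (0 : ℝ),
      (6 * (Real.exp ((l + 1 : ℕ) * t) * Real.exp (-(3 * (k * R) * Real.sinh t))) +
      2 * (Real.pi + 2 / (k * R)) * (l + 1) *
        (Real.exp (l * t) * Real.exp (-(3 * (k * R) * Real.sinh t)))) := by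
    refine norm_integral_le_of_norm_le (h1.add h2)
      ((ae_restrict_mem measurableSet_Ioi).mono fun t ht => ?_)
    have ht' : (0 : ℝ) ≤ t := le_of_lt ht
    have hs : 0 ≤ Real.sinh t := Real.sinh_nonneg_iff.2 ht'
    have h4 := abs_hankelKernel_le p ht'
    have h5 := norm_lineKernelIntegral_exp_le_div hk hR (α := α) hz hα' p hs hT
    have h6 : Real.exp (-(k * Real.sinh t * ‖z‖)) ≤ Real.exp (-(3 * (k * R) * Real.sinh t)) := by
      rw [Real.exp_le_exp, neg_le_neg_iff, show 3 * (k * R) * Real.sinh t =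
        k * Real.sinh t * (3 * R) by ring]
      gcongr
    have h7 := exp_div_le l ht'
    rw [hp] at h4
    rw [hpl] at h5
    rw [norm_mul, Complex.norm_real, Real.norm_eq_abs]
    calc _ ≤ 2 * Real.exp ((l + 1 : ℕ) * t) * ((3 + (l + 1) * ((Real.pi + 2 / (k * R)) /
          (2 * Real.sinh t + 1))) * Real.exp (-(3 * (k * R) * Real.sinh t))) := by
          gcongr
          refine h5.trans ?_
          gcongr
      _ = 6 * (Real.exp ((l + 1 : ℕ) * t) * Real.exp (-(3 * (k * R) * Real.sinh t))) +
          2 * (Real.pi + 2 / (k * R)) * (l + 1) * (Real.exp ((l + 1 : ℕ) * t) /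
          (2 * Real.sinh t + 1) * Real.exp (-(3 * (k * R) * Real.sinh t))) := by
          field_simp
          ring
      _ ≤ _ := by gcongr
  rw [integral_add h1 h2, integral_const_mul, integral_const_mul] at h3
  refine h3.trans (le_of_eq ?_)
  rw [expMoment, expMoment]
  ring

/-- Raising the order of the bound on the moment by one multiplies it by 2l/x, which compensates l +
1. For l = 0 monotonicity in the order suffices. -/
theorem succ_mul_expMoment_le (l : ℕ) {x : ℝ} (hx : 0 < x) :
    (l + 1) * expMoment l x ≤ (x + 1) * ((2 / x) ^ (l + 1) * l.factorial * Real.exp (x / 2)) := by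
  rcases l with _ | l
  · have h1 := expMoment_mono (Nat.zero_le 1) hx
    have h2 := expMoment_succ_le 0 hx
    have h3 : 0 ≤ (2 / x) ^ (0 + 1) * (Nat.factorial 0) * Real.exp (x / 2) := by positivity
    rw [zero_add] at h2
    push_cast
    nlinarith
  · have h2 := expMoment_succ_le l hx
    have e : (x * ((2 / x) ^ (l + 1 + 1) * (l + 1).factorial * Real.exp (x / 2))) =
        2 * (l + 1) * ((2 / x) ^ (l + 1) * l.factorial * Real.exp (x / 2)) := by
      rw [Nat.factorial_succ, pow_succ (2 / x) (l + 1)]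
      push_cast
      field_simp
    have h3 : 0 ≤ (2 / x) ^ (l + 1) * l.factorial * Real.exp (x / 2) := by positivity
    have h4 : 0 ≤ (2 / x) ^ (l + 1 + 1) * (l + 1).factorial * Real.exp (x / 2) := by positivity
    have h5 : (0 : ℝ) ≤ l := by positivity
    rw [add_mul x, e]
    push_cast
    nlinarith [mul_le_mul_of_nonneg_left h2 (by positivity : (0 : ℝ) ≤ (l : ℝ) + 1 + 1),
      mul_nonneg h5 h3]

/-- The constant in the bound for the partial line integrals. -/
noncomputable def lineConst (κ : ℝ) : ℝ :=
  16 + (4 + 4 / 3 * ((Real.pi + 2 / κ) * (3 * κ + 1)))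

theorem lineConst_pos {κ : ℝ} (hκ : 0 < κ) : 0 < lineConst κ := by
  have := Real.pi_pos
  unfold lineConst; positivity

/-- The majorant is the one for outgoing waves in `one_add_expMoment_succ_le`, up to `lineConst`.
Order 0 is never omitted by a truncation and so needs no bound. -/
theorem norm_integral_lineIntegrand_le {k R : ℝ} (hk : 0 < k) (hR : 0 < R) {α : ℂ}
    (hα : 0 ≤ α.re) (hα' : 0 ≤ α.im) {p : ℤ} {l : ℕ} (hp : p.natAbs = l + 1) {z : ℂ}
    (hz : R ≤ z.im) (hzR : 3 * R ≤ ‖z‖) {T : ℝ} (hT : 0 ≤ T) :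
    ‖∫ s in (0 : ℝ)..T, lineIntegrand k α p z s‖ ≤ lineConst (k * R) *
      (Real.exp (3 * (k * R) / 2) * ((l + 1) + (2 / (3 * (k * R))) ^ (l + 1) * l.factorial)) := by
  have hz' : 0 ≤ z.im := hR.le.trans hz
  have hz0 : z ≠ 0 := fun h => by simp [h] at hz; linarith
  have hκ : 0 < k * R := by positivity
  have hx : 0 < 3 * (k * R) := by positivity
  have hpi := Real.pi_pos
  have hpi3 := Real.pi_gt_three
  have hpi4 := Real.pi_le_four
  have hpl : |(p : ℝ)| = l + 1 := by
    rw [← Int.cast_abs, ← Nat.cast_natAbs, hp]; push_cast; rfl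
  rw [(integral_lineIntegrand hk hα' p hz' hz0 hT).2]
  refine (norm_sub_le _ _).trans ?_
  have h1 := norm_trigPart_le hk hα hα' p hz' hz0 hT
  have h2 := norm_expPart_le hk hR hα' hp hz hzR hT
  have h3 := expMoment_succ_le l hx
  have h4 := succ_mul_expMoment_le l hx
  set B : ℝ := (2 / (3 * (k * R))) ^ (l + 1) * l.factorial with hB
  set E : ℝ := Real.exp (3 * (k * R) / 2) with hE
  have hB0 : 0 ≤ B := by positivity
  have hE1 : 1 ≤ E := Real.one_le_exp (by positivity)
  have h5 : ‖expPart k α p z T‖ ≤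
      6 * (B * E) + 2 * (Real.pi + 2 / (k * R)) * ((3 * (k * R) + 1) * (B * E)) := by
    refine h2.trans ?_
    gcongr
  rw [norm_mul, norm_mul, norm_div, norm_div, norm_mul, Complex.norm_I, Complex.norm_real,
    Real.norm_of_nonneg hpi.le, Complex.norm_two, mul_one]
  have h6 : 2 / Real.pi * ‖trigPart k α p z T‖ ≤ 16 * (l + 1) := by
    rw [div_mul_eq_mul_div, div_le_iff₀ hpi]
    rw [hpl] at h1
    have h7 : (0 : ℝ) ≤ l := by positivity
    nlinarith [mul_nonneg h7 hpi.le]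
  have h7 : 2 / Real.pi * ‖expPart k α p z T‖ ≤ 2 / 3 * ‖expPart k α p z T‖ := by gcongr
  have h8 : 16 * ((l : ℝ) + 1) ≤ 16 * (E * ((l + 1) + B)) := by
    have h9 : (0 : ℝ) ≤ l := by positivity
    nlinarith [mul_nonneg h9 (sub_nonneg.2 hE1), mul_nonneg (by linarith : 0 ≤ E) hB0]
  have h9 : B * E ≤ E * ((l + 1) + B) := by
    have h9 : (0 : ℝ) ≤ l := by positivity
    nlinarith [mul_nonneg h9 (by linarith : 0 ≤ E)]
  have h10 : 2 / 3 * ‖expPart k α p z T‖ ≤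
      (4 + 4 / 3 * ((Real.pi + 2 / (k * R)) * (3 * (k * R) + 1))) * (B * E) := by
    nlinarith
  have h11 : (4 + 4 / 3 * ((Real.pi + 2 / (k * R)) * (3 * (k * R) + 1))) * (B * E) ≤
      (4 + 4 / 3 * ((Real.pi + 2 / (k * R)) * (3 * (k * R) + 1))) * (E * ((l + 1) + B)) := by
    gcongr
  rw [lineConst, add_mul]
  linarith

/-! ### Convergence of the line integrals -/

theorem image_sin_Ioo : Real.sin '' Ioo 0 (Real.pi / 2) = Ioo 0 1 := by
  ext v
  simp only [mem_image, mem_Ioo]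
  constructor
  · rintro ⟨t, ⟨h1, h2⟩, rfl⟩
    refine ⟨Real.sin_pos_of_pos_of_lt_pi h1 (by linarith [Real.pi_pos]), ?_⟩
    rw [← Real.sin_pi_div_two]
    exact Real.sin_lt_sin_of_lt_of_le_pi_div_two (by linarith [Real.pi_pos]) le_rfl h2
  · rintro ⟨h1, h2⟩
    exact ⟨Real.arcsin v, ⟨Real.arcsin_pos.2 h1, Real.arcsin_lt_pi_div_two.2 h2⟩,
      Real.sin_arcsin (by linarith) h2.le⟩

theorem tendsto_integral_exp_mul_sin_half (h : ℝ → ℂ) :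
    Tendsto (fun x : ℝ => ∫ t in (0 : ℝ)..Real.pi / 2,
      Complex.exp (Complex.I * (x * Real.sin t : ℝ)) * h t) atTop (𝓝 0) := by
  have hpi := Real.pi_pos
  set g : ℝ → ℂ := fun v => h (Real.arcsin v) / (Real.cos (Real.arcsin v) : ℂ) with hg
  have h1 := Real.tendsto_integral_exp_smul_cocompact ((Ioo (0 : ℝ) 1).indicator g)
  -- This frequency matches the normalisation e^{-2πivw} of the Fourier kernel after the
  -- substitution v = sin t.
  have h2 : Tendsto (fun x : ℝ => -(x / (2 * Real.pi))) atTop (cocompact ℝ) :=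
    (tendsto_neg_atTop_atBot.comp (tendsto_id.atTop_div_const (by positivity))).mono_right
      atBot_le_cocompact
  refine (h1.comp h2).congr fun x => ?_
  have hd : ∀ t ∈ Ioo (0 : ℝ) (Real.pi / 2),
      HasDerivWithinAt Real.sin (Real.cos t) (Ioo 0 (Real.pi / 2)) t :=
    fun t _ => (Real.hasDerivAt_sin t).hasDerivWithinAt
  have hsub : Ioo 0 (Real.pi / 2) ⊆ Icc (-(Real.pi / 2)) (Real.pi / 2) := fun t ht =>
    ⟨by linarith [ht.1], ht.2.le⟩
  have hi : InjOn Real.sin (Ioo 0 (Real.pi / 2)) := Real.injOn_sin.mono hsub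
  have h3 := integral_image_eq_integral_abs_deriv_smul measurableSet_Ioo hd hi
    (fun v => Complex.exp (Complex.I * (x * v : ℝ)) * g v)
  rw [image_sin_Ioo] at h3
  have h4 : ∫ t in (0 : ℝ)..Real.pi / 2, Complex.exp (Complex.I * (x * Real.sin t : ℝ)) * h t =
      ∫ t in Ioo 0 (Real.pi / 2), |Real.cos t| •
        (Complex.exp (Complex.I * (x * Real.sin t : ℝ)) * g (Real.sin t)) := by
    rw [intervalIntegral.integral_of_le (by positivity), integral_Ioc_eq_integral_Ioo]
    refine setIntegral_congr_fun measurableSet_Ioo fun t ht => ?_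
    have hc : 0 < Real.cos t := Real.cos_pos_of_mem_Ioo ⟨by linarith [ht.1], ht.2⟩
    have hc' : (Real.cos t : ℂ) ≠ 0 := by exact_mod_cast hc.ne'
    simp only [hg]
    rw [Real.arcsin_sin (by linarith [ht.1]) ht.2.le, abs_of_pos hc, Complex.real_smul]
    field_simp
  rw [h4, ← h3, ← integral_indicator measurableSet_Ioo]
  refine integral_congr_ae (Eventually.of_forall fun v => ?_)
  simp only [indicator]
  split_ifs
  · rw [Circle.smul_def, Real.fourierChar_apply, smul_eq_mul]
    congr 2
    push_cast
    field_simp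
  · simp

theorem tendsto_integral_exp_mul_sin {h : ℝ → ℂ} (hh : Continuous h) :
    Tendsto (fun x : ℝ => ∫ t in (0 : ℝ)..Real.pi,
      Complex.exp (Complex.I * (x * Real.sin t : ℝ)) * h t) atTop (𝓝 0) := by
  have h1 := (tendsto_integral_exp_mul_sin_half h).add
    (tendsto_integral_exp_mul_sin_half fun t => h (Real.pi - t))
  rw [add_zero] at h1
  refine h1.congr fun x => ?_
  have hc : Continuous fun t : ℝ => Complex.exp (Complex.I * (x * Real.sin t : ℝ)) * h t := by
    fun_prop
  have h2 := intervalIntegral.integral_comp_sub_left (a := 0) (b := Real.pi / 2)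
    (fun t : ℝ => Complex.exp (Complex.I * (x * Real.sin t : ℝ)) * h t) Real.pi
  simp only [Real.sin_pi_sub, sub_zero] at h2
  rw [h2, show Real.pi - Real.pi / 2 = Real.pi / 2 by ring]
  exact intervalIntegral.integral_add_adjacent_intervals (hc.intervalIntegrable _ _)
    (hc.intervalIntegrable _ _)

theorem tendsto_rad_atTop {z : ℂ} (hz : 0 ≤ z.im) : Tendsto (rad z) atTop atTop :=
  tendsto_atTop_mono (fun s => show s ≤ rad z s by linarith [im_add_le_rad z s]) tendsto_id

theorem one_sub_slope_le {z : ℂ} (hz : 0 ≤ z.im) (hz0 : z ≠ 0) {s : ℝ} (hs : 0 ≤ s) :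
    1 - slope z s ≤ |z.re| / rad z s := by
  have hr := rad_pos hz hz0 hs
  have h : rad z s ≤ |z.re| + (z.im + s) := by
    refine le_of_sq_le_sq ?_ (by positivity)
    rw [rad_sq, ← sq_abs z.re]
    nlinarith [mul_nonneg (abs_nonneg z.re) (add_nonneg hz hs)]
  rw [slope, le_div_iff₀ hr, sub_mul, div_mul_cancel₀ _ hr.ne']
  linarith

theorem tendsto_one_sub_slope {z : ℂ} (hz : 0 ≤ z.im) (hz0 : z ≠ 0) :
    Tendsto (fun s => 1 - slope z s) atTop (𝓝 0) := by
  refine squeeze_zero' (Eventually.of_forall fun s => by linarith [slope_le_one z s])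
    ((eventually_ge_atTop 0).mono fun s hs => one_sub_slope_le hz hz0 hs) ?_
  exact tendsto_const_nhds.div_atTop (tendsto_rad_atTop hz)

/-- For fixed t the boundary term is merely bounded. Integrated over t it oscillates with frequency
k r(T). Its amplitude depends on T only through the slope, which tends to 1, so it may be replaced
by its limit before Riemann–Lebesgue is applied. -/
theorem tendsto_boundary {k : ℝ} (hk : 0 < k) {α : ℂ} (hα0 : α ≠ 0) (hα : 0 ≤ α.re)
    (hα' : 0 ≤ α.im) (p : ℤ) {z : ℂ} (hz : 0 ≤ z.im) (hz0 : z ≠ 0) :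
    Tendsto (fun T : ℝ => ∫ t in (0 : ℝ)..Real.pi, Complex.exp (-(Complex.I * p * t)) *
      (oscAmp z α p (k * Real.sin t) T * oscExp z α (k * Real.sin t) T)) atTop (𝓝 0) := by
  have hpi := Real.pi_pos
  have hαp := norm_pos_iff.2 hα0
  -- The absolute value keeps D away from zero for every real t, so that the amplitude is continuous
  -- on the whole line; on [0, π] it changes nothing.
  set D : ℝ → ℝ → ℂ := fun c t => ((k * |Real.sin t| * c : ℝ) : ℂ) + α with hD
  have hD1 : ∀ c t, 0 ≤ c → ‖α‖ ≤ ‖D c t‖ := fun c t hc =>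
    norm_le_norm_ofReal_add hα (by positivity)
  have hD0 : ∀ c t, 0 ≤ c → D c t ≠ 0 := fun c t hc => norm_pos_iff.1 (hαp.trans_le (hD1 c t hc))
  set h : ℝ → ℝ → ℂ := fun c t => Complex.exp (-(Complex.I * p * t)) / D c t with hh
  have hhc : ∀ c, 0 ≤ c → Continuous (h c) := fun c hc => by
    refine Continuous.div (by fun_prop) (by fun_prop) fun t => hD0 c t hc
  have hdiff : ∀ c t, 0 ≤ c → c ≤ 1 → ‖h c t - h 1 t‖ ≤ k * (1 - c) / ‖α‖ ^ 2 := by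
    intro c t hc hc1
    have e : h c t - h 1 t = Complex.exp (-(Complex.I * p * t)) *
        ((k * |Real.sin t| * (1 - c) : ℝ) : ℂ) / (D c t * D 1 t) := by
      have h1 := hD0 c t hc
      have h2 := hD0 1 t zero_le_one
      simp only [hh]
      rw [div_sub_div _ _ h1 h2]
      congr 1
      simp only [hD]
      push_cast
      ring
    rw [e, norm_div, norm_mul, norm_exp_neg_I_mul_int_mul, one_mul, norm_mul, Complex.norm_real,
      Real.norm_of_nonneg (by have := sub_nonneg.2 hc1; positivity), sq]
    have h1 := hD1 c t hc
    have h2 := hD1 1 t zero_le_one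
    have h3 := Real.abs_sin_le_one t
    have h4 := sub_nonneg.2 hc1
    gcongr
    exact mul_le_of_le_one_right hk.le h3
  have hRL := ((tendsto_integral_exp_mul_sin (hhc 1 zero_le_one)).comp
    ((tendsto_rad_atTop hz).const_mul_atTop hk)).norm
  have hS : Tendsto (fun T => k * (1 - slope z T) / ‖α‖ ^ 2 * Real.pi) atTop (𝓝 0) := by
    simpa using (((tendsto_one_sub_slope hz hz0).const_mul k).div_const (‖α‖ ^ 2)).mul_const Real.pi
  have hlim := (hRL.add hS).const_mul ‖α‖
  rw [norm_zero, add_zero, mul_zero] at hlim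
  refine squeeze_zero_norm' ((eventually_ge_atTop 0).mono fun T hT => ?_) hlim
  have hr := rad_pos hz hz0 hT
  have hs0 := slope_nonneg hz hT
  have e1 : ∫ t in (0 : ℝ)..Real.pi, Complex.exp (-(Complex.I * p * t)) *
      (oscAmp z α p (k * Real.sin t) T * oscExp z α (k * Real.sin t) T) =
      α * phase z p T * Complex.exp (Complex.I * α * T) * ∫ t in (0 : ℝ)..Real.pi,
        Complex.exp (Complex.I * (k * rad z T * Real.sin t : ℝ)) * h (slope z T) t := by
    rw [← intervalIntegral.integral_const_mul]
    refine intervalIntegral.integral_congr fun t ht => ?_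
    rw [uIcc_of_le hpi.le] at ht
    have hsin := Real.sin_nonneg_of_nonneg_of_le_pi ht.1 ht.2
    have e2 : Complex.exp (Complex.I * (((k * Real.sin t : ℝ) : ℂ) * rad z T + α * T)) =
        Complex.exp (Complex.I * α * T) *
        Complex.exp (Complex.I * (k * rad z T * Real.sin t : ℝ)) := by
      rw [← Complex.exp_add]; congr 1; push_cast; ring
    simp only [oscAmp, oscExp, hh, hD, abs_of_nonneg hsin, e2]
    ring
  have e3 : ∫ t in (0 : ℝ)..Real.pi, Complex.exp (Complex.I * (k * rad z T * Real.sin t : ℝ)) *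
      h (slope z T) t = (∫ t in (0 : ℝ)..Real.pi,
        Complex.exp (Complex.I * (k * rad z T * Real.sin t : ℝ)) * h 1 t) +
      ∫ t in (0 : ℝ)..Real.pi, Complex.exp (Complex.I * (k * rad z T * Real.sin t : ℝ)) *
        (h (slope z T) t - h 1 t) := by
    have hc1 := hhc 1 zero_le_one
    have hc2 := hhc _ hs0
    rw [← intervalIntegral.integral_add]
    · refine intervalIntegral.integral_congr fun t _ => ?_
      ring
    all_goals exact Continuous.intervalIntegrable (by fun_prop) _ _
  have h5 : ‖∫ t in (0 : ℝ)..Real.pi, Complex.exp (Complex.I * (k * rad z T * Real.sin t : ℝ)) *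
      (h (slope z T) t - h 1 t)‖ ≤ k * (1 - slope z T) / ‖α‖ ^ 2 * Real.pi := by
    have := intervalIntegral.norm_integral_le_of_norm_le_const (a := 0) (b := Real.pi)
      (C := k * (1 - slope z T) / ‖α‖ ^ 2) (f := fun t : ℝ =>
        Complex.exp (Complex.I * (k * rad z T * Real.sin t : ℝ)) * (h (slope z T) t - h 1 t))
      (fun t _ => by
        rw [norm_mul, mul_comm Complex.I, Complex.norm_exp_ofReal_mul_I, one_mul]
        exact hdiff _ t hs0 (slope_le_one z T))
    rwa [sub_zero, abs_of_pos hpi] at this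
  rw [e1, norm_mul, norm_mul, norm_mul, norm_phase p hr, mul_one, e3]
  have h6 := norm_exp_I_mul_mul_le hα' hT
  refine mul_le_mul (mul_le_of_le_one_right (norm_nonneg _) h6) ?_ (norm_nonneg _) (norm_nonneg _)
  exact (norm_add_le _ _).trans (add_le_add le_rfl h5)

theorem integrableOn_oscAmpDeriv {z α : ℂ} (hz : 0 ≤ z.im) (hz0 : z ≠ 0) (hα0 : α ≠ 0)
    (hα : 0 ≤ α.re) (hα' : 0 ≤ α.im) (p : ℤ) {c : ℝ} (hc : 0 ≤ c) :
    IntegrableOn (fun s => oscAmpDeriv z α p c s * oscExp z α c s) (Ioi 0) := by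
  refine integrableOn_Ioi_of_intervalIntegral_norm_bounded (l := atTop) (b := fun T : ℝ => T)
    (|(p : ℝ)| * Real.pi + 2) 0 (fun T => ?_) tendsto_id
    ((eventually_ge_atTop 0).mono fun T hT =>
      integral_norm_oscAmpDeriv_le hz hz0 hα0 hα hα' p hc hT)
  rcases le_total 0 T with hT | hT
  · rw [← intervalIntegrable_iff_integrableOn_Ioc_of_le hT]
    refine ContinuousOn.intervalIntegrable fun s hs => ?_
    rw [uIcc_of_le hT] at hs
    exact (continuousAt_oscAmpDeriv_mul_oscExp hz hz0 hα0 hα p hc hs.1).continuousWithinAt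
  · rw [Ioc_eq_empty (not_lt.2 hT)]
    exact integrableOn_empty

/-- After removal of the boundary term at T, the remainder converges for each t and is dominated by
a constant, by the bounded variation estimates. -/
theorem exists_tendsto_trigPart {k : ℝ} (hk : 0 < k) {α : ℂ} (hα : 0 ≤ α.re) (hα' : 0 ≤ α.im)
    (p : ℤ) {z : ℂ} (hz : 0 ≤ z.im) (hz0 : z ≠ 0) :
    ∃ L, Tendsto (trigPart k α p z) atTop (𝓝 L) := by
  have hpi := Real.pi_pos
  rcases eq_or_ne α 0 with rfl | hα0
  · refine ⟨0, tendsto_const_nhds.congr fun T => ?_⟩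
    simp [trigPart, lineKernelIntegral, lineAmp]
  set bd : ℝ → ℝ → ℂ := fun T t =>
    oscAmp z α p (k * Real.sin t) T * oscExp z α (k * Real.sin t) T with hbd
  have hbdm : ∀ T, Measurable (bd T) := fun T => by
    simp only [hbd, oscAmp, oscExp]
    fun_prop
  have hbd1 : ∀ T t, 0 ≤ T → t ∈ Icc 0 Real.pi → ‖bd T t‖ ≤ 1 := fun T t hT ht => by
    have hc := mul_nonneg hk.le (Real.sin_nonneg_of_nonneg_of_le_pi ht.1 ht.2)
    simp only [hbd]
    rw [norm_mul]
    exact mul_le_one₀ (norm_oscAmp_le hz hz0 hα p hc hT) (norm_nonneg _) (norm_oscExp_le hα' _ hT)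
  have hbdi : ∀ T, 0 ≤ T → IntervalIntegrable (fun t : ℝ => Complex.exp (-(Complex.I * p * t)) *
      bd T t) volume 0 Real.pi := fun T hT => by
    rw [intervalIntegrable_iff_integrableOn_Ioc_of_le hpi.le]
    refine Measure.integrableOn_of_bounded (M := 1) measure_Ioc_lt_top.ne
      (Measurable.aestronglyMeasurable (by have := hbdm T; fun_prop)) ?_
    refine (ae_restrict_mem measurableSet_Ioc).mono fun t ht => ?_
    rw [norm_mul, norm_exp_neg_I_mul_int_mul, one_mul]
    exact hbd1 T t hT ⟨ht.1.le, ht.2⟩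
  have key : ∀ T t, 0 ≤ T → t ∈ Icc 0 Real.pi →
      lineKernelIntegral z α p (Complex.I * (k * Real.sin t : ℝ)) T - bd T t =
      -bd 0 t - ∫ s in (0 : ℝ)..T, oscAmpDeriv z α p (k * Real.sin t) s *
        oscExp z α (k * Real.sin t) s := fun T t hT ht => by
    have hc := mul_nonneg hk.le (Real.sin_nonneg_of_nonneg_of_le_pi ht.1 ht.2)
    rw [lineKernelIntegral_osc_eq hz hz0 hα0 hα p hc hT]
    simp only [hbd]
    ring
  have h1 := tendsto_boundary hk hα0 hα hα' p hz hz0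
  have h2 : Tendsto (fun T : ℝ => ∫ t in (0 : ℝ)..Real.pi, Complex.exp (-(Complex.I * p * t)) *
      (lineKernelIntegral z α p (Complex.I * (k * Real.sin t : ℝ)) T - bd T t)) atTop
      (𝓝 (∫ t in (0 : ℝ)..Real.pi, Complex.exp (-(Complex.I * p * t)) *
        (-bd 0 t - ∫ s in Ioi (0 : ℝ), oscAmpDeriv z α p (k * Real.sin t) s *
          oscExp z α (k * Real.sin t) s))) := by
    refine intervalIntegral.tendsto_integral_filter_of_dominated_convergence
      (fun _ => 1 + (|(p : ℝ)| * Real.pi + 2)) ?_ ?_ intervalIntegrable_const ?_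
    · refine (eventually_ge_atTop 0).mono fun T hT => ?_
      have h3 := (integral_trig k hα' p hz hz0 hT).2.2.sub (hbdi T hT)
      rw [intervalIntegrable_iff] at h3
      refine h3.aestronglyMeasurable.congr (Eventually.of_forall fun t => ?_)
      simp only [mul_sub]
    · refine (eventually_ge_atTop 0).mono fun T hT => Eventually.of_forall fun t ht => ?_
      rw [uIoc_of_le hpi.le] at ht
      have ht' : t ∈ Icc 0 Real.pi := ⟨ht.1.le, ht.2⟩
      have hc := mul_nonneg hk.le (Real.sin_nonneg_of_nonneg_of_le_pi ht'.1 ht'.2)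
      rw [norm_mul, norm_exp_neg_I_mul_int_mul, one_mul, key T t hT ht']
      refine (norm_sub_le _ _).trans (add_le_add ?_ ?_)
      · rw [norm_neg]; exact hbd1 0 t le_rfl ht'
      · exact (intervalIntegral.norm_integral_le_integral_norm hT).trans
          (integral_norm_oscAmpDeriv_le hz hz0 hα0 hα hα' p hc hT)
    · refine Eventually.of_forall fun t ht => ?_
      rw [uIoc_of_le hpi.le] at ht
      have ht' : t ∈ Icc 0 Real.pi := ⟨ht.1.le, ht.2⟩
      have hc := mul_nonneg hk.le (Real.sin_nonneg_of_nonneg_of_le_pi ht'.1 ht'.2)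
      have h3 := intervalIntegral_tendsto_integral_Ioi 0
        (integrableOn_oscAmpDeriv hz hz0 hα0 hα hα' p hc) tendsto_id
      refine Tendsto.const_mul _ ((h3.const_sub (-bd 0 t)).congr' ?_)
      exact (eventually_ge_atTop 0).mono fun T hT => (key T t hT ht').symm
  refine ⟨_, (h2.add h1).congr' ((eventually_ge_atTop 0).mono fun T hT => ?_)⟩
  have h3 := (integral_trig k hα' p hz hz0 hT).2.2
  rw [trigPart, ← intervalIntegral.integral_add _ (hbdi T hT)]
  · refine intervalIntegral.integral_congr fun t _ => ?_
    simp only [hbd]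
    ring
  · have h4 := h3.sub (hbdi T hT)
    simpa only [mul_sub] using h4

/-- For t > 0 the inner integral converges absolutely, but the bound |α|/(k sinh t) this gives is
not integrable at t = 0; the integration by parts supplies the dominating function. -/
theorem exists_tendsto_expPart {k : ℝ} (hk : 0 < k) {α : ℂ} (hα' : 0 ≤ α.im)
    (p : ℤ) {z : ℂ} (hz : 0 ≤ z.im) (hz0 : z ≠ 0) :
    ∃ L, Tendsto (expPart k α p z) atTop (𝓝 L) := by
  have hkz : 0 < k * ‖z‖ := mul_pos hk (norm_pos_iff.2 hz0)
  have hpi := Real.pi_pos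
  refine ⟨∫ t in Ioi (0 : ℝ), (hankelKernel p t : ℂ) * ∫ s in Ioi (0 : ℝ),
    Complex.exp (-((k * Real.sinh t : ℝ) : ℂ) * rad z s) * lineAmp z α p s, ?_⟩
  refine tendsto_integral_filter_of_dominated_convergence
    (fun t => 2 * (3 + |(p : ℝ)| * Real.pi) *
      (Real.exp (p.natAbs * t) * Real.exp (-(k * ‖z‖ * Real.sinh t)))) ?_ ?_
    ((integrableOn_expMoment p.natAbs hkz).const_mul _) ?_
  · exact (eventually_ge_atTop 0).mono fun T hT => (integral_exp hk hα' p hz hz0 hT).2.2.1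
  · refine (eventually_ge_atTop 0).mono fun T hT =>
      (ae_restrict_mem measurableSet_Ioi).mono fun t ht => ?_
    have ht' : (0 : ℝ) ≤ t := le_of_lt ht
    have hs : 0 ≤ k * Real.sinh t := mul_nonneg hk.le (Real.sinh_nonneg_iff.2 ht')
    have h1 := norm_lineKernelIntegral_exp_le_pi (α := α) hz hz0 hα' p hs hT
    have h2 := abs_hankelKernel_le p ht'
    rw [norm_mul, Complex.norm_real, Real.norm_eq_abs]
    calc _ ≤ 2 * Real.exp (p.natAbs * t) *
          ((3 + |(p : ℝ)| * Real.pi) * Real.exp (-(k * Real.sinh t * ‖z‖))) := by gcongr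
      _ = _ := by
          rw [show k * Real.sinh t * ‖z‖ = k * ‖z‖ * Real.sinh t by ring]
          ring
  · refine (ae_restrict_mem measurableSet_Ioi).mono fun t ht => ?_
    have hs : 0 < k * Real.sinh t := mul_pos hk (Real.sinh_pos_iff.2 ht)
    refine Tendsto.const_mul _ (intervalIntegral_tendsto_integral_Ioi 0 ?_ tendsto_id)
    have hm := measurable_lineAmp z α p
    have hr := (continuous_rad z).measurable
    refine Integrable.mono' ((exp_neg_integrableOn_Ioi 0 hs).const_mul ‖α‖)
      (Measurable.aestronglyMeasurable (by fun_prop)) ?_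
    refine (ae_restrict_mem measurableSet_Ioi).mono fun s hs' => ?_
    have hs0 : (0 : ℝ) ≤ s := le_of_lt hs'
    rw [norm_mul, norm_exp_neg_mul_rad, mul_comm]
    have h1 := norm_lineAmp_le hz hz0 hα' p hs0
    have h2 : s ≤ rad z s := by linarith [im_add_le_rad z s]
    rw [neg_mul]
    gcongr

theorem improperlyIntegrable_lineIntegrand {k : ℝ} (hk : 0 < k) {α : ℂ} (hα : 0 ≤ α.re)
    (hα' : 0 ≤ α.im) (p : ℤ) {z : ℂ} (hz : 0 ≤ z.im) (hz0 : z ≠ 0) :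
    ImproperlyIntegrable (lineIntegrand k α p z) := by
  refine ⟨fun T hT => (integral_lineIntegrand hk hα' p hz hz0 hT).1, ?_⟩
  obtain ⟨L₁, h1⟩ := exists_tendsto_trigPart hk hα hα' p hz hz0
  obtain ⟨L₂, h2⟩ := exists_tendsto_expPart hk hα' p hz hz0
  refine ⟨_, ((h1.const_mul (2 / Real.pi : ℂ)).sub
    (h2.const_mul (2 * Complex.I / Real.pi))).congr' ?_⟩
  exact (eventually_ge_atTop 0).mono fun T hT =>
    (integral_lineIntegrand hk hα' p hz hz0 hT).2.symm

/-! ### Improper integrals -/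

theorem ImproperlyIntegrable.tendsto {f : ℝ → ℂ} (h : ImproperlyIntegrable f) :
    Tendsto (fun T : ℝ => ∫ s in (0 : ℝ)..T, f s) atTop (𝓝 (improperIntegral f)) :=
  tendsto_nhds_limUnder h.2

theorem ImproperlyIntegrable.const_mul {f : ℝ → ℂ} (h : ImproperlyIntegrable f) (c : ℂ) :
    ImproperlyIntegrable fun s => c * f s := by
  refine ⟨fun T hT => (h.1 T hT).const_mul c, ?_⟩
  obtain ⟨L, hL⟩ := h.2
  refine ⟨c * L, (hL.const_mul c).congr fun T => ?_⟩
  rw [intervalIntegral.integral_const_mul]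

theorem sub_lineImage (x x₀ : ℂ) (s : ℝ) : x - lineImage x₀ s = x - conj x₀ + s * Complex.I := by
  rw [lineImage]; ring

theorem lineWave_eq (k : ℝ) (α : ℂ) (p : ℤ) (x xc : ℂ) :
    lineWave k α p x xc = lineIntegrand k α p (x - conj xc) := by
  funext s
  rw [lineWave, sub_lineImage, lineIntegrand]

theorem lineGreen_eq (k : ℝ) (α : ℂ) (x x₀ : ℂ) :
    lineGreen k α x x₀ = fun s => Complex.I / 4 * lineIntegrand k α 0 (x - conj x₀) s := by
  funext s
  rw [lineGreen, freeGreen, sub_lineImage, lineIntegrand, outgoingWave]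
  simp
  ring

/-! ### The error of the truncated line image expansion -/

theorem norm_lineDensity_le {α : ℂ} (hα' : 0 ≤ α.im) {s : ℝ} (hs : 0 ≤ s) :
    ‖lineDensity α s‖ ≤ 2 * ‖α‖ := by
  rw [lineDensity, norm_mul, norm_mul, norm_mul, Complex.norm_I, Complex.norm_two, mul_one]
  exact mul_le_of_le_one_right (by positivity) (norm_exp_I_mul_mul_le hα' hs)

/-- Sum and integral are exchanged at finite T, where the terms have a summable bound independent of
s. -/
theorem hasSum_integral_lineIntegrand {k R : ℝ} (hk : 0 < k) (hR : 0 < R) {α : ℂ}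
    (hα' : 0 ≤ α.im) {y z : ℂ} (hy : ‖y‖ ≤ R) (hz : 0 ≤ z.im) (hzR : 3 * R ≤ ‖z‖) {T : ℝ}
    (hT : 0 ≤ T) :
    HasSum (fun m : ℤ => sourceCoeff k y m * ∫ s in (0 : ℝ)..T, lineIntegrand k α m z s)
      (∫ s in (0 : ℝ)..T, hankel 0 (k * ‖z + s * Complex.I - y‖) * lineDensity α s) := by
  have hz0 : z ≠ 0 := norm_pos_iff.1 (by linarith)
  have hκ : 0 < k * R := by positivity
  have hsum := (summable_besselJ_mul_one_add_expMoment hκ (x := k * ‖y‖) (by positivity)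
    (by gcongr)).mul_right (2 * ‖α‖)
  simp_rw [← intervalIntegral.integral_const_mul]
  refine intervalIntegral.hasSum_integral_of_dominated_convergence (fun m _ =>
    |besselJ m (k * ‖y‖)| * (1 + expMoment m.natAbs (3 * (k * R))) * (2 * ‖α‖))
    (fun m => ?_) (fun m => Eventually.of_forall fun s hs => ?_)
    (Eventually.of_forall fun _ _ => hsum) intervalIntegrable_const
    (Eventually.of_forall fun s hs => ?_)
  · have h := ((integral_lineIntegrand hk hα' m hz hz0 hT).1).const_mul (sourceCoeff k y m)
    rw [intervalIntegrable_iff] at h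
    exact h.aestronglyMeasurable
  · rw [uIoc_of_le hT] at hs
    have h1 := norm_outgoingWave_le hk hR m (hzR.trans (norm_le_rad hz hs.1.le))
    have h2 := norm_lineDensity_le hα' hs.1.le
    have h3 : 0 ≤ 1 + expMoment m.natAbs (3 * (k * R)) :=
      add_nonneg zero_le_one (expMoment_nonneg _ _)
    rw [lineIntegrand, norm_mul, norm_sourceCoeff, norm_mul, mul_assoc]
    gcongr
  · rw [uIoc_of_le hT] at hs
    have h := (hasSum_graf hk hR hy (hzR.trans (norm_le_rad hz hs.1.le))).mul_right
      (lineDensity α s)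
    refine h.congr_fun fun m => ?_
    rw [lineIntegrand, sourceCoeff]
    ring

theorem norm_integral_sub_le {k R : ℝ} (hk : 0 < k) (hR : 0 < R) {α : ℂ} (hα : 0 ≤ α.re)
    (hα' : 0 ≤ α.im) (P : ℕ) {y z : ℂ} (hy : ‖y‖ ≤ R) (hz : R ≤ z.im) (hzR : 3 * R ≤ ‖z‖) {T : ℝ}
    (hT : 0 ≤ T) :
    ‖(∫ s in (0 : ℝ)..T, hankel 0 (k * ‖z + s * Complex.I - y‖) * lineDensity α s) -
      ∑ p ∈ Finset.Icc (-(P : ℤ)) P, sourceCoeff k y p * ∫ s in (0 : ℝ)..T, lineIntegrand k α p z s‖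
      ≤ 3 * (lineConst (k * R) * termConst (k * R) * ((1 / 3) ^ (P + 1) / (P + 1))) := by
  have hκ : 0 < k * R := by positivity
  have hl := lineConst_pos hκ
  have ht := termConst_pos hκ
  refine norm_sub_sum_Icc_le P (hasSum_integral_lineIntegrand hk hR hα' hy (hR.le.trans hz) hzR hT)
    (by positivity) fun l m hm => ?_
  have h1 := norm_integral_lineIntegrand_le hk hR hα hα' hm hz hzR hT
  have h2 := abs_besselJ_mul_le hκ (x := k * ‖y‖) (by positivity) (by gcongr) hm le_rfl
  rw [norm_mul, norm_sourceCoeff]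
  calc _ ≤ |besselJ m (k * ‖y‖)| * _ := mul_le_mul_of_nonneg_left h1 (abs_nonneg _)
    _ = lineConst (k * R) * (|besselJ m (k * ‖y‖)| * (Real.exp (3 * (k * R) / 2) *
        ((l + 1) + (2 / (3 * (k * R))) ^ (l + 1) * l.factorial))) := by ring
    _ ≤ lineConst (k * R) * (termConst (k * R) * ((1 / 3) ^ (l + 1) / (l + 1))) := by gcongr
    _ = _ := by ring

theorem norm_improperIntegral_sub_le {k R : ℝ} (hk : 0 < k) (hR : 0 < R) {α : ℂ} (hα : 0 ≤ α.re)
    (hα' : 0 ≤ α.im) (P : ℕ) {x x₀ xc : ℂ} (hy : ‖x₀ - xc‖ ≤ R) (hz : R ≤ (x - conj xc).im)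
    (hzR : 3 * R ≤ ‖x - conj xc‖) (hg : ImproperlyIntegrable (lineGreen k α x x₀))
    (hw : ∀ p : ℤ, ImproperlyIntegrable (lineWave k α p x xc)) :
    ‖improperIntegral (lineGreen k α x x₀) - Complex.I / 4 * ∑ p ∈ Finset.Icc (-(P : ℤ)) P,
      sourceCoeff k (conj (x₀ - xc)) p * improperIntegral (lineWave k α p x xc)‖ ≤
      lineConst (k * R) * termConst (k * R) * ((1 / 3) ^ (P + 1) / (P + 1)) := by
  have hκ : 0 < k * R := by positivity
  have hl := lineConst_pos hκ
  have ht := termConst_pos hκ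
  -- The truncated error involves finitely many improper integrals, so the bound that is uniform in
  -- T passes to the limit.
  have h1 := hg.tendsto.sub ((tendsto_finsetSum (Finset.Icc (-(P : ℤ)) P) fun p _ =>
    (hw p).tendsto.const_mul (sourceCoeff k (conj (x₀ - xc)) p)).const_mul (Complex.I / 4))
  refine le_of_tendsto h1.norm ((eventually_ge_atTop 0).mono fun T hT => ?_)
  have h2 := norm_integral_sub_le hk hR hα hα' P (y := conj (x₀ - xc))
    (by rwa [RCLike.norm_conj]) hz hzR hT
  have e : ∫ s in (0 : ℝ)..T, lineGreen k α x x₀ s = Complex.I / 4 * ∫ s in (0 : ℝ)..T,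
      hankel 0 (k * ‖x - conj xc + s * Complex.I - conj (x₀ - xc)‖) * lineDensity α s := by
    rw [← intervalIntegral.integral_const_mul]
    refine intervalIntegral.integral_congr fun s _ => ?_
    simp only [lineGreen, freeGreen, sub_lineImage, map_sub]
    rw [show x - conj xc + s * Complex.I - (conj x₀ - conj xc) =
      x - conj x₀ + s * Complex.I by ring, mul_assoc]
  simp only [lineWave_eq] at *
  rw [e, ← mul_sub, norm_mul, norm_div, Complex.norm_I]
  have h4 : ‖(4 : ℂ)‖ = 4 := by norm_num
  rw [h4]
  have h5 : 0 ≤ lineConst (k * R) * termConst (k * R) * ((1 / 3) ^ (P + 1) / (P + 1)) := by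
    positivity
  linarith

/-! ### Reflection of the coefficients -/

/-- Reflection reverses the angle. Working with (w/|w|)^(-m) avoids the branch cut of the argument,
where it is not odd under conjugation. -/
theorem conj_sourceCoeff (k : ℝ) (y : ℂ) (m : ℤ) :
    conj (sourceCoeff k y m) = sourceCoeff k (conj y) m := by
  rcases eq_or_ne y 0 with rfl | hy
  · simp [sourceCoeff]
  · have e : ∀ w : ℂ, w ≠ 0 → Complex.exp (-(Complex.I * m * Complex.arg w)) =
        (w / ‖w‖) ^ (-m) := fun w hw => by
      rw [← exp_I_mul_int_mul_arg hw]; congr 1; push_cast; ring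
    rw [sourceCoeff, sourceCoeff, e y hy, e (conj y) ((map_ne_zero _).2 hy), map_mul, map_zpow₀,
      map_div₀, Complex.conj_ofReal, Complex.conj_ofReal, RCLike.norm_conj]

theorem conj_multipoleCoeff (k : ℝ) {N : ℕ} (q : Fin N → ℝ) (xs : Fin N → ℂ) (xc : ℂ) (p : ℤ) :
    conj (multipoleCoeff k q xs xc p) = ∑ j, (q j : ℂ) * sourceCoeff k (conj (xs j - xc)) p := by
  rw [multipoleCoeff_eq, map_sum]
  refine Finset.sum_congr rfl fun j _ => ?_
  rw [map_mul, Complex.conj_ofReal, conj_sourceCoeff]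

theorem lineImage_sub_lineImage (x y : ℂ) (s : ℝ) :
    lineImage x s - lineImage y s = conj (x - y) := by
  rw [lineImage, lineImage, map_sub]; ring

theorem multipoleCoeff_lineImage (k : ℝ) {N : ℕ} (q : Fin N → ℝ) (xs : Fin N → ℂ) (xc : ℂ) (s : ℝ)
    (p : ℤ) : multipoleCoeff k q (fun j => lineImage (xs j) s) (lineImage xc s) p =
      conj (multipoleCoeff k q xs xc p) := by
  rw [conj_multipoleCoeff, multipoleCoeff_eq]
  simp only [lineImage_sub_lineImage]

/-! ### Geometry of the reflected configuration and splitting of the error. -/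

theorem norm_sub_le_norm_sub_conj {x y : ℂ} (hx : 0 ≤ x.im) (hy : 0 ≤ y.im) :
    ‖x - y‖ ≤ ‖x - conj y‖ := by
  refine le_of_sq_le_sq ?_ (norm_nonneg _)
  rw [Complex.sq_norm, Complex.sq_norm, Complex.normSq_apply, Complex.normSq_apply]
  simp
  nlinarith [mul_nonneg hx hy]

theorem WellSeparated.lineImage {R : ℝ} (hR : 0 < R) {N : ℕ} {xs : Fin N → ℂ} {xc x : ℂ}
    (h : WellSeparated R xs xc x) (hxc : R ≤ xc.im) (hx : 0 ≤ x.im) {s : ℝ} (hs : 0 ≤ s) :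
    WellSeparated R (fun j => lineImage (xs j) s) (lineImage xc s) x := by
  refine ⟨fun j => ?_, ?_⟩
  · rw [lineImage_sub_lineImage, RCLike.norm_conj]
    exact h.1 j
  · rw [sub_lineImage]
    refine h.2.trans ((norm_sub_le_norm_sub_conj hx (hR.le.trans hxc)).trans ?_)
    exact norm_le_rad (by simp; linarith) hs

theorem FreeSpaceAccuracy.lineImage {k R ε : ℝ} {P : ℕ} (h : FreeSpaceAccuracy k R P ε)
    {N : ℕ} (q : Fin N → ℝ) {xs : Fin N → ℂ} {xc x : ℂ} {s : ℝ}
    (hw : WellSeparated R (fun j => lineImage (xs j) s) (lineImage xc s) x) :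
    ‖(∑ j, (q j : ℂ) * freeGreen k x (lineImage (xs j) s)) -
      multipoleExpansion k P (fun p => conj (multipoleCoeff k q xs xc p)) x
        (lineImage xc s)‖ ≤ ε * ∑ j, |q j| := by
  have h1 := h N q _ _ _ hw
  simpa only [multipoleCoeff_lineImage, multipoleExpansion] using h1

theorem WellSeparated.source_im_nonneg {R : ℝ} {N : ℕ} {xs : Fin N → ℂ} {xc x : ℂ}
    (h : WellSeparated R xs xc x) (hxc : R ≤ xc.im) (j : Fin N) : 0 ≤ (xs j).im := by
  have h1 := (abs_le.1 ((Complex.abs_im_le_norm (xs j - xc)).trans (h.1 j))).1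
  rw [Complex.sub_im] at h1
  linarith

theorem WellSeparated.sub_conj_source_ne_zero {R : ℝ} (hR : 0 < R) {N : ℕ} {xs : Fin N → ℂ}
    {xc x : ℂ} (h : WellSeparated R xs xc x) (hxc : R ≤ xc.im) (hx : 0 ≤ x.im) (j : Fin N) :
    x - conj (xs j) ≠ 0 := by
  refine norm_pos_iff.1 (lt_of_lt_of_le ?_
    (norm_sub_le_norm_sub_conj hx (h.source_im_nonneg hxc j)))
  have h1 := norm_sub_norm_le (x - xc) (xs j - xc)
  rw [sub_sub_sub_cancel_right] at h1
  linarith [h.1 j, h.2]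

/-- By linearity the error splits into direct, point image and line image parts. The point images
are written as depth 0 so that the fixed-depth estimate applies. -/
theorem domain_error_decomposition (k : ℝ) (α : ℂ) (P : ℕ) {N : ℕ} (q : Fin N → ℝ)
    (xs : Fin N → ℂ) (xc x : ℂ) :
    (∑ j, (q j : ℂ) * domainGreen k α x (xs j)) -
        domainExpansion k α P (multipoleCoeff k q xs xc) x xc =
      ((∑ j, (q j : ℂ) * freeGreen k x (xs j)) -
        multipoleExpansion k P (multipoleCoeff k q xs xc) x xc) +
      ((∑ j, (q j : ℂ) * freeGreen k x (lineImage (xs j) 0)) -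
        multipoleExpansion k P (fun p => conj (multipoleCoeff k q xs xc p)) x (lineImage xc 0)) +
      ∑ j, (q j : ℂ) * (improperIntegral (lineGreen k α x (xs j)) -
        Complex.I / 4 * ∑ p ∈ Finset.Icc (-(P : ℤ)) P,
          sourceCoeff k (conj (xs j - xc)) p * improperIntegral (lineWave k α p x xc)) := by
  have h0 : ∀ w, lineImage w 0 = conj w := fun w => by simp [lineImage]
  simp only [domainGreen, domainExpansion, multipoleExpansion, h0, mul_add, mul_sub,
    Finset.sum_add_distrib, Finset.sum_sub_distrib]
  rw [← sum_sourceCoeff_mul P q (fun j => sourceCoeff k (conj (xs j - xc)))]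
  simp only [← conj_multipoleCoeff]
  ring

end HalfSpaceHelmholtz

/-! ### Choice of the constant and final estimate. -/

open HalfSpaceHelmholtz in
theorem mainTheorem1 :
    ∃ C : ℝ → ℝ, ∀ k R : ℝ, 0 < k → 0 < R →
      (∀ P : ℕ, FreeSpaceAccuracy k R P (C (k * R) * (1 / 3) ^ P)) ∧
      ∀ α : ℂ, 0 ≤ α.re → 0 ≤ α.im →
      ∀ (N : ℕ) (q : Fin N → ℝ) (xs : Fin N → ℂ) (xc x : ℂ),
        WellSeparated R xs xc x → R ≤ xc.im → 0 ≤ x.im →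
        (∀ s : ℝ, 0 ≤ s →
          WellSeparated R (fun j => lineImage (xs j) s) (lineImage xc s) x) ∧
        (∀ j, ImproperlyIntegrable (lineGreen k α x (xs j))) ∧
        (∀ p : ℤ, ImproperlyIntegrable (lineWave k α p x xc)) ∧
        ∀ (P : ℕ) (ε : ℝ), FreeSpaceAccuracy k R P ε →
          (∀ s : ℝ, 0 ≤ s →
            ‖(∑ j, (q j : ℂ) * freeGreen k x (lineImage (xs j) s)) -
              multipoleExpansion k P (fun p => conj (multipoleCoeff k q xs xc p)) x
                (lineImage xc s)‖ ≤ ε * ∑ j, |q j|) ∧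
          ‖(∑ j, (q j : ℂ) * domainGreen k α x (xs j)) -
            domainExpansion k α P (multipoleCoeff k q xs xc) x xc‖ ≤
              C (k * R) * ε * ∑ j, |q j| := by
  have hc : ∀ κ : ℝ, ∃ c : ℝ, 0 < κ → 0 < c ∧ ∀ k R : ℝ, 0 < k → 0 < R → k * R = κ →
      ∀ (P : ℕ) (ε : ℝ), FreeSpaceAccuracy k R P ε →
        c * ((1 / 3) ^ (P + 1) / (P + 1)) ≤ ε := fun κ => by
    by_cases h : 0 < κ
    · obtain ⟨c, hc⟩ := exists_le_accuracy h
      exact ⟨c, fun _ => hc⟩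
    · exact ⟨0, fun h' => absurd h' h⟩
  choose c hc using hc
  -- The first summand serves the free-space bound, the 2 the direct and point image errors (ε
  -- each), and the quotient converts the line image bound into a multiple of ε.
  refine ⟨fun κ => termConst κ + 2 + lineConst κ * termConst κ / c κ, fun k R hk hR => ?_⟩
  have hκ : 0 < k * R := mul_pos hk hR
  have ht := termConst_pos hκ
  have hl := lineConst_pos hκ
  obtain ⟨hc0, hcε⟩ := hc (k * R) hκ
  have hq : 0 < lineConst (k * R) * termConst (k * R) / c (k * R) := by positivity
  refine ⟨fun P N q xs xc x hw => ?_, fun α hα hα' N q xs xc x hw hxc hx => ?_⟩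
  · refine (freeSpaceAccuracy_termConst hk hR P N q xs xc x hw).trans ?_
    have : 0 ≤ ∑ j, |q j| := Finset.sum_nonneg fun _ _ => abs_nonneg _
    gcongr
    linarith
  have hxc0 : 0 ≤ xc.im := hR.le.trans hxc
  have hz : R ≤ (x - (starRingEnd ℂ) xc).im := by simp; linarith
  have hzR : 3 * R ≤ ‖x - (starRingEnd ℂ) xc‖ := hw.2.trans (norm_sub_le_norm_sub_conj hx hxc0)
  have hz0 : x - (starRingEnd ℂ) xc ≠ 0 := norm_pos_iff.1 (by linarith)
  have hws : ∀ s : ℝ, 0 ≤ s → WellSeparated R (fun j => lineImage (xs j) s) (lineImage xc s) x :=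
    fun s hs => hw.lineImage hR hxc hx hs
  have hg : ∀ j, ImproperlyIntegrable (lineGreen k α x (xs j)) := fun j => by
    rw [lineGreen_eq]
    refine (improperlyIntegrable_lineIntegrand hk hα hα' 0 ?_
      (hw.sub_conj_source_ne_zero hR hxc hx j)).const_mul _
    have := hw.source_im_nonneg hxc j
    simp
    linarith
  have hwv : ∀ p : ℤ, ImproperlyIntegrable (lineWave k α p x xc) := fun p => by
    rw [lineWave_eq]
    exact improperlyIntegrable_lineIntegrand hk hα hα' p (hR.le.trans hz) hz0
  refine ⟨hws, hg, hwv, fun P ε hε => ⟨fun s hs => hε.lineImage q (hws s hs), ?_⟩⟩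
  have hlow := hcε k R hk hR rfl P ε hε
  have hQ : 0 ≤ ∑ j, |q j| := Finset.sum_nonneg fun _ _ => abs_nonneg _
  -- Nonnegativity of ε is not assumed; it follows from the lower bound.
  have hε0 : 0 ≤ ε := le_trans (by positivity) hlow
  have h1 := hε N q xs xc x hw
  have h2 := hε.lineImage q (hws 0 le_rfl)
  have h3 := norm_sum_mul_le q _ fun j =>
    norm_improperIntegral_sub_le hk hR hα hα' P (hw.1 j) hz hzR (hg j) hwv
  have h4 : lineConst (k * R) * termConst (k * R) * ((1 / 3) ^ (P + 1) / (P + 1)) ≤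
      lineConst (k * R) * termConst (k * R) / c (k * R) * ε := by
    rw [div_mul_eq_mul_div, le_div_iff₀ hc0, mul_assoc, mul_comm _ (c (k * R))]
    gcongr
  rw [domain_error_decomposition]
  refine (norm_add₃_le).trans ?_
  have h5 := h3.trans (mul_le_mul_of_nonneg_right h4 hQ)
  calc _ ≤ ε * ∑ j, |q j| + ε * ∑ j, |q j| +
        lineConst (k * R) * termConst (k * R) / c (k * R) * ε * ∑ j, |q j| := by gcongr
    _ ≤ _ := by
        have : 0 ≤ termConst (k * R) * (ε * ∑ j, |q j|) := by positivity
        linarith
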